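/- **Upper bound on nondiagonal terms.** Let $d\ge 3$, $\mathrm e(x)=e^{2\pi i x}$, $\widehat W(y)=\int_{\mathbb R^d}W(x)\,\mathrm e(-x\cdot y)\,dx$ and $\tilde a(\xi,y)=\int_{\mathbb R^d}a(x,y)\,\mathrm e(-x\cdot\xi)\,dx$. Fix $\chi\in C_c^\infty(\mathbb R^d,\mathbb R)$, a non-increasing function of $\|z\|$, with $\chi(z)=1$ for $\|z\|<1$ and $\chi(z)=0$ for $\|z\|>2$. For $m\ge 1$, $\gamma\in\{0,1\}^m$ and $S\subset\{0,\dots,m\}$ with $0,m\in S$, for $r,\alpha,t>0$, a set $\mathcal P\subset\mathbb R^d$ and functions $\lambda,\Gamma:\mathbb R^d\to\mathbb R$, put $$w_j=\eta+r^{-d}\sum_{i\le j}z_i,\qquad \xi_j=\tfrac12\Big(\big\|y+\sum_{i\le j}(1-\gamma_i)z_i+r^d\eta\big\|^2-\big\|y-\sum_{i\le j}\gamma_iz_i\big\|^2\Big)\qquad(0\le j\le m)$$ and $$\begin{aligned}\mathcal A^{\alpha,r}_{\mathrm{nd},\gamma,S}(t)=&\sum_{(q_1,\dots,q_m)}\ \prod_{i=1}^m\lambda(r^{d-1}q_i)\int_{\mathbb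 R^{(m+2)d}}dy\,d\eta\,dz_1\cdots dz_m\ \prod_{i=1}^m\widehat W(z_i)\,\mathrm e(-r^{-1}q_i\cdot z_i)\\ &\times\int_{\mathbb R_{\ge0}^{m+1}}\delta(u_0+\cdots+u_m-r^{-d}t)\prod_{j=0}^m\mathrm e(\xi_ju_j)\,e^{-\alpha^d(1-\Gamma(\alpha w_j))u_j}\,du_0\cdots du_m\\ &\times\prod_{j\in S\setminus\{0,m\}}\chi(\alpha w_j)\prod_{j\notin S}\big(1-\chi(\alpha w_j)\big)\\ &\times\tilde a\Big(-\eta-r^{-d}\sum_{i=1}^mz_i,\ y-\sum_{i=1}^m\gamma_iz_i+\tfrac12\big(r^d\eta+\sum_{i=1}^mz_i\big)\Big)\,\tilde b\big(\eta,\,y+\tfrac12r^d\eta\big),\end{aligned}$$ where the sum runs over the nondiagonal tuples in $\mathcal P^m$. Here, with $S=\{0=s_1<\cdots<s_p=m\}$, a tuple is called diagonal if $q_j=q_{s_{i+1}}$ whenever $s_i<j\le s_{i+1}$, $1\le i\le p-1$. Let $W\in\mathcal S(\mathbb R^d)$, $a,b\in\mathcal S(\mathbb R^d\times\mathbb R^d)$,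 $\alpha,t>0$ and $b_{\mathcal P}>0$. Then there is a constant $C>0$, depending only on $d,\chi,\alpha,t,W,a,b$ and $b_{\mathcal P}$, such that $$\big|\mathcal A^{\alpha,r}_{\mathrm{nd},\gamma,S}(t)\big|\le C^m\,r\,\log_2\!\big(1+r^{1-d}b_{\mathcal P}^{-1}\big)\,\|\lambda\|_{1,\infty}^m,\qquad \|\lambda\|_{1,\infty}=\max\{\|\lambda\|_{L^1},\|\lambda\|_{L^\infty}\},$$ for all $r>0$, $m\ge1$, $\gamma$ and $S$ as above, all $\mathcal P\subset\mathbb R^d$ with $\|q-q'\|>b_{\mathcal P}$ for all distinct $q,q'\in\mathcal P$, all smooth $\lambda:\mathbb R^d\to\mathbb R$ supported in the closed unit ball, and all $\Gamma\in C_c^\infty(\mathbb R^d)$ with values in $[0,1]$, $\Gamma=1$ in a neighbourhood of the origin and $\Gamma(y)=0$ for $\|y\|>1$. -/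

import Mathlib

open MeasureTheory
open scoped ContDiff FourierTransform SchwartzMap RealInnerProductSpace

noncomputable section

namespace Lorentz

/-- Euclidean space `ℝ^d`, with the Euclidean norm and Lebesgue measure. -/
abbrev Space (d : ℕ) : Type := EuclideanSpace ℝ (Fin d)

/-- `e(x) = exp(2πix)`. -/
def e (x : ℝ) : ℂ := Complex.exp (2 * Real.pi * Complex.I * x)

/-- The conditions on the damping profile `Γ`. -/
structure IsDampingProfile {d : ℕ} (Γ : Space d → ℝ) : Prop where
  smooth : ContDiff ℝ ∞ Γ
  mem_Icc : ∀ y, Γ y ∈ Set.Icc (0 : ℝ) 1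
  eq_one_near_zero : ∀ᶠ y in nhds (0 : Space d), Γ y = 1
  eq_zero : ∀ y, 1 < ‖y‖ → Γ y = 0

/-- The conditions on the cut-off `χ` used to build the partition of unity. -/
structure IsRadialCutoff {d : ℕ} (χ : Space d → ℝ) : Prop where
  smooth : ContDiff ℝ ∞ χ
  antitone_norm : ∀ z w, ‖z‖ ≤ ‖w‖ → χ w ≤ χ z
  eq_one : ∀ z, ‖z‖ < 1 → χ z = 1
  eq_zero : ∀ z, 2 < ‖z‖ → χ z = 0

/-- The cut-off `λ`: smooth, with (compact) support contained in the unit ball. -/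
structure IsSpatialCutoff {d : ℕ} (lam : Space d → ℝ) : Prop where
  smooth : ContDiff ℝ ∞ lam
  support : tsupport lam ⊆ Metric.closedBall 0 1

/-- Distinct points of `P` are at distance greater than `bP`. -/
def IsSeparated {d : ℕ} (P : Set (Space d)) (bP : ℝ) : Prop :=
  ∀ q ∈ P, ∀ q' ∈ P, q ≠ q' → bP < ‖q - q'‖

/-- `‖λ‖_{1,∞} = max {‖λ‖_{L¹}, ‖λ‖_{L^∞}}`. -/
def normOneInf {d : ℕ} (lam : Space d → ℝ) : ℝ :=
  max (eLpNorm lam 1 volume).toReal (eLpNorm lam ⊤ volume).toReal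

/-- The partial Fourier transform `ã(ξ, y) = ∫ a(x, y) e(-x·ξ) dx`. -/
def tilde {d : ℕ} (a : 𝓢(Space d × Space d, ℂ)) (ξ y : Space d) : ℂ :=
  ∫ x : Space d, a (x, y) * e (-⟪x, ξ⟫)

/-- `∫_{△_m(T)} f(u_0, …, u_m) du_0 ⋯ du_m` over the simplex
`u_0 + ⋯ + u_m = T`, `u_j ≥ 0`, i.e. against `δ(u_0 + ⋯ + u_m - T) du_0 ⋯ du_m`: the variables
`u_1, …, u_m` are integrated against Lebesgue measure and `u_0 = T - u_1 - ⋯ - u_m`. -/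
def simplexIntegral (m : ℕ) (T : ℝ) (f : (Fin (m + 1) → ℝ) → ℂ) : ℂ :=
  ∫ v in {v : Fin m → ℝ | (∀ i, 0 ≤ v i) ∧ ∑ i, v i ≤ T}, f (Fin.cons (T - ∑ i, v i) v)

/-- `∑_{i=1}^{j} x_i` for `0 ≤ j ≤ m`; the entry `x i` (`i : Fin m`) is the one with number
`i + 1`. -/
def partialSum {d m : ℕ} (x : Fin m → Space d) (j : Fin (m + 1)) : Space d :=
  ∑ i : Fin m with i.castSucc < j, x i

/-- `γ_i ∈ {0,1}` as a real number. -/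
def gam {m : ℕ} (γ : Fin m → Fin 2) (i : Fin m) : ℝ := ((γ i : ℕ) : ℝ)

/-- `ξ_j = ½ (‖y + ∑_{i≤j} (1-γ_i) z_i + r^d η‖² - ‖y - ∑_{i≤j} γ_i z_i‖²)`. -/
def xi {d m : ℕ} (r : ℝ) (γ : Fin m → Fin 2) (y η : Space d) (z : Fin m → Space d)
    (j : Fin (m + 1)) : ℝ :=
  (‖y + partialSum (fun i => (1 - gam γ i) • z i) j + r ^ d • η‖ ^ 2
    - ‖y - partialSum (fun i => gam γ i • z i) j‖ ^ 2) / 2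

/-- `w_j = η + r^{-d} ∑_{i≤j} z_i`. -/
def offset {d m : ℕ} (r : ℝ) (η : Space d) (z : Fin m → Space d) (j : Fin (m + 1)) : Space d :=
  η + (r ^ d)⁻¹ • partialSum z j

/-- The element `χ^S` of the partition of unity, evaluated at `w_1, …, w_{m-1}`; the entries
`w_0`, `w_m` do not enter when `0, m ∈ S`. -/
def chiS {d m : ℕ} (χ : Space d → ℝ) (S : Finset (Fin (m + 1))) (w : Fin (m + 1) → Space d) : ℝ :=
  (∏ j ∈ S \ {0, Fin.last m}, χ (w j)) * ∏ j ∈ Sᶜ, (1 - χ (w j))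

/-- The integrand in `(y, η, z_1, …, z_m)` of the summand with scatterers `q_1, …, q_m`,
without the factor `λ(r^{d-1} q_1) ⋯ λ(r^{d-1} q_m)`. -/
def integrand {d m : ℕ} (W : 𝓢(Space d, ℂ)) (a b : 𝓢(Space d × Space d, ℂ)) (Γ χ : Space d → ℝ)
    (α t r : ℝ) (γ : Fin m → Fin 2) (S : Finset (Fin (m + 1))) (q : Fin m → Space d)
    (y η : Space d) (z : Fin m → Space d) : ℂ :=
  (∏ i, 𝓕 (⇑W) (z i)) * e (-(r⁻¹ * ∑ i, ⟪q i, z i⟫))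
    * simplexIntegral m ((r ^ d)⁻¹ * t) (fun u =>
        ∏ j, (e (xi r γ y η z j * u j)
          * (Real.exp (-(α ^ d * (1 - Γ (α • offset r η z j)) * u j)) : ℂ)))
    * (chiS χ S (fun j => α • offset r η z j) : ℂ)
    * tilde a (-η - (r ^ d)⁻¹ • ∑ i, z i)
        (y - ∑ i, gam γ i • z i + (1 / 2 : ℝ) • (r ^ d • η + ∑ i, z i))
    * tilde b η (y + ((1 / 2 : ℝ) * r ^ d) • η)

/-- With `S = {s_1 < ⋯ < s_p}`, `s_1 = 0`, `s_p = m`, the tuple `(q_1, …, q_m)` is diagonal if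
within each block `s_i < j ≤ s_{i+1}` all `q_j` are equal to `q_{s_{i+1}}`. Here `q j`
(`j : Fin m`) is the entry with number `j + 1 = j.succ`, and in the condition `k.succ = s_{i+1}`
is the first element of `S` that is at least `j.succ`. -/
def IsDiagonal {d m : ℕ} (S : Finset (Fin (m + 1))) (q : Fin m → Space d) : Prop :=
  ∀ j k : Fin m, j ≤ k → k.succ ∈ S → (∀ l : Fin m, j ≤ l → l < k → l.succ ∉ S) → q j = q k

/-- The nondiagonal term `A_{nd,γ,S}^{α,r}(t)`: the sum over all nondiagonal tuples of points
of `P`. -/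
def nondiagonalTerm {d m : ℕ} (P : Set (Space d)) (lam : Space d → ℝ) (W : 𝓢(Space d, ℂ))
    (a b : 𝓢(Space d × Space d, ℂ)) (Γ χ : Space d → ℝ) (α r t : ℝ)
    (γ : Fin m → Fin 2) (S : Finset (Fin (m + 1))) : ℂ :=
  ∑' q : {q : Fin m → Space d // (∀ i, q i ∈ P) ∧ ¬ IsDiagonal S q},
    (∏ i, (lam (r ^ (d - 1) • q.1 i) : ℂ))
      * ∫ v : Space d × Space d × (Fin m → Space d),
          integrand W a b Γ χ α t r γ S q.1 v.1 v.2.1 v.2.2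

end Lorentz

end

/-!
Only finitely many points `q` of `P` are seen by the cut-off `λ`, namely those with
`‖q‖ ≤ r^{1-d}`. If there is at most one, every tuple is diagonal and the sum vanishes. Otherwise
two of them are at a distance between `bP` and `2 r^{1-d}`; so `r` is bounded, the logarithm is
bounded below, there are `O(r^{d(1-d)})` visible scatterers, and it remains to gain one factor `r`.

Put `h = r^d` and let the scatterers sit at `q / r`. Starting from the final observable `a`, an
amplitude `R(p, p')` in two momenta is built up by alternately applying a scattering,
`R ↦ ∫ Ŵ(z) e(-q·z / r) R(p + (1 - γ) z, p' - γ z) dz`, and a stage of free evolution for the time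
`u_j`, with a multiplier in the momentum difference `w = (p - p') / h` (`chain`); at the end it is
paired with the initial observable `b` (`startPair`). The stages in `S` are the nodes. At the first
and the last one `b` and `a` make `w` essentially bounded; the multiplier of any other node is
supported in `‖w‖ ≤ 2 / α`. The multiplier of a stage outside `S` is `e^{-α^d u_j}` plus such a
compactly supported part, because `Γ (α w) = 0` wherever `χ (α w) ≠ 1`.

The amplitudes are measured by pairing them with wave packets (`packet`), localised in phase space
and freely evolved for some time. The claims `IsBound` are proved by induction from the last stage
backwards.

* The sum over all scatterers still to come is bounded. A scattering turns a packet into a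
  superposition of packets starting at the scatterer, with a weight that decays in the distance of
  the incoming packet from it, and these weights are summable since the scatterers are separated
  (`exists_bound_scatter`). At a node the two momenta are equal up to `O(h)`, so the pair of packets
  becomes a single one (`IsLineBound`), which no longer singles out a scatterer. The sum over the
  next scatterer costs their number, the restriction of the momenta gains `h^d`, and together this
  is `O(h)`, compensated by the duration `O(1 / h)` of the node (`exists_bound_stage`).
* The sum over the continuations that leave the present scatterer `c` within its block is smaller
  by `κ = r / bP`. The packets start at `c` and have to reach a scatterer at a distance at least
  `κ⁻¹`; by the decay of the weights this costs `κ`, times the deviation of the packets from packets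
  of momentum zero at `c` (`deviation`), which is controlled by the decay in momentum and by the
  damping in time.

The recursion over the stages gives `exists_bound_chain`. The initial observable is a superposition
of packets in a bounded region (`exists_sum_startPair_le`), and the time integral is at most a
product of one-dimensional ones (`sum_norm_setIntegral_le`).
-/

noncomputable section

namespace Lorentz

variable {d : ℕ}

/-! ### Polynomial decay -/

/-- The weight `(1 + ‖x‖)^{-N}`. -/
def decay (N : ℕ) {V : Type*} [Norm V] (x : V) : ℝ := ((1 + ‖x‖) ^ N)⁻¹

section Decay

variable {V : Type*} [NormedAddCommGroup V]

lemma decay_pos (N : ℕ) (x : V) : 0 < decay N x := by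
  unfold decay; positivity

lemma decay_le_one (N : ℕ) (x : V) : decay N x ≤ 1 := by
  unfold decay
  exact inv_le_one_of_one_le₀ (one_le_pow₀ (by linarith [norm_nonneg x]))

lemma decay_anti {N M : ℕ} (h : N ≤ M) (x : V) : decay M x ≤ decay N x := by
  unfold decay
  have := norm_nonneg x
  gcongr
  linarith

lemma decay_add (N M : ℕ) (x : V) : decay (N + M) x = decay N x * decay M x := by
  unfold decay
  rw [pow_add, mul_inv]

lemma one_add_norm_mul_decay (N : ℕ) (x : V) : (1 + ‖x‖) * decay (N + 1) x = decay N x := by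
  unfold decay
  have : (1 + ‖x‖) ≠ 0 := by have := norm_nonneg x; positivity
  rw [pow_succ]
  field_simp

lemma one_add_norm_add_le (x y : V) : 1 + ‖x + y‖ ≤ (1 + ‖x‖) * (1 + ‖y‖) := by
  nlinarith [norm_add_le x y, norm_nonneg x, norm_nonneg y]

lemma decay_le_of_le {N : ℕ} {x y : V} {c : ℝ}
    (h : 1 + ‖y‖ ≤ c * (1 + ‖x‖)) : decay N x ≤ c ^ N * decay N y := by
  unfold decay
  have hx : 0 < (1 + ‖x‖) := by have := norm_nonneg x; positivity
  have hy : 0 < (1 + ‖y‖) := by have := norm_nonneg y; positivity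
  rw [← div_eq_mul_inv, ← div_pow, ← inv_pow]
  gcongr
  rw [le_div_iff₀ hy, inv_mul_le_iff₀ hx]
  linarith

lemma decay_mul_decay_sub_le (N : ℕ) (x y : V) :
    decay N x * decay N (x - y) ≤ decay N y := by
  unfold decay
  rw [← mul_inv, ← mul_pow]
  have hx := norm_nonneg x
  have hy := norm_nonneg y
  gcongr
  have h := one_add_norm_add_le x (-(x - y))
  rw [norm_neg] at h
  simpa using h

lemma continuous_decay (N : ℕ) : Continuous (decay N : V → ℝ) := by
  unfold decay
  refine Continuous.inv₀ (by fun_prop) fun x => ?_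
  have := norm_nonneg x
  positivity

lemma integrable_decay [NormedSpace ℝ V] [FiniteDimensional ℝ V] [MeasurableSpace V]
    [BorelSpace V] (μ : Measure V) [μ.IsAddHaarMeasure] {N : ℕ} (hN : Module.finrank ℝ V < N) :
    Integrable (decay N : V → ℝ) μ := by
  have h := integrable_one_add_norm (E := V) (μ := μ) (r := N) (by exact_mod_cast hN)
  refine h.congr (Filter.Eventually.of_forall fun x => ?_)
  have := norm_nonneg x
  simp only [decay]
  rw [Real.rpow_neg (by positivity), Real.rpow_natCast]

end Decay

/-! ### Decay of Fourier integrals -/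

section FourierDecay

lemma one_add_pow_le (n : ℕ) {x : ℝ} (hx : 0 ≤ x) : (1 + x) ^ n ≤ 2 ^ n * (1 + x ^ n) := by
  rcases le_total x 1 with h | h
  · calc (1 + x) ^ n ≤ 2 ^ n := by gcongr; linarith
      _ ≤ 2 ^ n * (1 + x ^ n) := by
        have : 0 ≤ x ^ n := by positivity
        have h2 : (0 : ℝ) < 2 ^ n := by positivity
        nlinarith
  · calc (1 + x) ^ n ≤ (2 * x) ^ n := by gcongr; linarith
      _ = 2 ^ n * x ^ n := mul_pow _ _ _
      _ ≤ 2 ^ n * (1 + x ^ n) := by gcongr; linarith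

lemma le_decay_of_pow_mul_le {V : Type*} [NormedAddCommGroup V] {n : ℕ} {a K : ℝ} {x : V}
    (h0 : a ≤ K) (h1 : ‖x‖ ^ n * a ≤ K) (ha : 0 ≤ a) : a ≤ 2 ^ (n + 1) * K * decay n x := by
  unfold decay
  have hx : 0 < (1 + ‖x‖) ^ n := by have := norm_nonneg x; positivity
  rw [← div_eq_mul_inv, le_div_iff₀ hx]
  calc a * (1 + ‖x‖) ^ n ≤ a * (2 ^ n * (1 + ‖x‖ ^ n)) := by
        gcongr; exact one_add_pow_le n (norm_nonneg x)
    _ = 2 ^ n * (a + ‖x‖ ^ n * a) := by ring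
    _ ≤ 2 ^ n * (K + K) := by gcongr
    _ = 2 ^ (n + 1) * K := by ring

variable {V W : Type*} [NormedAddCommGroup V] [NormedSpace ℝ V] [FiniteDimensional ℝ V]
  [MeasurableSpace V] [BorelSpace V] [NormedAddCommGroup W] [NormedSpace ℝ W]

/-- A function whose first `n` derivatives are `O((1 + ‖v‖)^{-N})`, `N > dim V`, has a Fourier
transform that decays to order `n`, with a constant that depends on nothing else. -/
lemma abs_pow_mul_norm_fourierIntegral_le (μ : Measure V) [μ.IsAddHaarMeasure]
    (L : V →L[ℝ] W →L[ℝ] ℝ) (n : ℕ) :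
    ∃ C : ℝ, 0 ≤ C ∧ ∀ (f : V → ℂ) (K : ℝ), ContDiff ℝ ∞ f →
      (∀ l ≤ n, ∀ v, ‖iteratedFDeriv ℝ l f v‖ ≤ K * decay (Module.finrank ℝ V + 1) v) →
      ∀ (v : V) (w : W), |L v w| ^ n *
        ‖VectorFourier.fourierIntegral Real.fourierChar μ L.toLinearMap₁₂ f w‖ ≤
          ‖v‖ ^ n * (C * K) := by
  have hint : Integrable (decay (Module.finrank ℝ V + 1) : V → ℝ) μ :=
    integrable_decay μ (Nat.lt_succ_self _)
  refine ⟨2 ^ n * ∑ p ∈ Finset.range 1 ×ˢ Finset.range (n + 1),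
    ∫ v : V, decay (Module.finrank ℝ V + 1) v ∂μ, ?_, ?_⟩
  · exact mul_nonneg (by positivity) (Finset.sum_nonneg fun _ _ =>
      integral_nonneg fun v => (decay_pos _ v).le)
  intro f K hf hK v w
  have hi : ∀ l ≤ n, Integrable (fun v => ‖iteratedFDeriv ℝ l f v‖) μ := fun l hl =>
    (hint.const_mul K).mono'
      ((hf.continuous_iteratedFDeriv (mod_cast le_top)).norm.aestronglyMeasurable)
      (Filter.Eventually.of_forall fun v => by simpa using hK l hl v)
  have h := VectorFourier.pow_mul_norm_iteratedFDeriv_fourierIntegral_le (μ := μ) L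
    (K := 0) (N := n) (f := f) (hf.of_le (mod_cast le_top))
    (fun k l hk hl => by
      have hk0 : k = 0 := by simpa using hk
      subst hk0
      simpa using hi l (by exact_mod_cast hl)) (k := 0) (n := n) le_rfl le_rfl v w
  simp only [norm_iteratedFDeriv_zero, pow_zero, mul_one, Nat.cast_zero, mul_zero, zero_add] at h
  refine h.trans ?_
  rw [mul_assoc]
  refine mul_le_mul_of_nonneg_left ?_ (by positivity)
  rw [mul_assoc, Finset.sum_mul]
  refine mul_le_mul_of_nonneg_left ?_ (by positivity)
  refine Finset.sum_le_sum fun p hp => ?_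
  simp only [Finset.mem_product, Finset.mem_range] at hp
  have hp1 : p.1 = 0 := by omega
  rw [hp1, mul_comm _ K, ← integral_const_mul]
  simp only [pow_zero, one_mul]
  exact integral_mono (hi _ (by omega)) (hint.const_mul K) fun v => hK _ (by omega) v

end FourierDecay

lemma finrank_space : Module.finrank ℝ (Space d) = d := by simp

lemma fourier_decay (n : ℕ) : ∃ C : ℝ, 0 ≤ C ∧ ∀ (f : Space d → ℂ) (K : ℝ), ContDiff ℝ ∞ f →
    (∀ l ≤ n, ∀ v, ‖iteratedFDeriv ℝ l f v‖ ≤ K * decay (d + 1) v) →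
    ∀ w, ‖𝓕 f w‖ ≤ C * K * decay n w := by
  obtain ⟨C₀, hC₀, h₀⟩ := abs_pow_mul_norm_fourierIntegral_le (V := Space d) (W := Space d)
    volume (innerSL ℝ) 0
  obtain ⟨C₁, hC₁, h₁⟩ := abs_pow_mul_norm_fourierIntegral_le (V := Space d) (W := Space d)
    volume (innerSL ℝ) n
  simp only [finrank_space] at h₀ h₁
  refine ⟨2 ^ (n + 1) * (C₀ + C₁), by positivity, fun f K hf hK w => ?_⟩
  have e0 := h₀ f K hf (fun l hl => hK l (by omega)) w w
  have e1 := h₁ f K hf hK w w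
  change _ * ‖𝓕 f w‖ ≤ _ at e0
  change _ * ‖𝓕 f w‖ ≤ _ at e1
  have hK0 : 0 ≤ K := by
    have := (norm_nonneg _).trans (hK 0 (Nat.zero_le _) 0)
    exact nonneg_of_mul_nonneg_left this (decay_pos _ _)
  have e1' : ‖w‖ ^ n * ‖𝓕 f w‖ ≤ C₁ * K := by
    rcases eq_or_ne n 0 with rfl | hn
    · simpa using e1
    rcases eq_or_ne w 0 with rfl | hw
    · rw [norm_zero, zero_pow hn, zero_mul]; positivity
    · rw [innerSL_apply_apply, real_inner_self_eq_norm_sq, abs_of_nonneg (by positivity), pow_two,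
        mul_pow, mul_assoc] at e1
      exact le_of_mul_le_mul_left e1 (by have := norm_pos_iff.2 hw; positivity)
  have := le_decay_of_pow_mul_le (n := n) (a := ‖𝓕 f w‖) (K := (C₀ + C₁) * K) (x := w)
    (by simp only [pow_zero, one_mul] at e0; nlinarith) (by nlinarith) (norm_nonneg _)
  linarith

/-- The pairing `(x, y), (ξ, η) ↦ x·ξ + y·η` on `ℝ^d × ℝ^d`. -/
def prodInner (d : ℕ) : (Space d × Space d) →L[ℝ] (Space d × Space d) →L[ℝ] ℝ :=
  (((innerSL ℝ : Space d →L[ℝ] Space d →L[ℝ] ℝ).comp (ContinuousLinearMap.fst ℝ _ _)).flip.comp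
      (ContinuousLinearMap.fst ℝ _ _)).flip +
  (((innerSL ℝ : Space d →L[ℝ] Space d →L[ℝ] ℝ).comp (ContinuousLinearMap.snd ℝ _ _)).flip.comp
      (ContinuousLinearMap.snd ℝ _ _)).flip

lemma prodInner_apply (v w : Space d × Space d) :
    prodInner d v w = ⟪v.1, w.1⟫ + ⟪v.2, w.2⟫ := by
  simp [prodInner]

lemma fourier_decay_prod (n : ℕ) : ∃ C : ℝ, 0 ≤ C ∧ ∀ (f : Space d × Space d → ℂ) (K : ℝ),
    ContDiff ℝ ∞ f →
    (∀ l ≤ 2 * n, ∀ v, ‖iteratedFDeriv ℝ l f v‖ ≤ K * decay (d + d + 1) v) →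
    ∀ w : Space d × Space d, ‖VectorFourier.fourierIntegral Real.fourierChar volume
      (prodInner d).toLinearMap₁₂ f w‖ ≤ C * K * (decay n w.1 * decay n w.2) := by
  have : (volume : Measure (Space d × Space d)).IsAddHaarMeasure := by
    rw [Measure.volume_eq_prod]; infer_instance
  obtain ⟨C₀, hC₀, h₀⟩ := abs_pow_mul_norm_fourierIntegral_le
    (volume : Measure (Space d × Space d)) (prodInner d) 0
  obtain ⟨C₁, hC₁, h₁⟩ := abs_pow_mul_norm_fourierIntegral_le
    (volume : Measure (Space d × Space d)) (prodInner d) (2 * n)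
  simp only [Module.finrank_prod, finrank_space] at h₀ h₁
  refine ⟨2 ^ (2 * n + 1) * (C₀ + C₁), by positivity, fun f K hf hK w => ?_⟩
  set F := VectorFourier.fourierIntegral Real.fourierChar volume
      (prodInner d).toLinearMap₁₂ f w with hF
  have hK0 : 0 ≤ K := by
    have := (norm_nonneg _).trans (hK 0 (Nat.zero_le _) 0)
    exact nonneg_of_mul_nonneg_left this (decay_pos _ _)
  have e0 : ‖F‖ ≤ C₀ * K := by
    have := h₀ f K hf (fun l hl => hK l (by omega)) 0 w
    simpa using this
  have key : ∀ (x : Space d) (v : Space d × Space d), ‖v‖ = ‖x‖ → prodInner d v w = ‖x‖ ^ 2 →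
      ‖F‖ ≤ 2 ^ (2 * n + 1) * ((C₀ + C₁) * K) * decay (2 * n) x := by
    intro x v hv hvw
    have e1 := h₁ f K hf hK v w
    rw [hvw, hv, ← hF] at e1
    have e1' : ‖x‖ ^ (2 * n) * ‖F‖ ≤ C₁ * K := by
      rcases eq_or_ne n 0 with rfl | hn
      · simpa using e1
      rcases eq_or_ne x 0 with rfl | hw
      · rw [norm_zero, zero_pow (by omega), zero_mul]; positivity
      · rw [abs_of_nonneg (by positivity), pow_two, mul_pow, mul_assoc] at e1
        exact le_of_mul_le_mul_left e1 (by have := norm_pos_iff.2 hw; positivity)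
    exact le_decay_of_pow_mul_le (by nlinarith) (by nlinarith) (norm_nonneg _)
  have k1 := key w.1 (w.1, 0) (by simp [Prod.norm_def]) (by simp [prodInner_apply])
  have k2 := key w.2 (0, w.2) (by simp [Prod.norm_def]) (by simp [prodInner_apply])
  set D := 2 ^ (2 * n + 1) * ((C₀ + C₁) * K) with hD
  have hD0 : 0 ≤ D := by positivity
  have e1 : ∀ x : Space d, decay (2 * n) x = decay n x * decay n x := fun x => by
    rw [two_mul, decay_add]
  rw [e1] at k1 k2
  have p1 := decay_pos n w.1
  have p2 := decay_pos n w.2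
  rw [show 2 ^ (2 * n + 1) * (C₀ + C₁) * K = D by rw [hD]; ring]
  rcases le_total (decay n w.1) (decay n w.2) with h | h
  · exact k1.trans (by gcongr)
  · exact k2.trans (by gcongr)

/-! ### Localised Schwartz functions -/

lemma SchwartzMap.exists_decay {V : Type*} [NormedAddCommGroup V] [NormedSpace ℝ V]
    (f : 𝓢(V, ℂ)) (k n : ℕ) :
    ∃ C : ℝ, 0 ≤ C ∧ ∀ l ≤ n, ∀ v, ‖iteratedFDeriv ℝ l f v‖ ≤ C * decay k v := by
  refine ⟨2 ^ k * (Finset.Iic (k, n)).sup (fun m => SchwartzMap.seminorm ℝ m.1 m.2) f,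
    by positivity, fun l hl v => ?_⟩
  have h := SchwartzMap.one_add_le_sup_seminorm_apply (𝕜 := ℝ) (m := (k, n)) le_rfl hl f v
  have hv : 0 < (1 + ‖v‖) ^ k := by have := norm_nonneg v; positivity
  rw [decay, ← div_eq_mul_inv, le_div_iff₀ hv]
  linarith

section Schwartz

variable {V E : Type*} [NormedAddCommGroup V] [NormedSpace ℝ V] [NormedAddCommGroup E]
  [NormedSpace ℝ E]

lemma norm_iteratedFDeriv_mul_le_of_le {f g : V → ℂ} (hf : ContDiff ℝ ∞ f) (hg : ContDiff ℝ ∞ g)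
    {n l : ℕ} (hl : l ≤ n) {A B : ℝ} (v : V)
    (hA : ∀ i ≤ n, ‖iteratedFDeriv ℝ i f v‖ ≤ A) (hB : ∀ i ≤ n, ‖iteratedFDeriv ℝ i g v‖ ≤ B) :
    ‖iteratedFDeriv ℝ l (fun v => f v * g v) v‖ ≤ 2 ^ n * (A * B) := by
  have hA0 : 0 ≤ A := (norm_nonneg _).trans (hA 0 (Nat.zero_le _))
  have hB0 : 0 ≤ B := (norm_nonneg _).trans (hB 0 (Nat.zero_le _))
  refine (norm_iteratedFDeriv_mul_le hf hg v (n := l) (mod_cast le_top)).trans ?_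
  calc ∑ i ∈ Finset.range (l + 1), (l.choose i : ℝ) * ‖iteratedFDeriv ℝ i f v‖ *
        ‖iteratedFDeriv ℝ (l - i) g v‖
      ≤ ∑ i ∈ Finset.range (l + 1), (l.choose i : ℝ) * (A * B) := by
        refine Finset.sum_le_sum fun i hi => ?_
        rw [Finset.mem_range] at hi
        rw [mul_assoc]
        gcongr
        · exact hA i (by omega)
        · exact hB _ (by omega)
    _ = 2 ^ l * (A * B) := by
        rw [← Finset.sum_mul]
        congr 1
        exact_mod_cast Nat.sum_range_choose l
    _ ≤ 2 ^ n * (A * B) := by gcongr; norm_num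

lemma norm_iteratedFDeriv_comp_clm_le (L : V →L[ℝ] E) (hL : ‖L‖ ≤ 1) {g : E → ℂ}
    (hg : ContDiff ℝ ∞ g) (l : ℕ) (v : V) :
    ‖iteratedFDeriv ℝ l (fun v => g (L v)) v‖ ≤ ‖iteratedFDeriv ℝ l g (L v)‖ := by
  have h := L.iteratedFDeriv_comp_right (f := g) (hg.of_le (m := l) (mod_cast le_top)) v
    (i := l) le_rfl
  change ‖iteratedFDeriv ℝ l (g ∘ L) v‖ ≤ _
  rw [h]
  refine (ContinuousMultilinearMap.norm_compContinuousLinearMap_le _ _).trans ?_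
  refine mul_le_of_le_one_right (norm_nonneg _) ?_
  exact Finset.prod_le_one (fun _ _ => norm_nonneg _) fun _ _ => hL

/-- Cutting a Schwartz function off near `L v = ν` makes it small for large `ν`. -/
lemma exists_decay_mul_translate (f : 𝓢(V, ℂ)) (ψ : 𝓢(E, ℂ)) (L : V →L[ℝ] E) (hL : ‖L‖ ≤ 1)
    (n k M : ℕ) : ∃ C : ℝ, 0 ≤ C ∧ ∀ (ν : E) (l : ℕ), l ≤ n → ∀ v : V,
      ‖iteratedFDeriv ℝ l (fun v => f v * ψ (L v - ν)) v‖ ≤ C * decay M ν * decay k v := by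
  obtain ⟨A, hA0, hA⟩ := SchwartzMap.exists_decay f (M + k) n
  obtain ⟨B, hB0, hB⟩ := SchwartzMap.exists_decay ψ M n
  refine ⟨2 ^ n * (A * B), by positivity, fun ν l hl v => ?_⟩
  have hg : ContDiff ℝ ∞ (fun x : E => ψ (x - ν)) :=
    (ψ.smooth ⊤).comp (contDiff_id.sub contDiff_const)
  refine (norm_iteratedFDeriv_mul_le_of_le (f.smooth ⊤) (hg.comp L.contDiff) hl v
    (A := A * decay (M + k) v) (B := B * decay M (L v - ν)) (fun i hi => hA i hi v)
    fun i hi => ?_).trans ?_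
  · refine (norm_iteratedFDeriv_comp_clm_le L hL hg i v).trans ?_
    rw [iteratedFDeriv_comp_sub]
    exact hB i hi _
  · have hLv : ‖L v‖ ≤ ‖v‖ := (L.le_opNorm v).trans (mul_le_of_le_one_left (norm_nonneg _) hL)
    have h1 : decay M v ≤ decay M (L v) := by
      unfold decay
      have := norm_nonneg (L v)
      gcongr
    have h2 := decay_mul_decay_sub_le M (L v) ν
    have h3 : decay M v * decay M (L v - ν) ≤ decay M ν :=
      (mul_le_mul_of_nonneg_right h1 (decay_pos _ _).le).trans h2
    rw [decay_add]
    have h4 := (decay_pos k v).le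
    calc 2 ^ n * (A * (decay M v * decay k v) * (B * decay M (L v - ν)))
        = 2 ^ n * (A * B) * (decay M v * decay M (L v - ν)) * decay k v := by ring
      _ ≤ 2 ^ n * (A * B) * decay M ν * decay k v := by gcongr

end Schwartz

/-! ### The character `e` -/

lemma e_eq_fourierChar (x : ℝ) : e x = Real.fourierChar x := by
  rw [Real.fourierChar_apply, e]
  congr 1
  push_cast
  ring

lemma e_add (x y : ℝ) : e (x + y) = e x * e y := by
  rw [e, e, e, ← Complex.exp_add]
  congr 1
  push_cast
  ring

@[simp] lemma e_zero : e 0 = 1 := by simp [e]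

@[simp] lemma norm_e (x : ℝ) : ‖e x‖ = 1 := by
  rw [e_eq_fourierChar]; exact Circle.norm_coe _

lemma continuous_e : Continuous e := by
  unfold e
  fun_prop

@[fun_prop] lemma measurable_e : Measurable e := continuous_e.measurable

@[fun_prop] lemma contDiff_e {n : ℕ∞ω} : ContDiff ℝ n e := by
  unfold e
  have := Complex.ofRealCLM.contDiff (n := n)
  exact (contDiff_const.mul this).cexp

/-! ### Bump functions and wave packets -/

/-- A smooth nonnegative function supported in the unit ball, with integral `1`. -/
def bump (d : ℕ) : Space d → ℝ :=
  ContDiffBump.normed (⟨1 / 2, 1, by norm_num, by norm_num⟩ : ContDiffBump (0 : Space d)) volume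

/-- A smooth compactly supported function that is `1` on the ball of radius `2`. -/
def plateau (d : ℕ) : Space d → ℝ :=
  (⟨2, 3, by norm_num, by norm_num⟩ : ContDiffBump (0 : Space d))

lemma bump_nonneg (x : Space d) : 0 ≤ bump d x := ContDiffBump.nonneg_normed _ _

lemma contDiff_bump : ContDiff ℝ ∞ (bump d) := ContDiffBump.contDiff_normed _

@[fun_prop] lemma continuous_bump : Continuous (bump d) := contDiff_bump.continuous

lemma hasCompactSupport_bump : HasCompactSupport (bump d) :=
  ContDiffBump.hasCompactSupport_normed _

lemma integrable_bump : Integrable (bump d) :=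
  continuous_bump.integrable_of_hasCompactSupport hasCompactSupport_bump

lemma integral_bump : ∫ x, bump d x = 1 := ContDiffBump.integral_normed _

lemma bump_eq_zero {x : Space d} (hx : 1 ≤ ‖x‖) : bump d x = 0 := by
  by_contra h
  have h' : x ∈ Function.support (bump d) := h
  unfold bump at h'
  rw [ContDiffBump.support_normed_eq] at h'
  simp at h'
  linarith

lemma plateau_eq_one {x : Space d} (hx : ‖x‖ ≤ 2) : plateau d x = 1 :=
  ContDiffBump.one_of_mem_closedBall _ (by simpa using hx)

lemma contDiff_plateau : ContDiff ℝ ∞ (plateau d) := ContDiffBump.contDiff _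

lemma hasCompactSupport_plateau : HasCompactSupport (plateau d) := ContDiffBump.hasCompactSupport _

/-- `bump` as a complex Schwartz function. -/
def bumpS (d : ℕ) : 𝓢(Space d, ℂ) :=
  HasCompactSupport.toSchwartzMap (f := fun x => (bump d x : ℂ))
    (hasCompactSupport_bump.comp_left (g := fun x : ℝ => (x : ℂ)) (by simp))
    (Complex.ofRealCLM.contDiff.comp contDiff_bump)

/-- `plateau` as a complex Schwartz function. -/
def plateauS (d : ℕ) : 𝓢(Space d, ℂ) :=
  HasCompactSupport.toSchwartzMap (f := fun x => (plateau d x : ℂ))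
    (hasCompactSupport_plateau.comp_left (g := fun x : ℝ => (x : ℂ)) (by simp))
    (Complex.ofRealCLM.contDiff.comp contDiff_plateau)

@[simp] lemma bumpS_apply (x : Space d) : bumpS d x = bump d x := rfl

@[simp] lemma plateauS_apply (x : Space d) : plateauS d x = plateau d x := rfl

/-- The wave packet with momentum near `n`, position near `-x`, freely evolved for the
time `-U`. -/
def packet (x n : Space d) (U : ℝ) (p : Space d) : ℂ :=
  bump d (p - n) * e ⟪x, p⟫ * e (U / 2 * ‖p‖ ^ 2)

lemma norm_packet (x n : Space d) (U : ℝ) (p : Space d) :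
    ‖packet x n U p‖ = bump d (p - n) := by
  simp [packet, abs_of_nonneg (bump_nonneg _)]

lemma continuous_packet (x n : Space d) (U : ℝ) : Continuous (packet x n U) := by
  unfold packet
  have := continuous_e
  fun_prop

lemma integrable_bump_sub (n : Space d) : Integrable fun p => bump d (p - n) :=
  integrable_bump.comp_sub_right n

lemma integral_bump_sub (n : Space d) : ∫ p, bump d (p - n) = 1 := by
  rw [integral_sub_right_eq_self (bump d) n, integral_bump]

lemma integral_bump_sub' (p : Space d) : ∫ n, bump d (p - n) = 1 := by
  rw [integral_sub_left_eq_self (bump d) volume p, integral_bump]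

lemma exists_bump_le : ∃ C : ℝ, 0 ≤ C ∧ ∀ p : Space d, bump d p ≤ C := by
  obtain ⟨C, hC, h⟩ := SchwartzMap.exists_decay (bumpS d) 0 0
  refine ⟨C, hC, fun p => ?_⟩
  have := h 0 le_rfl p
  simpa [decay, abs_of_nonneg (bump_nonneg _)] using this

/-! ### Windowed Fourier transforms -/

/-- The windowed Fourier transform `∫ f(z) ψ(z - ν) e(x·z) dz`, `ψ` the plateau function. -/
def window (f : Space d → ℂ) (ν x : Space d) : ℂ :=
  ∫ z, f z * plateau d (z - ν) * e ⟪x, z⟫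

lemma window_eq_fourier (f : Space d → ℂ) (ν x : Space d) :
    window f ν x = 𝓕 (fun z => f z * plateauS d (z - ν)) (-x) := by
  rw [window, Real.fourier_eq]
  congr 1
  ext z
  rw [Circle.smul_def, smul_eq_mul, mul_comm, e_eq_fourierChar, plateauS_apply, inner_neg_right,
    neg_neg, real_inner_comm]

lemma exists_window_le (f : 𝓢(Space d, ℂ)) (M n : ℕ) :
    ∃ C : ℝ, 0 ≤ C ∧ ∀ ν x, ‖window f ν x‖ ≤ C * (decay M ν * decay n x) := by
  obtain ⟨C, hC, h⟩ := fourier_decay (d := d) n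
  obtain ⟨D, hD, h'⟩ := exists_decay_mul_translate f (plateauS d)
    (ContinuousLinearMap.id ℝ (Space d)) ContinuousLinearMap.norm_id_le n (d + 1) M
  refine ⟨C * D, by positivity, fun ν x => ?_⟩
  rw [window_eq_fourier]
  have hs : ContDiff ℝ ∞ (fun z => f z * plateauS d (z - ν)) :=
    (f.smooth ⊤).mul (((plateauS d).smooth ⊤).comp (contDiff_id.sub contDiff_const))
  have := h (fun z => f z * plateauS d (z - ν)) (D * decay M ν) hs (fun l hl v => h' ν l hl v) (-x)
  rw [show decay n (-x) = decay n x by simp [decay]] at this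
  calc _ ≤ _ := this
    _ = _ := by ring

lemma continuous_window {g : Space d → ℂ} (hg : Continuous g) {A : ℝ}
    (hA : ∀ z, ‖g z‖ ≤ A * decay (d + 1) z) :
    Continuous fun θ : Space d × Space d => window g θ.1 θ.2 := by
  obtain ⟨B, hB, h'⟩ := SchwartzMap.exists_decay (plateauS d) 0 0
  unfold window
  have := continuous_e
  have hp : Continuous (plateau d) := contDiff_plateau.continuous
  refine continuous_of_dominated (bound := fun z => A * decay (d + 1) z * B) (fun θ => ?_)
    (fun θ => ?_) ?_ ?_
  · exact Continuous.aestronglyMeasurable (by fun_prop)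
  · refine Filter.Eventually.of_forall fun z => ?_
    rw [norm_mul, norm_e, mul_one, norm_mul]
    have h2 := h' 0 le_rfl (z - θ.1)
    simp only [norm_iteratedFDeriv_zero] at h2
    exact mul_le_mul (hA z) (h2.trans (mul_le_of_le_one_right hB (decay_le_one _ _)))
      (norm_nonneg _) ((norm_nonneg _).trans (hA z))
  · exact ((integrable_decay volume (by simp)).const_mul A).mul_const B
  · refine Filter.Eventually.of_forall fun z => ?_
    fun_prop

lemma integrable_decay_space {N : ℕ} (hN : d < N) : Integrable (decay N : Space d → ℝ) :=
  integrable_decay volume (by simpa using hN)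

lemma integrable_window (f : 𝓢(Space d, ℂ)) :
    Integrable fun θ : Space d × Space d => window f θ.1 θ.2 := by
  obtain ⟨C, hC, h⟩ := exists_window_le f (d + 1) (d + 1)
  have hi := integrable_decay_space (Nat.lt_succ_self d)
  obtain ⟨A, -, hA⟩ := SchwartzMap.exists_decay f (d + 1) 0
  exact ((hi.mul_prod hi).const_mul C).mono' (continuous_window f.continuous
    fun z => by simpa using hA 0 le_rfl z).aestronglyMeasurable
    (Filter.Eventually.of_forall fun θ => h θ.1 θ.2)

/-- Fourier inversion for the windowed transform. -/
lemma integral_window {g : Space d → ℂ} (hg : Continuous g) (ν z : Space d) {C : ℝ}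
    (hC : ∀ x, ‖window g ν x‖ ≤ C * decay (d + 1) x) :
    ∫ x, window g ν x * e (-⟪x, z⟫) = g z * plateau d (z - ν) := by
  set F : Space d → ℂ := fun z => g z * plateauS d (z - ν) with hF
  have hp : Continuous (plateau d) := contDiff_plateau.continuous
  have hc : Continuous F := by
    have := (plateauS d).continuous
    fun_prop
  have hFi : Integrable F := by
    refine hc.integrable_of_hasCompactSupport (HasCompactSupport.mul_left ?_)
    have := (hasCompactSupport_plateau (d := d)).comp_homeomorph (Homeomorph.subRight ν)
    exact this.comp_left (g := fun x : ℝ => (x : ℂ)) (by simp)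
  have hFF : Integrable (𝓕 F) := by
    refine ((integrable_decay_space (Nat.lt_succ_self d)).const_mul C).mono'
      (VectorFourier.fourierIntegral_continuous Real.continuous_fourierChar
        (innerSL ℝ).continuous₂ hFi).aestronglyMeasurable (Filter.Eventually.of_forall fun x => ?_)
    have := hC (-x)
    rw [window_eq_fourier, neg_neg, show decay (d + 1) (-x) = decay (d + 1) x by simp [decay]]
      at this
    exact this
  have hinv := congrFun (hc.fourierInv_fourier_eq hFi hFF) z
  rw [Real.fourierInv_eq] at hinv
  rw [← integral_neg_eq_self]
  refine Eq.trans ?_ (hinv.trans (by simp [hF]))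
  congr 1
  ext x
  rw [window_eq_fourier, neg_neg, inner_neg_left, neg_neg, Circle.smul_def, smul_eq_mul,
    e_eq_fourierChar, mul_comm]

lemma exists_window_le_decay (f : 𝓢(Space d, ℂ)) :
    ∃ C : ℝ, ∀ ν x, ‖window f ν x‖ ≤ C * decay (d + 1) x := by
  obtain ⟨C, hC, h⟩ := exists_window_le f 0 (d + 1)
  refine ⟨C, fun ν x => (h ν x).trans ?_⟩
  rw [← mul_assoc]
  have := (decay_pos (d + 1) x).le
  gcongr
  exact mul_le_of_le_one_right hC (decay_le_one _ _)

/-- The total mass of a wave packet, `∫ φ(p - n) e(X·p) e(U‖p‖²/2) dp`. -/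
def packetMass (X n : Space d) (U : ℝ) : ℂ := ∫ p, packet X n U p

lemma packetMass_eq (X n : Space d) (U : ℝ) :
    ‖packetMass X n U‖ = ‖𝓕 (fun s => (bump d s : ℂ) * e (U / 2 * ‖s‖ ^ 2)) (-(X + U • n))‖ := by
  have : packetMass X n U = e (⟪X, n⟫ + U / 2 * ‖n‖ ^ 2) *
      𝓕 (fun s => (bump d s : ℂ) * e (U / 2 * ‖s‖ ^ 2)) (-(X + U • n)) := by
    rw [packetMass, ← integral_add_right_eq_self _ n, Real.fourier_eq, ← integral_const_mul]
    congr 1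
    ext s
    rw [Circle.smul_def, smul_eq_mul, packet, ← e_eq_fourierChar, add_sub_cancel_right]
    rw [show e (⟪X, n⟫ + U / 2 * ‖n‖ ^ 2) * (e (-⟪s, -(X + U • n)⟫) *
      (↑(bump d s) * e (U / 2 * ‖s‖ ^ 2))) = bump d s * (e (⟪X, n⟫ + U / 2 * ‖n‖ ^ 2) *
        e (-⟪s, -(X + U • n)⟫) * e (U / 2 * ‖s‖ ^ 2)) by ring, mul_assoc, ← e_add, ← e_add, ← e_add]
    congr 2
    rw [inner_neg_right, neg_neg, inner_add_right, inner_add_right, inner_smul_right,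
      norm_add_sq_real, real_inner_comm s X]
    ring
  rw [this, norm_mul, norm_e, one_mul]

lemma norm_iteratedFDeriv_e_le (n i : ℕ) (hi : i ≤ n) (x : ℝ) :
    ‖iteratedFDeriv ℝ i e x‖ ≤ (2 * Real.pi) ^ n := by
  have key : ∀ i : ℕ, iteratedDeriv i e = fun x => (2 * Real.pi * Complex.I) ^ i * e x := by
    intro i
    induction i with
    | zero => simp
    | succ i ih =>
      rw [iteratedDeriv_succ, ih]
      ext x
      have h : HasDerivAt e (2 * Real.pi * Complex.I * e x) x := by
        have h1 : HasDerivAt (fun x : ℝ => 2 * Real.pi * Complex.I * (x : ℂ))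
            (2 * Real.pi * Complex.I * 1) x := (Complex.ofRealCLM.hasDerivAt).const_mul _
        exact h1.cexp.congr_deriv (by rw [e]; ring)
      rw [(h.const_mul _).deriv]
      ring
  rw [norm_iteratedFDeriv_eq_norm_iteratedDeriv, key, norm_mul, norm_e, mul_one, norm_pow]
  have h1 : ‖(2 * Real.pi * Complex.I : ℂ)‖ = 2 * Real.pi := by
    simp [abs_of_pos Real.pi_pos]
  rw [h1]
  exact pow_le_pow_right₀ (by linarith [Real.pi_gt_three]) hi

lemma exists_packetMass_le_pow (N : ℕ) : ∃ C : ℝ, 0 ≤ C ∧ ∀ (X n : Space d) (U : ℝ),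
    ‖packetMass X n U‖ ≤ C * (1 + |U|) ^ N * decay N (X + U • n) := by
  obtain ⟨C, hC, h⟩ := fourier_decay (d := d) N
  obtain ⟨A, hA, hA'⟩ := SchwartzMap.exists_decay (bumpS d) 0 N
  set q : Space d → ℝ := fun s => ‖s‖ ^ 2 with hq
  have hqs : ContDiff ℝ ∞ q := contDiff_norm_sq ℝ
  have hB : ∃ B : ℝ, 1 ≤ B ∧ ∀ i ≤ N, ∀ s : Space d, ‖s‖ ≤ 1 → ‖iteratedFDeriv ℝ i q s‖ ≤ B := by
    have h1 : ∀ i : ℕ, ∃ B : ℝ, ∀ s : Space d, ‖s‖ ≤ 1 → ‖iteratedFDeriv ℝ i q s‖ ≤ B := by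
      intro i
      obtain ⟨B, hB⟩ := (isCompact_closedBall (0 : Space d) 1).exists_bound_of_continuousOn
        (hqs.continuous_iteratedFDeriv (m := i) (mod_cast le_top)).continuousOn
      exact ⟨B, fun s hs => hB s (by simpa using hs)⟩
    choose B hB using h1
    refine ⟨1 + ∑ i ∈ Finset.range (N + 1), |B i|,
      by linarith [Finset.sum_nonneg fun i (_ : i ∈ Finset.range (N + 1)) => abs_nonneg (B i)],
      fun i hi s hs => (hB i s hs).trans ?_⟩
    have := Finset.single_le_sum (f := fun i => |B i|) (fun i _ => abs_nonneg _)
      (Finset.mem_range.2 (Nat.lt_succ_of_le hi))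
    have h2 := le_abs_self (B i)
    linarith
  obtain ⟨B, hB1, hB⟩ := hB
  -- the constant of the derivative bound for `s ↦ φ(s) e(U‖s‖²/2)`, up to `(1 + |U|) ^ N`
  set K : ℝ := 2 ^ N * (A * (N.factorial * (2 * Real.pi) ^ N * B ^ N)) * 2 ^ (d + 1) with hK
  have hpi := Real.pi_pos
  have hK0 : 0 ≤ K := by positivity
  refine ⟨C * K, by positivity, fun X n U => ?_⟩
  rw [packetMass_eq]
  have hfs : ContDiff ℝ ∞ fun s : Space d => U / 2 * ‖s‖ ^ 2 := contDiff_const.mul hqs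
  have hes : ContDiff ℝ ∞ fun s : Space d => e (U / 2 * ‖s‖ ^ 2) := contDiff_e.comp hfs
  have hbs : ContDiff ℝ ∞ fun s : Space d => (bump d s : ℂ) := (bumpS d).smooth ⊤
  have hmain := h (fun s => (bump d s : ℂ) * e (U / 2 * ‖s‖ ^ 2)) (K * (1 + |U|) ^ N)
    (hbs.mul hes) ?_ (-(X + U • n))
  · rw [show decay N (-(X + U • n)) = decay N (X + U • n) by simp only [decay, norm_neg]] at hmain
    calc _ ≤ _ := hmain
      _ = _ := by ring
  intro l hl s
  rcases le_or_gt ‖s‖ 1 with hs | hs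
  · have h2 : ∀ i ≤ N, ‖iteratedFDeriv ℝ i (fun s : Space d => e (U / 2 * ‖s‖ ^ 2)) s‖ ≤
        N.factorial * (2 * Real.pi) ^ N * ((1 + |U|) * B) ^ N := by
      intro i hi
      have hD1 : 1 ≤ (1 + |U|) * B := by
        have := abs_nonneg U
        nlinarith
      refine (norm_iteratedFDeriv_comp_le (g := e) (f := fun s : Space d => U / 2 * ‖s‖ ^ 2)
        (n := i) contDiff_e hfs (mod_cast le_top) s (C := (2 * Real.pi) ^ N) (D := (1 + |U|) * B)
        (fun j hj => norm_iteratedFDeriv_e_le N j (hj.trans hi) _) (fun j hj1 hj => ?_)).trans ?_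
      · have : (fun s : Space d => U / 2 * ‖s‖ ^ 2) = (U / 2) • q := by
          ext s; simp [hq]
        rw [this, iteratedFDeriv_const_smul_apply (hqs.contDiffAt.of_le (mod_cast le_top)),
          norm_smul]
        have h3 := hB j (hj.trans hi) s hs
        calc ‖U / 2‖ * ‖iteratedFDeriv ℝ j q s‖ ≤ (1 + |U|) * B := by
              gcongr
              rw [Real.norm_eq_abs, abs_div, abs_two]
              linarith [abs_nonneg U]
          _ ≤ ((1 + |U|) * B) ^ j := le_self_pow₀ hD1 (by omega)
      · gcongr
    have h3 := norm_iteratedFDeriv_mul_le_of_le (n := N) hbs hes hl s (A := A)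
      (fun i hi =>
        (hA' i hi s).trans (mul_le_of_le_one_right hA (decay_le_one 0 s))) h2
    refine h3.trans ?_
    have h4 : (1 : ℝ) ≤ 2 ^ (d + 1) * decay (d + 1) s := by
      rw [decay, ← div_eq_mul_inv, one_le_div (by positivity)]
      gcongr
      linarith
    calc _ ≤ 2 ^ N * (A * (N.factorial * (2 * Real.pi) ^ N * ((1 + |U|) * B) ^ N)) *
          (2 ^ (d + 1) * decay (d + 1) s) := le_mul_of_one_le_right (by positivity) h4
      _ = _ := by rw [hK, mul_pow (1 + |U|) B]; ring
  · have hz : iteratedFDeriv ℝ l (fun s : Space d => (bump d s : ℂ) * e (U / 2 * ‖s‖ ^ 2)) s = 0 := by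
      by_contra hne
      have h5 := support_iteratedFDeriv_subset (𝕜 := ℝ) l (Function.mem_support.2 hne)
      have h6 : tsupport (fun s : Space d => (bump d s : ℂ) * e (U / 2 * ‖s‖ ^ 2)) ⊆
          Metric.closedBall 0 1 := by
        refine closure_minimal (fun p hp => ?_) Metric.isClosed_closedBall
        by_contra hp'
        rw [mem_closedBall_zero_iff, not_le] at hp'
        exact hp (by simp [bump_eq_zero hp'.le])
      have := h6 h5
      rw [mem_closedBall_zero_iff] at this
      linarith
    rw [hz, norm_zero]
    have := decay_pos (d + 1) s
    positivity

lemma exists_one_add_pow_le_exp (N : ℕ) {ε : ℝ} (hε : 0 < ε) :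
    ∃ C : ℝ, 0 ≤ C ∧ ∀ x : ℝ, 0 ≤ x → (1 + x) ^ N ≤ C * Real.exp (ε * x) := by
  refine ⟨N.factorial * (ε ^ N)⁻¹ * Real.exp ε, by positivity, fun x hx => ?_⟩
  have h := Real.pow_div_factorial_le_exp (ε * (1 + x)) (by positivity) N
  have hf : (0 : ℝ) < N.factorial := by exact_mod_cast N.factorial_pos
  rw [div_le_iff₀ hf, mul_pow, mul_one_add, Real.exp_add] at h
  rw [mul_assoc, mul_assoc, mul_left_comm, ← div_eq_inv_mul, le_div_iff₀ (by positivity)]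
  linarith

/-- The total mass of a packet with phase `X` and evolution time `U` decays in the distance of
its final position `X + U n` from the origin; the spreading in time costs less than any
exponential. -/
lemma exists_packetMass_le (N : ℕ) {ε : ℝ} (hε : 0 < ε) :
    ∃ C : ℝ, 0 ≤ C ∧ ∀ (X n : Space d) (U : ℝ),
      (1 + |U|) * ‖packetMass X n U‖ ≤ C * Real.exp (ε * |U|) * decay N (X + U • n) := by
  obtain ⟨C, hC, h⟩ := exists_packetMass_le_pow (d := d) N
  obtain ⟨D, hD, h'⟩ := exists_one_add_pow_le_exp (N + 1) hε
  refine ⟨C * D, by positivity, fun X n U => ?_⟩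
  have h1 := h X n U
  have h2 := h' |U| (abs_nonneg U)
  have h3 := decay_pos N (X + U • n)
  have h4 := abs_nonneg U
  calc (1 + |U|) * ‖packetMass X n U‖
      ≤ (1 + |U|) * (C * (1 + |U|) ^ N * decay N (X + U • n)) := by gcongr
    _ = C * (1 + |U|) ^ (N + 1) * decay N (X + U • n) := by ring
    _ ≤ C * (D * Real.exp (ε * |U|)) * decay N (X + U • n) := by gcongr
    _ = _ := by ring

/-! ### Scattering of wave packets -/

lemma integrable_window_sub (f : 𝓢(Space d, ℂ)) (n : Space d) :
    Integrable fun θ : Space d × Space d => window f (θ.1 - n) θ.2 := by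
  have h := (integrable_window f).comp_sub_right (μ := (volume : Measure (Space d)).prod volume)
    ((n, 0) : Space d × Space d)
  exact h.congr (Filter.Eventually.of_forall fun θ => by simp)

/-- The transition `p ↦ p₁` with amplitude `f (p₁ - p)`, out of a packet with momentum near `n`,
decomposed according to the momentum `n'` and the place `x` of the outgoing packet. -/
lemma mul_bump_eq_integral_window (f : 𝓢(Space d, ℂ)) (n p p₁ : Space d) :
    f (p₁ - p) * bump d (p - n) = ∫ θ : Space d × Space d,
      window f (θ.1 - n) θ.2 * (e (-⟪θ.2, p₁ - p⟫) * (bump d (p₁ - θ.1) * bump d (p - n))) := by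
  have hw := integrable_window_sub f n
  have := continuous_e
  obtain ⟨B, hB, hB'⟩ := exists_bump_le (d := d)
  have hi : Integrable fun θ : Space d × Space d =>
      window f (θ.1 - n) θ.2 *
        (e (-⟪θ.2, p₁ - p⟫) * (bump d (p₁ - θ.1) * bump d (p - n))) := by
    refine hw.mul_bdd (c := B * B) ?_ (Filter.Eventually.of_forall fun θ => ?_)
    · exact Continuous.aestronglyMeasurable (by fun_prop)
    · rw [norm_mul, norm_e, one_mul, norm_mul, Complex.norm_real, Complex.norm_real,
        Real.norm_of_nonneg (bump_nonneg _), Real.norm_of_nonneg (bump_nonneg _)]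
      exact mul_le_mul (hB' _) (hB' _) (bump_nonneg _) hB
  rw [Measure.volume_eq_prod, integral_prod _ hi]
  have h1 : ∀ n' : Space d, ∫ x : Space d, window f (n' - n) x *
      (e (-⟪x, p₁ - p⟫) * (bump d (p₁ - n') * bump d (p - n))) =
      (f (p₁ - p) * bump d (p - n)) * bump d (p₁ - n') := by
    intro n'
    obtain ⟨C, hC⟩ := exists_window_le_decay f
    simp_rw [← mul_assoc]
    rw [integral_mul_const, integral_mul_const, integral_window f.continuous _ _ (hC _)]
    by_cases ha : 1 ≤ ‖p₁ - n'‖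
    · simp [bump_eq_zero ha]
    by_cases hb : 1 ≤ ‖p - n‖
    · simp [bump_eq_zero hb]
    rw [plateau_eq_one]
    · push_cast; ring
    · have : p₁ - p - (n' - n) = (p₁ - n') - (p - n) := by abel
      rw [this]
      linarith [norm_sub_le (p₁ - n') (p - n)]
  simp_rw [h1]
  rw [integral_const_mul, integral_complex_ofReal, integral_bump_sub']
  simp

/-- A bounded Borel function of two momenta. -/
structure BddMeas (R : Space d → Space d → ℂ) : Prop where
  meas : Measurable fun v : Space d × Space d => R v.1 v.2
  bdd : ∃ K, ∀ p p', ‖R p p'‖ ≤ K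

lemma BddMeas.swap {R : Space d → Space d → ℂ} (hR : BddMeas R) :
    BddMeas fun p p' => R p' p :=
  ⟨hR.meas.comp measurable_swap, hR.bdd.imp fun _ h p p' => h p' p⟩

/-- The packet `packet x n U` scattered by `f` at position `q`, the momentum being first translated
by `h`, is a superposition of packets that start at `-q - x'` with momentum `n'`. -/
lemma integral_packet_mul_scatter (f : 𝓢(Space d, ℂ)) {Φ : Space d → Space d → ℂ}
    (hΦ : BddMeas Φ) (x n h q : Space d) (U : ℝ) :
    ∫ p, packet x n U p * ∫ z, f z * e (-⟪q, z⟫) * Φ p (p + h + z) =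
      ∫ θ : Space d × Space d, window f (θ.1 - (n + h)) θ.2 * e ⟪q + θ.2, h⟫ *
        ∫ p, ∫ p₁, packet (x + q + θ.2) n U p * packet (-q - θ.2) θ.1 0 p₁ * Φ p p₁ := by
  obtain ⟨K, hK⟩ := hΦ.bdd
  have := continuous_e
  have hcp : ∀ x n : Space d, ∀ U, Continuous (packet x n U) := continuous_packet
  -- the joint integrand in the momenta `(p, p₁)` and the label `θ`
  set G : (Space d × Space d) × (Space d × Space d) → ℂ := fun v =>
    window f (v.2.1 - (n + h)) v.2.2 * e ⟪q + v.2.2, h⟫ *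
      (packet (x + q + v.2.2) n U v.1.1 * packet (-q - v.2.2) v.2.1 0 v.1.2 * Φ v.1.1 v.1.2)
    with hG
  have hGn : ∀ v, ‖G v‖ ≤ K * (‖window f (v.2.1 - (n + h)) v.2.2‖ *
      (bump d (v.1.1 - n) * bump d (v.1.2 - v.2.1))) := by
    intro v
    simp only [hG, norm_mul, norm_e, norm_packet, mul_one]
    have := hK v.1.1 v.1.2
    have := bump_nonneg (v.1.1 - n)
    have := bump_nonneg (v.1.2 - v.2.1)
    calc _ ≤ ‖window f (v.2.1 - (n + h)) v.2.2‖ *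
      (bump d (v.1.1 - n) * bump d (v.1.2 - v.2.1) * K) := by gcongr
      _ = _ := by ring
  obtain ⟨A, -, hA⟩ := SchwartzMap.exists_decay f (d + 1) 0
  have hwc := continuous_window f.continuous fun z => by simpa using hA 0 le_rfl z
  have hGm : AEStronglyMeasurable G := by
    have h1 : Measurable fun v : (Space d × Space d) × (Space d × Space d) => Φ v.1.1 v.1.2 :=
      hΦ.meas.comp measurable_fst
    refine AEStronglyMeasurable.mul ?_ (AEStronglyMeasurable.mul ?_ h1.aestronglyMeasurable)
    · refine Continuous.aestronglyMeasurable (Continuous.mul ?_ (by fun_prop))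
      exact hwc.comp (g := fun θ : Space d × Space d => window f θ.1 θ.2)
        (f := fun v : (Space d × Space d) × (Space d × Space d) => (v.2.1 - (n + h), v.2.2))
        (by fun_prop)
    · unfold packet
      exact Continuous.aestronglyMeasurable (by fun_prop)
  have hdom : Integrable (fun v : (Space d × Space d) × (Space d × Space d) =>
      ‖window f (v.2.1 - (n + h)) v.2.2‖ * (bump d (v.1.1 - n) * bump d (v.1.2 - v.2.1))) := by
    refine (integrable_prod_iff' ?_).2 ?_
    rotate_left
    · refine ⟨Filter.Eventually.of_forall fun θ => ?_, ?_⟩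
      · exact ((integrable_bump_sub n).mul_prod (integrable_bump_sub θ.1)).const_mul
          ‖window f (θ.1 - (n + h)) θ.2‖
      · have : ∀ θ : Space d × Space d, ∫ v : Space d × Space d,
            ‖‖window f (θ.1 - (n + h)) θ.2‖ * (bump d (v.1 - n) * bump d (v.2 - θ.1))‖ =
            ‖window f (θ.1 - (n + h)) θ.2‖ := by
          intro θ
          simp_rw [norm_mul, norm_norm, Real.norm_of_nonneg (bump_nonneg _)]
          rw [integral_const_mul, Measure.volume_eq_prod,
            integral_prod_mul (fun p => bump d (p - n)) (fun p => bump d (p - θ.1)),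
            integral_bump_sub, integral_bump_sub]
          ring
        simp only [this]
        exact (integrable_window_sub f (n + h)).norm
    · refine Continuous.aestronglyMeasurable (Continuous.mul ?_ (by fun_prop))
      exact (hwc.comp (g := fun θ : Space d × Space d => window f θ.1 θ.2)
        (f := fun v : (Space d × Space d) × (Space d × Space d) => (v.2.1 - (n + h), v.2.2))
        (by fun_prop)).norm
  have hGi : Integrable G := (hdom.const_mul K).mono' hGm (Filter.Eventually.of_forall hGn)
  -- the pair `(p, p₁)` for fixed `θ`
  have hθ : ∀ θ : Space d × Space d, Integrable fun v : Space d × Space d =>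
      packet (x + q + θ.2) n U v.1 * packet (-q - θ.2) θ.1 0 v.2 * Φ v.1 v.2 := by
    intro θ
    refine (((integrable_bump_sub n).mul_prod (integrable_bump_sub θ.1)).mul_const K).mono' ?_
      (Filter.Eventually.of_forall fun v => ?_)
    · refine AEStronglyMeasurable.mul ?_ hΦ.meas.aestronglyMeasurable
      unfold packet
      exact Continuous.aestronglyMeasurable (by fun_prop)
    · rw [norm_mul, norm_mul, norm_packet, norm_packet]
      have := bump_nonneg (v.1 - n)
      have := bump_nonneg (v.2 - θ.1)
      gcongr
      exact hK _ _
  have hpp : ∀ p p₁ : Space d, ∫ θ, G ((p, p₁), θ) =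
      packet x n U p * (f (p₁ - (p + h)) * e (-⟪q, p₁ - (p + h)⟫) * Φ p p₁) := by
    intro p p₁
    have h1 := mul_bump_eq_integral_window f (n + h) (p + h) p₁
    rw [add_sub_add_right_eq_sub] at h1
    have h2 : packet x n U p * (f (p₁ - (p + h)) * e (-⟪q, p₁ - (p + h)⟫) * Φ p p₁) =
        (e ⟪x, p⟫ * e (U / 2 * ‖p‖ ^ 2) * e (-⟪q, p₁ - (p + h)⟫) * Φ p p₁) *
          (f (p₁ - (p + h)) * bump d (p - n)) := by
      rw [packet]; ring
    rw [h2, h1, ← integral_const_mul]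
    congr 1
    ext θ
    simp only [hG, packet]
    have h3 : e ⟪q + θ.2, h⟫ * e ⟪x + q + θ.2, p⟫ * e ⟪-q - θ.2, p₁⟫ =
        e ⟪x, p⟫ * e (-⟪q, p₁ - (p + h)⟫) * e (-⟪θ.2, p₁ - (p + h)⟫) := by
      rw [← e_add, ← e_add, ← e_add, ← e_add]
      congr 1
      simp only [inner_add_left, inner_sub_left, inner_neg_left, inner_sub_right, inner_add_right]
      ring
    rw [zero_div, zero_mul, e_zero]
    linear_combination (window f (θ.1 - (n + h)) θ.2 * bump d (p - n) * bump d (p₁ - θ.1) *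
      e (U / 2 * ‖p‖ ^ 2) * Φ p p₁) * h3
  have hz : ∀ p, ∫ z, f z * e (-⟪q, z⟫) * Φ p (p + h + z) =
      ∫ p₁, f (p₁ - (p + h)) * e (-⟪q, p₁ - (p + h)⟫) * Φ p p₁ := by
    intro p
    rw [← integral_sub_right_eq_self _ (p + h)]
    simp
  calc ∫ p, packet x n U p * ∫ z, f z * e (-⟪q, z⟫) * Φ p (p + h + z)
      = ∫ p, ∫ p₁, ∫ θ, G ((p, p₁), θ) := by
        congr 1
        ext p
        rw [hz, ← integral_const_mul]
        congr 1
        ext p₁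
        rw [hpp]
    _ = ∫ v : Space d × Space d, ∫ θ, G (v, θ) :=
        (integral_prod (fun v => ∫ θ, G (v, θ)) hGi.integral_prod_left).symm
    _ = ∫ θ, ∫ v, G (v, θ) := integral_integral_swap hGi
    _ = _ := by
        congr 1
        ext θ
        simp only [hG]
        rw [integral_const_mul]
        congr 1
        exact integral_prod _ (hθ θ)

/-! ### The scattering operator and its pairing with packets -/

/-- Scattering at position `q` with amplitude `f`, in the backward (dual) form: `g = 0` changes the
first momentum, `g = 1` the second. -/
def scatter (f : Space d → ℂ) (g : ℝ) (q : Space d) (R : Space d → Space d → ℂ)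
    (p p' : Space d) : ℂ :=
  ∫ z, f z * e (-⟪q, z⟫) * R (p + (1 - g) • z) (p' - g • z)

lemma BddMeas.scatter {R : Space d → Space d → ℂ} (hR : BddMeas R) (f : 𝓢(Space d, ℂ)) (g : ℝ)
    (q : Space d) : BddMeas (scatter f g q R) := by
  obtain ⟨K, hK⟩ := hR.bdd
  have := continuous_e
  refine ⟨?_, K * ∫ z, ‖f z‖, fun p p' => ?_⟩
  · unfold Lorentz.scatter
    have h1 : Measurable fun w : (Space d × Space d) × Space d =>
        f w.2 * e (-⟪q, w.2⟫) * R (w.1.1 + (1 - g) • w.2) (w.1.2 - g • w.2) := by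
      refine Measurable.mul ?_ (hR.meas.comp (g := fun v : Space d × Space d => R v.1 v.2)
        (f := fun w : (Space d × Space d) × Space d =>
          (w.1.1 + (1 - g) • w.2, w.1.2 - g • w.2)) (by fun_prop))
      have := f.continuous
      exact Continuous.measurable (by fun_prop)
    exact (h1.stronglyMeasurable.integral_prod_right' (ν := volume)).measurable
  · unfold Lorentz.scatter
    rw [← integral_const_mul]
    refine norm_integral_le_of_norm_le (f.integrable.norm.const_mul K)
      (Filter.Eventually.of_forall fun z => ?_)
    rw [norm_mul, norm_mul, norm_e, mul_one, mul_comm]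
    gcongr
    exact hK _ _

/-- The pairing of `R` with a product of two packets. -/
def pair (R : Space d → Space d → ℂ) (x n : Space d) (U : ℝ) (x' n' : Space d) (U' : ℝ) : ℂ :=
  ∫ p, ∫ p', packet x n U p * packet x' n' U' p' * R p p'

lemma integrable_pair {R : Space d → Space d → ℂ} (hR : BddMeas R) (x n : Space d) (U : ℝ)
    (x' n' : Space d) (U' : ℝ) : Integrable fun v : Space d × Space d =>
      packet x n U v.1 * packet x' n' U' v.2 * R v.1 v.2 := by
  obtain ⟨K, hK⟩ := hR.bdd
  refine (((integrable_bump_sub n).mul_prod (integrable_bump_sub n')).mul_const K).mono' ?_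
    (Filter.Eventually.of_forall fun v => ?_)
  · refine AEStronglyMeasurable.mul ?_ hR.meas.aestronglyMeasurable
    have h1 := continuous_packet x n U
    have h2 := continuous_packet x' n' U'
    exact Continuous.aestronglyMeasurable (by fun_prop)
  · rw [norm_mul, norm_mul, norm_packet, norm_packet]
    have := bump_nonneg (v.1 - n)
    have := bump_nonneg (v.2 - n')
    gcongr
    exact hK _ _

lemma pair_swap {R : Space d → Space d → ℂ} (hR : BddMeas R) (x n : Space d) (U : ℝ)
    (x' n' : Space d) (U' : ℝ) :
    pair R x n U x' n' U' = pair (fun p p' => R p' p) x' n' U' x n U := by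
  unfold pair
  rw [integral_integral_swap (f := fun p p' => packet x n U p * packet x' n' U' p' * R p p')
    (integrable_pair hR x n U x' n' U')]
  simp only [mul_comm (packet x n U _)]

/-- Scattering of the first momentum, paired with packets. -/
lemma pair_scatter_zero (f : 𝓢(Space d, ℂ)) {R : Space d → Space d → ℂ} (hR : BddMeas R)
    (q x n : Space d) (U : ℝ) (x' n' : Space d) (U' : ℝ) :
    pair (scatter f 0 q R) x n U x' n' U' = ∫ θ : Space d × Space d,
      window f (θ.1 - n) θ.2 * packetMass (x + q + θ.2) n U *
        pair R (-q - θ.2) θ.1 0 x' n' U' := by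
  obtain ⟨K, hK⟩ := hR.bdd
  have hcp := continuous_packet x' n' U'
  have := continuous_e
  have hΦm : Measurable fun v : Space d × Space d => ∫ p', packet x' n' U' p' * R v.2 p' := by
    have h1 : Measurable fun w : (Space d × Space d) × Space d =>
        packet x' n' U' w.2 * R w.1.2 w.2 :=
      (hcp.measurable.comp measurable_snd).mul (hR.meas.comp
        (g := fun v : Space d × Space d => R v.1 v.2)
        (f := fun w : (Space d × Space d) × Space d => (w.1.2, w.2)) (by fun_prop))
    exact (h1.stronglyMeasurable.integral_prod_right' (ν := volume)).measurable
  have hΦ : BddMeas fun (_ p₁ : Space d) => ∫ p', packet x' n' U' p' * R p₁ p' := by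
    refine ⟨hΦm, K, fun _ p₁ => ?_⟩
    have h2 : ∫ p', bump d (p' - n') * K = K := by
      rw [integral_mul_const, integral_bump_sub, one_mul]
    rw [← h2]
    refine norm_integral_le_of_norm_le ((integrable_bump_sub n').mul_const K)
      (Filter.Eventually.of_forall fun p' => ?_)
    rw [norm_mul, norm_packet]
    have := bump_nonneg (p' - n')
    gcongr
    exact hK _ _
  have key := integral_packet_mul_scatter f hΦ x n 0 q U
  have hL : pair (scatter f 0 q R) x n U x' n' U' = ∫ p, packet x n U p *
      ∫ z, f z * e (-⟪q, z⟫) * ∫ p', packet x' n' U' p' * R (p + 0 + z) p' := by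
    unfold pair
    congr 1
    ext p
    simp_rw [mul_assoc]
    rw [integral_const_mul]
    congr 1
    have hsw : Integrable (Function.uncurry fun (z p' : Space d) =>
        f z * (e (-⟪q, z⟫) * (packet x' n' U' p' * R (p + 0 + z) p'))) := by
      refine ((f.integrable.norm.mul_prod (integrable_bump_sub n')).mul_const K).mono' ?_
        (Filter.Eventually.of_forall fun v => ?_)
      · have := f.continuous
        refine Measurable.aestronglyMeasurable ?_
        refine Measurable.mul (by fun_prop) (Measurable.mul ?_ (Measurable.mul (by fun_prop) ?_))
        · exact Continuous.measurable (by fun_prop)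
        · exact hR.meas.comp (g := fun v : Space d × Space d => R v.1 v.2)
            (f := fun w : Space d × Space d => (p + 0 + w.1, w.2)) (by fun_prop)
      · simp only [Function.uncurry, norm_mul, norm_e, one_mul, norm_packet]
        rw [mul_assoc]
        have := bump_nonneg (v.2 - n')
        gcongr
        exact hK _ _
    simp_rw [← integral_const_mul]
    rw [integral_integral_swap hsw]
    congr 1
    ext p'
    rw [scatter, ← integral_const_mul]
    congr 1
    ext z
    simp only [sub_zero, one_smul, zero_smul, add_zero]
    ring
  rw [hL, key]
  congr 1
  ext θ
  rw [add_zero, inner_zero_right, e_zero, mul_one, mul_assoc]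
  congr 1
  rw [packetMass, pair, ← integral_mul_const]
  congr 1
  ext p
  rw [← integral_const_mul]
  congr 1
  ext p₁
  rw [mul_assoc, ← integral_const_mul]
  simp_rw [mul_assoc]

/-- The function `z ↦ f (-z)`. -/
def reflect (f : 𝓢(Space d, ℂ)) : 𝓢(Space d, ℂ) :=
  SchwartzMap.compCLMOfContinuousLinearEquiv ℝ (ContinuousLinearEquiv.neg ℝ) f

lemma reflect_apply (f : 𝓢(Space d, ℂ)) (z : Space d) : reflect f z = f (-z) := rfl

lemma scatter_one_eq (f : 𝓢(Space d, ℂ)) (q : Space d) (R : Space d → Space d → ℂ)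
    (p p' : Space d) :
    scatter f 1 q R p p' = scatter (reflect f) 0 (-q) (fun a b => R b a) p' p := by
  rw [scatter, scatter, ← integral_neg_eq_self]
  congr 1
  ext z
  simp [reflect_apply]

/-- The pairing of the restriction of `R` to the affine subspace `p - p' = h` with a packet. -/
def linePair (R : Space d → Space d → ℂ) (h x n : Space d) (U : ℝ) : ℂ :=
  ∫ p, packet x n U p * R (p + h) p

lemma linePair_scatter_zero (f : 𝓢(Space d, ℂ)) {R : Space d → Space d → ℂ} (hR : BddMeas R)
    (h q x n : Space d) (U : ℝ) :
    linePair (scatter f 0 q R) h x n U = ∫ θ : Space d × Space d,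
      window f (θ.1 - (n + h)) θ.2 * e ⟪q + θ.2, h⟫ *
        pair R (-q - θ.2) θ.1 0 (x + q + θ.2) n U := by
  have key := integral_packet_mul_scatter f hR.swap x n h q U
  have hL : linePair (scatter f 0 q R) h x n U =
      ∫ p, packet x n U p * ∫ z, f z * e (-⟪q, z⟫) * R (p + h + z) p := by
    simp [linePair, scatter]
  rw [hL, key]
  congr 1
  ext θ
  rw [pair_swap hR]
  rfl

lemma packet_sub (x n h : Space d) (U : ℝ) (p : Space d) :
    packet x n U (p - h) = e (U / 2 * ‖h‖ ^ 2 - ⟪x, h⟫) * packet (x - U • h) (n + h) U p := by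
  rw [packet, packet, sub_sub, add_comm h n]
  have : e ⟪x, p - h⟫ * e (U / 2 * ‖p - h‖ ^ 2) =
      e (U / 2 * ‖h‖ ^ 2 - ⟪x, h⟫) * e ⟪x - U • h, p⟫ * e (U / 2 * ‖p‖ ^ 2) := by
    rw [← e_add, ← e_add, ← e_add]
    congr 1
    rw [norm_sub_sq_real, inner_sub_right, inner_sub_left, inner_smul_left, real_inner_comm h p]
    simp
    ring
  linear_combination (bump d (p - (n + h)) : ℂ) * this

lemma linePair_scatter_one (f : 𝓢(Space d, ℂ)) (R : Space d → Space d → ℂ)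
    (h q x n : Space d) (U : ℝ) :
    linePair (scatter f 1 q R) h x n U = e (U / 2 * ‖h‖ ^ 2 - ⟪x, h⟫) *
      linePair (scatter (reflect f) 0 (-q) fun a b => R b a) (-h) (x - U • h) (n + h) U := by
  unfold linePair
  rw [← integral_sub_right_eq_self _ h, ← integral_const_mul]
  congr 1
  ext p
  rw [packet_sub, scatter_one_eq, sub_add_cancel, mul_assoc, sub_eq_add_neg p h]

/-! ### Sums of integrals -/

/-- A pointwise bound on a sum of norms bounds the sum of the norms of the integrals; the
functions need not be integrable, since the integral is `0` otherwise. -/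
lemma sum_norm_integral_le {X ι : Type*} [MeasurableSpace X] {μ : Measure X} (s : Finset ι)
    {F : ι → X → ℂ} {B : X → ℝ} (hB : Integrable B μ) (h : ∀ x, ∑ i ∈ s, ‖F i x‖ ≤ B x) :
    ∑ i ∈ s, ‖∫ x, F i x ∂μ‖ ≤ ∫ x, B x ∂μ := by
  classical
  set t := s.filter fun i => Integrable (F i) μ with ht
  calc ∑ i ∈ s, ‖∫ x, F i x ∂μ‖ = ∑ i ∈ t, ‖∫ x, F i x ∂μ‖ := by
        rw [ht, Finset.sum_filter]
        refine Finset.sum_congr rfl fun i _ => ?_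
        split_ifs with hi
        · rfl
        · rw [integral_undef hi, norm_zero]
    _ ≤ ∑ i ∈ t, ∫ x, ‖F i x‖ ∂μ := Finset.sum_le_sum fun i _ => norm_integral_le_integral_norm _
    _ = ∫ x, ∑ i ∈ t, ‖F i x‖ ∂μ := by
        rw [integral_finsetSum]
        exact fun i hi => (Finset.mem_filter.1 hi).2.norm
    _ ≤ ∫ x, B x ∂μ := by
        refine integral_mono (integrable_finsetSum _ fun i hi => (Finset.mem_filter.1 hi).2.norm)
          hB fun x => ?_
        exact (Finset.sum_le_sum_of_subset_of_nonneg (Finset.filter_subset _ _)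
          fun _ _ _ => norm_nonneg _).trans (h x)

/-! ### Restriction to a fixed momentum difference -/

lemma integrable_shear {F : Space d → Space d → ℂ}
    (hF : Integrable fun v : Space d × Space d => F v.1 v.2) :
    Integrable fun v : Space d × Space d => F (v.1 + v.2) v.1 := by
  have h1 := measurePreserving_prod_add (volume : Measure (Space d)) (volume : Measure (Space d))
  have h2 : Integrable (fun v : Space d × Space d => F v.2 v.1) := hF.swap
  exact (h1.integrable_comp h2.aestronglyMeasurable).2 h2

/-- Integration in the momentum difference, in units of `h`. -/
lemma integral_integral_eq_smul {F : Space d → Space d → ℂ}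
    (hF : Integrable fun v : Space d × Space d => F v.1 v.2) {h : ℝ} (hh : 0 < h) :
    ∫ p, ∫ p', F p p' = (h ^ d : ℝ) * ∫ w, ∫ p', F (p' + h • w) p' := by
  rw [integral_integral_swap (f := F) hF]
  have h1 : ∀ p', ∫ p, F p p' = ∫ k, F (p' + k) p' := fun p' =>
    (integral_add_left_eq_self (fun p => F p p') p').symm
  simp_rw [h1]
  rw [integral_integral_swap (f := fun p' k => F (p' + k) p') (integrable_shear hF)]
  have h2 := Measure.integral_comp_smul (volume : Measure (Space d))
    (fun k => ∫ p', F (p' + k) p') h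
  rw [finrank_space, abs_of_nonneg (by positivity)] at h2
  rw [h2, Complex.real_smul, ← mul_assoc, ← Complex.ofReal_mul, mul_inv_cancel₀ (by positivity)]
  simp

/-- The Fourier transform of the bump function. -/
def bumpHat (d : ℕ) : 𝓢(Space d, ℂ) := 𝓕 (bumpS d)

lemma integral_bumpHat (s : Space d) : ∫ X, bumpHat d X * e ⟪X, s⟫ = bump d s := by
  have h : 𝓕⁻ (𝓕 (bumpS d)) = bumpS d := FourierTransform.fourierInv_fourier_eq _
  have h1 := congrArg (fun f : 𝓢(Space d, ℂ) => f s) h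
  simp only [bumpS_apply] at h1
  rw [← h1, SchwartzMap.fourierInv_coe, Real.fourierInv_eq]
  congr 1
  ext X
  rw [Circle.smul_def, smul_eq_mul, mul_comm, e_eq_fourierChar]
  rfl

lemma integrable_one_add_norm_mul_bumpHat :
    Integrable fun X : Space d => ‖bumpHat d X‖ * (1 + ‖X‖) := by
  have h1 := (bumpHat d).integrable_pow_mul volume 1
  have h2 := (bumpHat d).integrable.norm (μ := volume)
  refine (h2.add h1).congr (Filter.Eventually.of_forall fun X => ?_)
  simp only [Pi.add_apply, pow_one]
  ring

/-- The product of two packets with momentum difference `H`, evolved for the time `u`, is a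
superposition of single packets. -/
lemma packet_mul_packet (x n x' n' H : Space d) (U U' u : ℝ) (p : Space d) :
    packet x n U (p + H) * packet x' n' U' p * e (u / 2 * (‖p + H‖ ^ 2 - ‖p‖ ^ 2)) =
      ∫ X, bumpHat d X * e (⟪X, H - n⟫ + ⟪x, H⟫ + (U + u) / 2 * ‖H‖ ^ 2) *
        packet (x + x' + X + (U + u) • H) n' (U + U') p := by
  have h1 := integral_bumpHat (p + H - n)
  have h2 : packet x n U (p + H) * packet x' n' U' p * e (u / 2 * (‖p + H‖ ^ 2 - ‖p‖ ^ 2)) =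
      (bump d (p + H - n) : ℂ) * (e ⟪x, p + H⟫ * e (U / 2 * ‖p + H‖ ^ 2) * packet x' n' U' p *
        e (u / 2 * (‖p + H‖ ^ 2 - ‖p‖ ^ 2))) := by
    rw [packet]; ring
  rw [h2, ← h1, ← integral_mul_const]
  congr 1
  ext X
  rw [packet, packet]
  have h3 : e ⟪X, p + H - n⟫ * (e ⟪x, p + H⟫ * e (U / 2 * ‖p + H‖ ^ 2) *
      (e ⟪x', p⟫ * e (U' / 2 * ‖p‖ ^ 2)) * e (u / 2 * (‖p + H‖ ^ 2 - ‖p‖ ^ 2))) =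
      e (⟪X, H - n⟫ + ⟪x, H⟫ + (U + u) / 2 * ‖H‖ ^ 2) *
      (e ⟪x + x' + X + (U + u) • H, p⟫ * e ((U + U') / 2 * ‖p‖ ^ 2)) := by
    simp only [← e_add]
    congr 1
    rw [norm_add_sq_real]
    simp only [inner_add_left, inner_sub_right, inner_add_right, inner_smul_left,
      real_inner_comm H p]
    simp
    ring
  linear_combination (bumpHat d X * bump d (p - n')) * h3

lemma exists_sum_norm_pair_node_le (ρ : ℝ) : ∃ C : ℝ, 0 ≤ C ∧ ∀ {ι : Type} (s : Finset ι)
    (R : ι → Space d → Space d → ℂ) (_ : ∀ i, BddMeas (R i)) (N : Space d → ℂ)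
    (_ : Measurable N) (τ : ℝ) (_ : ∀ w, ‖N w‖ ≤ τ) (_ : ∀ w, ρ < ‖w‖ → N w = 0)
    (h : ℝ) (_ : 0 < h) (x n x' n' : Space d) (U U' u B : ℝ)
    (_ : ∀ w, ‖w‖ ≤ ρ → ∀ X, ∑ i ∈ s, ‖linePair (R i) (h • w)
      (x + x' + X + (U + u) • h • w) n' (U + U')‖ ≤ B * (1 + ‖X‖)),
    ∑ i ∈ s, ‖pair (fun p p' => e (u / 2 * (‖p‖ ^ 2 - ‖p'‖ ^ 2)) * N (h⁻¹ • (p - p')) * R i p p')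
      x n U x' n' U'‖ ≤ C * τ * h ^ d * B := by
  classical
  set I : ℝ := ∫ X : Space d, ‖bumpHat d X‖ * (1 + ‖X‖) with hI
  have hI0 : 0 ≤ I := integral_nonneg fun X => by have := norm_nonneg X; positivity
  set v : ℝ := (volume : Measure (Space d)).real (Metric.closedBall 0 ρ) with hv
  refine ⟨v * I, by positivity, ?_⟩
  intro ι s R hR N hNm τ hτ hN h hh x n x' n' U U' u B hB
  have hc := continuous_e
  have hτ0 : 0 ≤ τ := (norm_nonneg _).trans (hτ 0)
  -- the pairing with fixed momentum difference `h • w`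
  have key : ∀ i, pair (fun p p' => e (u / 2 * (‖p‖ ^ 2 - ‖p'‖ ^ 2)) * N (h⁻¹ • (p - p')) *
      R i p p') x n U x' n' U' = (h ^ d : ℝ) * ∫ w, N w * ∫ X,
        bumpHat d X * e (⟪X, h • w - n⟫ + ⟪x, h • w⟫ + (U + u) / 2 * ‖h • w‖ ^ 2) *
          linePair (R i) (h • w) (x + x' + X + (U + u) • h • w) n' (U + U') := by
    intro i
    obtain ⟨K, hK⟩ := (hR i).bdd
    have hRn : BddMeas (fun p p' => e (u / 2 * (‖p‖ ^ 2 - ‖p'‖ ^ 2)) * N (h⁻¹ • (p - p')) *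
        R i p p') := by
      refine ⟨Measurable.mul (Measurable.mul ?_ ?_) (hR i).meas, τ * K, fun p p' => ?_⟩
      · exact Continuous.measurable (by fun_prop)
      · exact hNm.comp (by fun_prop)
      · rw [norm_mul, norm_mul, norm_e, one_mul]
        exact mul_le_mul (hτ _) (hK _ _) (norm_nonneg _) hτ0
    rw [pair, integral_integral_eq_smul (F := fun p p' => packet x n U p * packet x' n' U' p' *
      (e (u / 2 * (‖p‖ ^ 2 - ‖p'‖ ^ 2)) * N (h⁻¹ • (p - p')) * R i p p'))
      (integrable_pair hRn x n U x' n' U') hh]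
    congr 1
    congr 1
    ext w
    rw [← integral_const_mul]
    have hsw : Integrable (Function.uncurry fun X p : Space d => N w * (bumpHat d X *
        e (⟪X, h • w - n⟫ + ⟪x, h • w⟫ + (U + u) / 2 * ‖h • w‖ ^ 2) *
          (packet (x + x' + X + (U + u) • h • w) n' (U + U') p * R i (p + h • w) p))) := by
      refine ((((bumpHat d).integrable.norm.mul_prod (integrable_bump_sub n')).mul_const
        K).const_mul ‖N w‖).mono' ?_ (Filter.Eventually.of_forall fun v => ?_)
      · refine Measurable.aestronglyMeasurable ?_
        have h1 := (bumpHat d).continuous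
        refine Measurable.const_mul (Measurable.mul ?_ (Measurable.mul ?_ ?_)) _
        · exact Continuous.measurable (by fun_prop)
        · unfold packet
          exact Continuous.measurable (by fun_prop)
        · exact (hR i).meas.comp (g := fun v : Space d × Space d => R i v.1 v.2)
            (f := fun v : Space d × Space d => (v.2 + h • w, v.2)) (by fun_prop)
      · simp only [Function.uncurry, norm_mul, norm_e, mul_one, norm_packet]
        rw [mul_assoc ‖bumpHat d v.1‖]
        have := bump_nonneg (v.2 - n')
        gcongr
        exact hK _ _
    have h2 : ∀ X, N w * (bumpHat d X * e (⟪X, h • w - n⟫ + ⟪x, h • w⟫ +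
        (U + u) / 2 * ‖h • w‖ ^ 2) * linePair (R i) (h • w) (x + x' + X + (U + u) • h • w) n'
        (U + U')) = ∫ p, N w * (bumpHat d X *
        e (⟪X, h • w - n⟫ + ⟪x, h • w⟫ + (U + u) / 2 * ‖h • w‖ ^ 2) *
          (packet (x + x' + X + (U + u) • h • w) n' (U + U') p * R i (p + h • w) p)) := by
      intro X
      rw [integral_const_mul, integral_const_mul, linePair]
    simp_rw [h2]
    rw [integral_integral_swap hsw]
    congr 1
    ext p
    rw [add_sub_cancel_left, inv_smul_smul₀ hh.ne', integral_const_mul]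
    have h3 := packet_mul_packet x n x' n' (h • w) U U' u p
    have h4 : ∫ X, bumpHat d X * e (⟪X, h • w - n⟫ + ⟪x, h • w⟫ + (U + u) / 2 * ‖h • w‖ ^ 2) *
          (packet (x + x' + X + (U + u) • h • w) n' (U + U') p * R i (p + h • w) p) =
        (∫ X, bumpHat d X * e (⟪X, h • w - n⟫ + ⟪x, h • w⟫ + (U + u) / 2 * ‖h • w‖ ^ 2) *
          packet (x + x' + X + (U + u) • h • w) n' (U + U') p) * R i (p + h • w) p := by
      rw [← integral_mul_const]
      simp_rw [mul_assoc]
    rw [h4, ← h3]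
    ring
  have hXw : ∀ w, ‖w‖ ≤ ρ → ∑ i ∈ s, ‖∫ X, bumpHat d X *
      e (⟪X, h • w - n⟫ + ⟪x, h • w⟫ + (U + u) / 2 * ‖h • w‖ ^ 2) *
          linePair (R i) (h • w) (x + x' + X + (U + u) • h • w) n' (U + U')‖ ≤ I * B := by
    intro w hw
    rw [hI, ← integral_mul_const]
    refine sum_norm_integral_le s (integrable_one_add_norm_mul_bumpHat.mul_const B) fun X => ?_
    simp_rw [norm_mul, norm_e, mul_one]
    rw [← Finset.mul_sum, mul_assoc, mul_comm _ B]
    gcongr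
    exact hB w hw X
  have hw' : ∑ i ∈ s, ‖∫ w, N w * ∫ X, bumpHat d X *
      e (⟪X, h • w - n⟫ + ⟪x, h • w⟫ + (U + u) / 2 * ‖h • w‖ ^ 2) *
        linePair (R i) (h • w) (x + x' + X + (U + u) • h • w) n' (U + U')‖ ≤
      ∫ w, (Metric.closedBall (0 : Space d) ρ).indicator (fun _ => τ * (I * B)) w := by
    refine sum_norm_integral_le s ?_ fun w => ?_
    · refine (integrable_indicator_iff measurableSet_closedBall).2 (integrableOn_const ?_)
      exact (measure_closedBall_lt_top).ne
    · rcases le_or_gt ‖w‖ ρ with hw | hw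
      · rw [Set.indicator_of_mem (by simpa using hw)]
        simp_rw [norm_mul (N w)]
        rw [← Finset.mul_sum]
        exact mul_le_mul (hτ w) (hXw w hw) (Finset.sum_nonneg fun _ _ => norm_nonneg _) hτ0
      · rw [Set.indicator_of_notMem (by simpa using hw), hN w hw]
        simp
  rw [integral_indicator measurableSet_closedBall, setIntegral_const, smul_eq_mul, ← hv] at hw'
  simp_rw [key, norm_mul]
  rw [← Finset.mul_sum, Complex.norm_real, Real.norm_of_nonneg (by positivity)]
  calc _ ≤ h ^ d * (v * (τ * (I * B))) := by gcongr
    _ = _ := by ring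

/-! ### Separated sets -/

/-- Disjoint balls around the points of a separated set: a sum of slowly varying terms is bounded by
an integral. -/
lemma sum_le_integral_of_separated {ι : Type*} (s : Finset ι) (pos : ι → Space d) {δ : ℝ}
    (hsep : ∀ i ∈ s, ∀ j ∈ s, i ≠ j → δ < ‖pos i - pos j‖) {F : Space d → ℝ}
    (hF : Integrable F) (hF0 : ∀ x, 0 ≤ F x) {a : ι → ℝ}
    (ha : ∀ i ∈ s, ∀ y, ‖y - pos i‖ < δ / 2 → a i ≤ F y) :
    (∑ i ∈ s, a i) * (volume : Measure (Space d)).real (Metric.ball 0 (δ / 2)) ≤ ∫ y, F y := by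
  have hdisj : Set.PairwiseDisjoint (s : Set ι) fun i => Metric.ball (pos i) (δ / 2) := by
    intro i hi j hj hij
    refine Metric.ball_disjoint_ball ?_
    rw [dist_eq_norm, add_halves]
    exact (hsep i hi j hj hij).le
  calc (∑ i ∈ s, a i) * (volume : Measure (Space d)).real (Metric.ball 0 (δ / 2))
      = ∑ i ∈ s, ∫ _ in Metric.ball (pos i) (δ / 2), a i := by
        rw [Finset.sum_mul]
        refine Finset.sum_congr rfl fun i _ => ?_
        rw [setIntegral_const, smul_eq_mul, mul_comm, Measure.real, Measure.real,
          Measure.addHaar_ball_center volume (pos i)]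
    _ ≤ ∑ i ∈ s, ∫ y in Metric.ball (pos i) (δ / 2), F y := by
        refine Finset.sum_le_sum fun i hi => ?_
        refine setIntegral_mono_on (integrableOn_const measure_ball_lt_top.ne) hF.integrableOn
          measurableSet_ball fun y hy => ha i hi y ?_
        simpa [dist_eq_norm] using hy
    _ = ∫ y in ⋃ i ∈ s, Metric.ball (pos i) (δ / 2), F y :=
        (integral_biUnion_finset s (fun _ _ => measurableSet_ball) hdisj
          fun _ _ => hF.integrableOn).symm
    _ ≤ ∫ y, F y := setIntegral_le_integral hF (Filter.Eventually.of_forall hF0)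

lemma exists_sum_decay_le {δ : ℝ} (hδ : 0 < δ) : ∃ C : ℝ, 0 ≤ C ∧ ∀ {ι : Type} (s : Finset ι)
    (pos : ι → Space d), (∀ i ∈ s, ∀ j ∈ s, i ≠ j → δ < ‖pos i - pos j‖) →
    ∀ X, ∑ i ∈ s, decay (d + 1) (pos i + X) ≤ C := by
  set v := (volume : Measure (Space d)).real (Metric.ball 0 (δ / 2)) with hv
  have hv0 : 0 < v := ENNReal.toReal_pos (Metric.measure_ball_pos _ _ (by positivity)).ne'
    measure_ball_lt_top.ne
  have hi := integrable_decay_space (Nat.lt_succ_self d)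
  have hI0 : 0 ≤ ∫ y : Space d, decay (d + 1) y := integral_nonneg fun y => (decay_pos _ y).le
  refine ⟨((1 + δ / 2) ^ (d + 1) * ∫ y : Space d, decay (d + 1) y) / v, by positivity, ?_⟩
  intro ι s pos hsep X
  rw [le_div_iff₀ hv0, ← integral_add_right_eq_self _ X, ← integral_const_mul]
  refine sum_le_integral_of_separated s pos hsep ((hi.comp_add_right X).const_mul _)
    (fun y => mul_nonneg (by positivity) (decay_pos _ _).le) fun i _ y hy => ?_
  refine decay_le_of_le ?_
  have h1 := one_add_norm_add_le (y - pos i) (pos i + X)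
  rw [← add_assoc, sub_add_cancel] at h1
  refine h1.trans ?_
  gcongr

lemma card_le_of_separated {ι : Type*} (s : Finset ι) (pos : ι → Space d) {δ ρ : ℝ}
    (hδ : 0 < δ) (hsep : ∀ i ∈ s, ∀ j ∈ s, i ≠ j → δ < ‖pos i - pos j‖)
    (hρ : ∀ i ∈ s, ‖pos i‖ ≤ ρ) (hρδ : δ ≤ 2 * ρ) : (s.card : ℝ) ≤ (4 * ρ / δ) ^ d := by
  have hρ0 : 0 < ρ := by linarith
  have hball : ∀ t : ℝ, 0 < t → (volume : Measure (Space d)).real (Metric.ball 0 t) =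
      t ^ d * (volume : Measure (Space d)).real (Metric.ball 0 1) := fun t ht => by
    rw [Measure.real, Measure.addHaar_ball_of_pos _ _ ht, finrank_space, ENNReal.toReal_mul,
      ENNReal.toReal_ofReal (by positivity), Measure.real]
  have h := sum_le_integral_of_separated s pos hsep
    (F := (Metric.ball (0 : Space d) (ρ + δ / 2)).indicator fun _ => (1 : ℝ)) (a := fun _ => 1)
    ((integrable_indicator_iff measurableSet_ball).2 (integrableOn_const measure_ball_lt_top.ne))
    (fun x => Set.indicator_nonneg (fun _ _ => zero_le_one) x) fun i hi y hy => by
      rw [Set.indicator_of_mem]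
      rw [mem_ball_zero_iff]
      have := norm_add_le (y - pos i) (pos i)
      rw [sub_add_cancel] at this
      linarith [hρ i hi]
  rw [integral_indicator measurableSet_ball, setIntegral_const, smul_eq_mul, mul_one,
    Finset.sum_const, nsmul_eq_mul, mul_one, hball (δ / 2) (by positivity),
    hball (ρ + δ / 2) (by positivity)] at h
  have hv0 : 0 < (volume : Measure (Space d)).real (Metric.ball 0 1) :=
    ENNReal.toReal_pos (Metric.measure_ball_pos _ _ one_pos).ne' measure_ball_lt_top.ne
  rw [← mul_assoc] at h
  have h2 := le_of_mul_le_mul_right h hv0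
  rw [← le_div_iff₀ (by positivity), ← div_pow] at h2
  refine h2.trans (pow_le_pow_left₀ (by positivity) ?_ d)
  rw [div_le_div_iff₀ (by positivity) hδ]
  nlinarith

/-! ### Bounds on families of amplitudes, summed over the scatterers -/

/-- Integrals against the windowed transform of `f`, with linear weights. -/
lemma exists_sum_norm_integral_window_le (f : 𝓢(Space d, ℂ)) :
    ∃ C : ℝ, 0 ≤ C ∧ ∀ {J : Type} (s : Finset J) (n : Space d) (F : J → Space d × Space d → ℂ)
      (A : ℝ), 0 ≤ A →
      (∀ θ, ∑ j ∈ s, ‖F j θ‖ ≤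
        ‖window f (θ.1 - n) θ.2‖ * ((1 + ‖θ.1 - n‖) * (1 + ‖θ.2‖)) * A) →
      ∑ j ∈ s, ‖∫ θ, F j θ‖ ≤ C * A := by
  obtain ⟨C, hC, h⟩ := exists_window_le f (d + 2) (d + 2)
  have hi := integrable_decay_space (Nat.lt_succ_self d)
  set I : ℝ := ∫ y : Space d, decay (d + 1) y with hI
  have hI0 : 0 ≤ I := integral_nonneg fun y => (decay_pos _ y).le
  refine ⟨C * (I * I), by positivity, fun s n F A hA hF => ?_⟩
  have h2 : ∫ θ : Space d × Space d, C * (decay (d + 1) (θ.1 - n) * decay (d + 1) θ.2) * A =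
      C * (I * I) * A := by
    rw [integral_mul_const, integral_const_mul]
    congr 2
    rw [Measure.volume_eq_prod, integral_prod_mul (fun y : Space d => decay (d + 1) (y - n))
      (fun y : Space d => decay (d + 1) y), integral_sub_right_eq_self (decay (d + 1)) n]
  rw [← h2]
  have hint : Integrable fun θ : Space d × Space d =>
      C * (decay (d + 1) (θ.1 - n) * decay (d + 1) θ.2) * A :=
    (((hi.comp_sub_right n).mul_prod hi).const_mul C).mul_const A
  refine sum_norm_integral_le s hint fun θ => (hF θ).trans ?_
  have h3 := h (θ.1 - n) θ.2
  have h4 := norm_nonneg (θ.1 - n)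
  have h5 := norm_nonneg θ.2
  calc _ ≤ C * (decay (d + 2) (θ.1 - n) * decay (d + 2) θ.2) *
        ((1 + ‖θ.1 - n‖) * (1 + ‖θ.2‖)) * A := by gcongr
    _ = C * (((1 + ‖θ.1 - n‖) * decay (d + 1 + 1) (θ.1 - n)) *
        ((1 + ‖θ.2‖) * decay (d + 1 + 1) θ.2)) * A := by ring
    _ = _ := by rw [one_add_norm_mul_decay, one_add_norm_mul_decay]

/-- The properties of the rescaled scatterer positions that enter the estimates. -/
structure Scatterers {ι : Type} [Fintype ι] (cS κ : ℝ) (pos : ι → Space d) : Prop where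
  sum_le : ∀ X, ∑ i, decay (d + 1) (pos i + X) ≤ cS
  sep : ∀ i j, i ≠ j → 1 ≤ κ * ‖pos i - pos j‖

lemma Scatterers.neg {ι : Type} [Fintype ι] {cS κ : ℝ} {pos : ι → Space d}
    (h : Scatterers cS κ pos) : Scatterers cS κ fun i => -pos i := by
  refine ⟨fun X => ?_, fun i j hij => ?_⟩
  · convert h.sum_le (-X) using 2 with i
    rw [decay, decay, ← norm_neg, neg_add, neg_neg]
  · rw [← neg_sub', norm_neg]
    exact h.sep i j hij

/-- The deviation of a pair of packets from two packets of momentum `0` sitting at the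
scatterer `c`. -/
def deviation (c x n : Space d) (U : ℝ) (x' n' : Space d) (U' : ℝ) : ℝ :=
  1 + ‖x + c‖ + ‖x' - c‖ + ‖n‖ + ‖n'‖ + |U| + |U'|

lemma one_le_deviation (c x n : Space d) (U : ℝ) (x' n' : Space d) (U' : ℝ) :
    1 ≤ deviation c x n U x' n' U' := by
  unfold deviation
  have := norm_nonneg (x + c)
  have := norm_nonneg (x' - c)
  have := norm_nonneg n
  have := norm_nonneg n'
  have := abs_nonneg U
  have := abs_nonneg U'
  linarith

lemma deviation_swap (c x n : Space d) (U : ℝ) (x' n' : Space d) (U' : ℝ) :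
    deviation (-c) x' n' U' x n U = deviation c x n U x' n' U' := by
  unfold deviation
  rw [← sub_eq_add_neg, sub_neg_eq_add]
  ring

/-- A family of amplitudes `R j` (`j` collects the scatterers still to come), paired with packets,
has sum at most `M`, up to the cost of the evolution times; and the sum over the part `T c` of the
family, the continuations that are nondiagonal when the present block has scatterer `c`, is smaller
by the factor `κ`, up to the deviation of the packets from `c`. -/
structure IsBound {ι J : Type} [Fintype J] (ε M κ : ℝ) (pos : ι → Space d)
    (R : J → Space d → Space d → ℂ) (T : ι → Finset J) : Prop where
  bdd : ∀ j, BddMeas (R j)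
  all : ∀ x n U x' n' U',
    ∑ j, ‖pair (R j) x n U x' n' U'‖ ≤ M * Real.exp (ε * (|U| + |U'|))
  nondiag : ∀ c x n U x' n' U', ∑ j ∈ T c, ‖pair (R j) x n U x' n' U'‖ ≤
    M * κ * deviation (pos c) x n U x' n' U' * Real.exp (ε * (|U| + |U'|))

lemma IsBound.swap {ι J : Type} [Fintype J] {ε M κ : ℝ} {pos : ι → Space d}
    {R : J → Space d → Space d → ℂ} {T : ι → Finset J} (h : IsBound ε M κ pos R T) :
    IsBound ε M κ (fun i => -pos i) (fun j p p' => R j p' p) T := by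
  refine ⟨fun j => (h.bdd j).swap, fun x n U x' n' U' => ?_, fun c x n U x' n' U' => ?_⟩
  · simp_rw [← pair_swap (h.bdd _) x' n' U' x n U, add_comm |U|]
    exact h.all x' n' U' x n U
  · simp_rw [← pair_swap (h.bdd _) x' n' U' x n U, add_comm |U|]
    rw [deviation_swap]
    exact h.nondiag c x' n' U' x n U

section Families

variable {ι J : Type} [Fintype ι] [Fintype J]

open Classical in
/-- The pairs of a scatterer and a continuation that are nondiagonal in a block with
scatterer `c`. -/
def nondiagExt (T : ι → Finset J) (c : ι) : Finset (ι × J) :=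
  Finset.univ.filter fun v => v.1 = c → v.2 ∈ T c

open Classical in
/-- The pairs of a scatterer and a continuation that are nondiagonal when the scatterer opens a
block. -/
def nondiagNew (T : ι → Finset J) : Finset (ι × J) :=
  Finset.univ.filter fun v => v.2 ∈ T v.1

open Classical in
lemma sum_nondiagExt (T : ι → Finset J) (c : ι) (F : ι × J → ℝ) :
    ∑ v ∈ nondiagExt T c, F v =
      ∑ i, if i = c then ∑ j ∈ T c, F (i, j) else ∑ j, F (i, j) := by
  rw [nondiagExt, Finset.sum_filter, Fintype.sum_prod_type]
  refine Finset.sum_congr rfl fun i _ => ?_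
  split_ifs with h
  · simp [h, Finset.sum_ite_mem]
  · simp [h]

lemma sum_nondiagNew (T : ι → Finset J) (F : ι × J → ℝ) :
    ∑ v ∈ nondiagNew T, F v = ∑ i, ∑ j ∈ T i, F (i, j) := by
  classical
  rw [nondiagNew, Finset.sum_filter, Fintype.sum_prod_type]
  refine Finset.sum_congr rfl fun i _ => ?_
  simp [Finset.sum_ite_mem]

end Families

lemma sub_one_add_sub_one_add_le {A B w : ℝ} (hA : 1 ≤ A) (hB : 1 ≤ B) (hw : 1 ≤ w) :
    (A - 1) + (B - 1) + w ≤ A * B * w := by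
  have h1 : A + B - 1 ≤ A * B := by nlinarith
  have h2 : 1 ≤ A * B := by nlinarith
  nlinarith

lemma norm_sub_le_deviation (q c y x n x' n' : Space d) (U U' : ℝ) :
    ‖q - c‖ ≤ (1 + ‖q + (x + y + U • n)‖) *
      ((1 + |U|) * ((1 + ‖y‖) * deviation c x n U x' n' U')) := by
  set Y := q + (x + y + U • n) with hY
  set w := deviation c x n U x' n' U' with hw
  have hw1 : 1 ≤ w := one_le_deviation _ _ _ _ _ _ _
  have h0 := norm_nonneg y
  have h1 := norm_nonneg (x + c)
  have h2 := norm_nonneg (x' - c)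
  have h3 := norm_nonneg n
  have h4 := norm_nonneg n'
  have h5 := abs_nonneg U
  have h6 := abs_nonneg U'
  have h7 : ‖q - c‖ ≤ ‖Y‖ + (|U| * ‖n‖ + (‖y‖ + ‖x + c‖)) := by
    rw [show q - c = Y - (U • n + (y + (x + c))) by rw [hY]; abel]
    refine (norm_sub_le _ _).trans ?_
    gcongr
    refine (norm_add_le _ _).trans ?_
    rw [norm_smul, Real.norm_eq_abs]
    gcongr
    exact norm_add_le _ _
  have hBw : 1 ≤ (1 + ‖y‖) * w := by nlinarith
  have h9 : ‖n‖ ≤ (1 + ‖y‖) * w := by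
    have : ‖n‖ ≤ w := by rw [hw, deviation]; linarith
    nlinarith
  have h10 : ‖y‖ + ‖x + c‖ ≤ (1 + ‖y‖) * w := by
    have : 1 + ‖x + c‖ ≤ w := by rw [hw, deviation]; linarith
    nlinarith
  have h8 : |U| * ‖n‖ + (‖y‖ + ‖x + c‖) ≤ (1 + |U|) * ((1 + ‖y‖) * w) := by nlinarith
  have h11 : 1 ≤ (1 + |U|) * ((1 + ‖y‖) * w) := by nlinarith
  have h12 := norm_nonneg Y
  nlinarith

/-- One scattering inside a block. A new scatterer different from the present one costs the factor
`κ`, since a packet starting at the present one has to reach it. -/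
lemma exists_bound_scatter_zero (f : 𝓢(Space d, ℂ)) {ε : ℝ} (hε : 0 < ε) (cS : ℝ) :
    ∃ C : ℝ, 0 ≤ C ∧ ∀ {ι J : Type} [Fintype ι] [Fintype J] (κ M : ℝ) (pos : ι → Space d)
      (R : J → Space d → Space d → ℂ) (T : ι → Finset J), 0 ≤ κ → 0 ≤ M → Scatterers cS κ pos →
      IsBound ε M κ pos R T →
      IsBound ε (C * M) κ pos (fun v : ι × J => scatter f 0 (pos v.1) (R v.2))
        (nondiagExt T) := by
  classical
  obtain ⟨cw, hcw, hw⟩ := exists_sum_norm_integral_window_le f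
  obtain ⟨cG, hcG, hG⟩ := exists_packetMass_le (d := d) (d + 2) hε
  refine ⟨cw * (cG * (1 + |cS|)), by positivity, ?_⟩
  intro ι J _ _ κ M pos R T hκ hM hs hb
  have hcS : ∀ X, ∑ i, decay (d + 1) (pos i + X) ≤ |cS| := fun X =>
    (hs.sum_le X).trans (le_abs_self _)
  have hG1 : ∀ X n U, ‖packetMass (d := d) X n U‖ ≤
      cG * Real.exp (ε * |U|) * decay (d + 2) (X + U • n) := fun X n U => by
    have := hG X n U
    nlinarith [norm_nonneg (packetMass X n U), abs_nonneg U]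
  refine ⟨fun v => (hb.bdd _).scatter f 0 _, fun x n U x' n' U' => ?_,
    fun c x n U x' n' U' => ?_⟩
  · have := hw Finset.univ n (fun (v : ι × J) θ => window f (θ.1 - n) θ.2 *
      packetMass (x + pos v.1 + θ.2) n U * pair (R v.2) (-pos v.1 - θ.2) θ.1 0 x' n' U')
      (cG * (1 + |cS|) * M * Real.exp (ε * (|U| + |U'|))) (by positivity) fun θ => ?_
    · simp_rw [pair_scatter_zero f (hb.bdd _)]
      calc _ ≤ _ := this
        _ = _ := by ring
    rw [Fintype.sum_prod_type]
    simp_rw [norm_mul, mul_assoc ‖window f (θ.1 - n) θ.2‖, ← Finset.mul_sum]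
    have h4 := norm_nonneg (θ.1 - n)
    have h5 := norm_nonneg θ.2
    refine mul_le_mul_of_nonneg_left ?_ (norm_nonneg _)
    calc ∑ i, ‖packetMass (x + pos i + θ.2) n U‖ *
          ∑ j, ‖pair (R j) (-pos i - θ.2) θ.1 0 x' n' U'‖
        ≤ ∑ i, cG * Real.exp (ε * |U|) * decay (d + 1) (pos i + (x + θ.2 + U • n)) *
            (M * Real.exp (ε * |U'|)) := by
          refine Finset.sum_le_sum fun i _ => ?_
          have h1 := hG1 (x + pos i + θ.2) n U
          have h2 := hb.all (-pos i - θ.2) θ.1 0 x' n' U'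
          rw [abs_zero, zero_add] at h2
          refine mul_le_mul (h1.trans ?_) h2 (Finset.sum_nonneg fun _ _ => norm_nonneg _)
            (mul_nonneg (by positivity) (decay_pos _ _).le)
          rw [show x + pos i + θ.2 + U • n = pos i + (x + θ.2 + U • n) by abel]
          exact mul_le_mul_of_nonneg_left (decay_anti (Nat.le_succ _) _) (by positivity)
      _ = cG * Real.exp (ε * |U|) * (M * Real.exp (ε * |U'|)) *
            ∑ i, decay (d + 1) (pos i + (x + θ.2 + U • n)) := by
          rw [Finset.mul_sum]
          exact Finset.sum_congr rfl fun i _ => by ring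
      _ ≤ cG * Real.exp (ε * |U|) * (M * Real.exp (ε * |U'|)) * (1 + |cS|) := by
          gcongr
          linarith [hcS (x + θ.2 + U • n)]
      _ = 1 * (cG * (1 + |cS|) * M * Real.exp (ε * (|U| + |U'|))) := by
          rw [mul_add ε, Real.exp_add]; ring
      _ ≤ _ := by
          gcongr
          nlinarith
  · set wt := deviation (pos c) x n U x' n' U' with hwt
    have hwt1 : 1 ≤ wt := one_le_deviation _ _ _ _ _ _ _
    have := hw (nondiagExt T c) n (fun (v : ι × J) θ => window f (θ.1 - n) θ.2 *
      packetMass (x + pos v.1 + θ.2) n U * pair (R v.2) (-pos v.1 - θ.2) θ.1 0 x' n' U')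
      (cG * (1 + |cS|) * M * κ * wt * Real.exp (ε * (|U| + |U'|))) (by positivity) fun θ => ?_
    · simp_rw [pair_scatter_zero f (hb.bdd _)]
      calc _ ≤ _ := this
        _ = _ := by ring
    rw [sum_nondiagExt]
    set A := 1 + ‖θ.1 - n‖ with hA
    set B := 1 + ‖θ.2‖ with hB
    have h4 := norm_nonneg (θ.1 - n)
    have h5 := norm_nonneg θ.2
    have hA1 : 1 ≤ A := by linarith
    have hB1 : 1 ≤ B := by linarith
    have hA0 : 0 < A := by linarith
    have hB0 : 0 < B := by linarith
    set E := Real.exp (ε * |U|) with hE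
    set E' := Real.exp (ε * |U'|) with hE'
    have hx0 := norm_nonneg (x + pos c)
    have hx0' := norm_nonneg (x' - pos c)
    have hn0 := norm_nonneg n
    have hn0' := norm_nonneg n'
    have hU0 := abs_nonneg U
    have hU0' := abs_nonneg U'
    set Y := fun i => pos i + (x + θ.2 + U • n) with hY
    -- the present scatterer again: the deviation stays under control
    have hsame : ‖packetMass (x + pos c + θ.2) n U‖ *
        ∑ j ∈ T c, ‖pair (R j) (-pos c - θ.2) θ.1 0 x' n' U'‖ ≤
          cG * E * (M * κ * (A * B * wt) * E') := by
      have h1 := hG1 (x + pos c + θ.2) n U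
      have h2 := hb.nondiag c (-pos c - θ.2) θ.1 0 x' n' U'
      rw [abs_zero, zero_add] at h2
      refine mul_le_mul (h1.trans (mul_le_of_le_one_right (by positivity) (decay_le_one _ _)))
        (h2.trans ?_) (Finset.sum_nonneg fun _ _ => norm_nonneg _) (by positivity)
      gcongr
      rw [deviation, show -pos c - θ.2 + pos c = -θ.2 by abel, norm_neg, abs_zero]
      have h3 : ‖θ.1‖ ≤ ‖θ.1 - n‖ + ‖n‖ := by
        simpa using norm_add_le (θ.1 - n) n
      have h6 : 1 + ‖θ.2‖ + ‖x' - pos c‖ + ‖θ.1‖ + ‖n'‖ + 0 + |U'| ≤ (A - 1) + (B - 1) + wt := by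
        rw [hwt, hA, hB, deviation]
        linarith
      exact h6.trans (sub_one_add_sub_one_add_le hA1 hB1 hwt1)
    -- another scatterer: the distance is paid for by the decay of the mass of the packet
    have hother : ∀ i, i ≠ c → ‖packetMass (x + pos i + θ.2) n U‖ *
        ∑ j, ‖pair (R j) (-pos i - θ.2) θ.1 0 x' n' U'‖ ≤
          cG * E * (M * κ * (A * B * wt) * E') * decay (d + 1) (Y i) := by
      intro i hi
      have h1 := hG (x + pos i + θ.2) n U
      rw [show x + pos i + θ.2 + U • n = Y i by simp only [hY]; abel] at h1
      have h2 := hb.all (-pos i - θ.2) θ.1 0 x' n' U'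
      rw [abs_zero, zero_add] at h2
      have h3 : ‖pos i - pos c‖ ≤ (1 + ‖Y i‖) * ((1 + |U|) * (B * wt)) :=
        norm_sub_le_deviation (pos i) (pos c) θ.2 x n x' n' U U'
      have h13 : 1 ≤ κ * ((1 + ‖Y i‖) * ((1 + |U|) * (B * wt))) :=
        (hs.sep i c hi).trans (by gcongr)
      have h14 := norm_nonneg (Y i)
      have h15 : B * wt ≤ A * B * wt := by
        rw [mul_assoc]
        exact le_mul_of_one_le_left (by positivity) hA1
      have h16 := (decay_pos (d + 2) (Y i)).le
      calc _ ≤ ‖packetMass (x + pos i + θ.2) n U‖ * (M * E') := by gcongr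
        _ ≤ ‖packetMass (x + pos i + θ.2) n U‖ * (M * E') *
            (κ * ((1 + ‖Y i‖) * ((1 + |U|) * (B * wt)))) :=
            le_mul_of_one_le_right (by positivity) h13
        _ = ((1 + |U|) * ‖packetMass (x + pos i + θ.2) n U‖) * (1 + ‖Y i‖) *
            (M * κ * (B * wt) * E') := by ring
        _ ≤ (cG * E * decay (d + 2) (Y i)) * (1 + ‖Y i‖) * (M * κ * (A * B * wt) * E') := by
            gcongr
        _ = cG * E * (M * κ * (A * B * wt) * E') *
            ((1 + ‖Y i‖) * decay (d + 1 + 1) (Y i)) := by ring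
        _ = _ := by rw [one_add_norm_mul_decay]
    simp_rw [norm_mul, mul_assoc ‖window f (θ.1 - n) θ.2‖, ← Finset.mul_sum]
    simp_rw [← mul_ite, ← Finset.mul_sum]
    refine mul_le_mul_of_nonneg_left ?_ (norm_nonneg _)
    have hterm : ∀ i, ‖packetMass (x + pos i + θ.2) n U‖ *
        (if i = c then ∑ j ∈ T c, ‖pair (R j) (-pos i - θ.2) θ.1 0 x' n' U'‖ else
          ∑ j, ‖pair (R j) (-pos i - θ.2) θ.1 0 x' n' U'‖) ≤
        cG * E * (M * κ * (A * B * wt) * E') * ((if i = c then 1 else 0) +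
          decay (d + 1) (Y i)) := by
      intro i
      have hd := (decay_pos (d + 1) (Y i)).le
      split_ifs with hi
      · subst hi
        refine hsame.trans (le_mul_of_one_le_right (by positivity) (by linarith))
      · rw [zero_add]
        exact hother i hi
    calc _ ≤ ∑ i, cG * E * (M * κ * (A * B * wt) * E') * ((if i = c then 1 else 0) +
          decay (d + 1) (Y i)) := Finset.sum_le_sum fun i _ => hterm i
      _ = cG * E * (M * κ * (A * B * wt) * E') * (1 + ∑ i, decay (d + 1) (Y i)) := by
          rw [← Finset.mul_sum, Finset.sum_add_distrib, Finset.sum_ite_eq' Finset.univ c]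
          simp
      _ ≤ cG * E * (M * κ * (A * B * wt) * E') * (1 + |cS|) := by
          gcongr
          exact hcS _
      _ = _ := by
          rw [mul_add ε, Real.exp_add]; ring

/-- One scattering inside a block, of either momentum. -/
lemma exists_bound_scatter (f : 𝓢(Space d, ℂ)) {ε : ℝ} (hε : 0 < ε) (cS : ℝ) :
    ∃ C : ℝ, 0 ≤ C ∧ ∀ {ι J : Type} [Fintype ι] [Fintype J] (κ M : ℝ) (pos : ι → Space d)
      (R : J → Space d → Space d → ℂ) (T : ι → Finset J), 0 ≤ κ → 0 ≤ M → Scatterers cS κ pos →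
      IsBound ε M κ pos R T → ∀ g : ℝ, g = 0 ∨ g = 1 →
      IsBound ε (C * M) κ pos (fun v : ι × J => scatter f g (pos v.1) (R v.2))
        (nondiagExt T) := by
  obtain ⟨C₀, hC₀, h₀⟩ := exists_bound_scatter_zero f hε cS
  obtain ⟨C₁, hC₁, h₁⟩ := exists_bound_scatter_zero (reflect f) hε cS
  refine ⟨C₀ + C₁, by positivity, ?_⟩
  intro ι J _ _ κ M pos R T hκ hM hs hb g hg
  have hmono : ∀ {C : ℝ} {R' : ι × J → Space d → Space d → ℂ} {pos' : ι → Space d},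
      C ≤ C₀ + C₁ → IsBound ε (C * M) κ pos' R' (nondiagExt T) →
      IsBound ε ((C₀ + C₁) * M) κ pos' R' (nondiagExt T) := by
    intro C R' pos' hC h
    refine ⟨h.bdd, fun x n U x' n' U' => (h.all x n U x' n' U').trans (by gcongr),
      fun c x n U x' n' U' => (h.nondiag c x n U x' n' U').trans ?_⟩
    have := one_le_deviation (pos' c) x n U x' n' U'
    gcongr
  rcases hg with rfl | rfl
  · exact hmono (by linarith) (h₀ κ M pos R T hκ hM hs hb)
  · have h := (h₁ κ M (fun i => -pos i) (fun j p p' => R j p' p) T hκ hM hs.neg hb.swap).swap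
    simp only [neg_neg] at h
    have hR : (fun (v : ι × J) (p p' : Space d) =>
        scatter (reflect f) 0 (-pos v.1) (fun a b => R v.2 b a) p' p) =
        fun v : ι × J => scatter f 1 (pos v.1) (R v.2) := by
      ext v p p'
      rw [scatter_one_eq]
    rw [hR] at h
    exact hmono (by linarith) h

/-- The weight of a single packet at momentum difference `H`. -/
def lineWeight (H x n : Space d) (U : ℝ) : ℝ :=
  1 + ‖x‖ + ‖n‖ + ‖H‖ + |U| * (1 + ‖H‖)

lemma one_le_lineWeight (H x n : Space d) (U : ℝ) : 1 ≤ lineWeight H x n U := by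
  unfold lineWeight
  have := norm_nonneg x
  have := norm_nonneg n
  have := norm_nonneg H
  have : 0 ≤ |U| * (1 + ‖H‖) := by positivity
  linarith

/-- The analogue of `IsBound` for amplitudes restricted to a fixed momentum difference. -/
structure IsLineBound {J : Type} [Fintype J] (ε K κ : ℝ) (R : J → Space d → Space d → ℂ)
    (T : Finset J) : Prop where
  all : ∀ H x n U, ∑ j, ‖linePair (R j) H x n U‖ ≤ K * Real.exp (ε * |U|)
  nondiag : ∀ H x n U, ∑ j ∈ T, ‖linePair (R j) H x n U‖ ≤
    K * κ * lineWeight H x n U * Real.exp (ε * |U|)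

lemma exists_lineBound_scatter_zero (f : 𝓢(Space d, ℂ)) {ε : ℝ} :
    ∃ C : ℝ, 0 ≤ C ∧ ∀ {ι J : Type} [Fintype ι] [Fintype J] (κ M : ℝ) (pos : ι → Space d)
      (R : J → Space d → Space d → ℂ) (T : ι → Finset J), 0 ≤ κ → 0 ≤ M →
      IsBound ε M κ pos R T →
      IsLineBound ε (C * Fintype.card ι * M) κ (fun v : ι × J => scatter f 0 (pos v.1) (R v.2))
        (nondiagNew T) := by
  obtain ⟨cw, hcw, hw⟩ := exists_sum_norm_integral_window_le f
  refine ⟨cw * 2, by positivity, ?_⟩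
  intro ι J _ _ κ M pos R T hκ hM hb
  refine ⟨fun H x n U => ?_, fun H x n U => ?_⟩
  · have := hw Finset.univ (n + H) (fun (v : ι × J) θ => window f (θ.1 - (n + H)) θ.2 *
      e ⟪pos v.1 + θ.2, H⟫ * pair (R v.2) (-pos v.1 - θ.2) θ.1 0 (x + pos v.1 + θ.2) n U)
      (2 * Fintype.card ι * M * Real.exp (ε * |U|)) (by positivity) fun θ => ?_
    · simp_rw [linePair_scatter_zero f (hb.bdd _)]
      calc _ ≤ _ := this
        _ = _ := by ring
    rw [Fintype.sum_prod_type]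
    simp_rw [norm_mul, norm_e, mul_one, ← Finset.mul_sum, mul_assoc ‖window f _ _‖]
    refine mul_le_mul_of_nonneg_left ?_ (norm_nonneg _)
    have h4 := norm_nonneg (θ.1 - (n + H))
    have h5 := norm_nonneg θ.2
    calc _ ≤ ∑ _i : ι, M * Real.exp (ε * |U|) := Finset.sum_le_sum fun i _ => by
          have := hb.all (-pos i - θ.2) θ.1 0 (x + pos i + θ.2) n U
          rwa [abs_zero, zero_add] at this
      _ = 1 * (1 * Fintype.card ι * M * Real.exp (ε * |U|)) := by
          rw [Finset.sum_const, nsmul_eq_mul, Finset.card_univ]; ring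
      _ ≤ _ := by
          gcongr
          · nlinarith
          · norm_num
  · set w := lineWeight H x n U with hwt
    have hw1 : 1 ≤ w := one_le_lineWeight H x n U
    have := hw (nondiagNew T) (n + H) (fun (v : ι × J) θ => window f (θ.1 - (n + H)) θ.2 *
      e ⟪pos v.1 + θ.2, H⟫ * pair (R v.2) (-pos v.1 - θ.2) θ.1 0 (x + pos v.1 + θ.2) n U)
      (2 * Fintype.card ι * M * κ * w * Real.exp (ε * |U|)) (by positivity) fun θ => ?_
    · simp_rw [linePair_scatter_zero f (hb.bdd _)]
      calc _ ≤ _ := this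
        _ = _ := by ring
    rw [sum_nondiagNew]
    simp_rw [norm_mul, norm_e, mul_one, ← Finset.mul_sum, mul_assoc ‖window f _ _‖]
    refine mul_le_mul_of_nonneg_left ?_ (norm_nonneg _)
    set A := 1 + ‖θ.1 - (n + H)‖ with hA
    set B := 1 + ‖θ.2‖ with hB
    have h4 := norm_nonneg (θ.1 - (n + H))
    have h5 := norm_nonneg θ.2
    calc _ ≤ ∑ _i : ι, M * κ * (2 * (A * B * w)) * Real.exp (ε * |U|) :=
          Finset.sum_le_sum fun i _ => by
          refine (hb.nondiag i (-pos i - θ.2) θ.1 0 (x + pos i + θ.2) n U).trans ?_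
          rw [abs_zero, zero_add]
          gcongr
          refine le_trans ?_ (mul_le_mul_of_nonneg_left
            (sub_one_add_sub_one_add_le (A := A) (B := B) (by linarith) (by linarith) hw1)
            zero_le_two)
          rw [deviation, show -pos i - θ.2 + pos i = -θ.2 by abel,
            show x + pos i + θ.2 - pos i = x + θ.2 by abel, norm_neg, abs_zero, hA, hB, hwt,
            lineWeight]
          have h6 : ‖θ.1‖ ≤ ‖θ.1 - (n + H)‖ + (‖n‖ + ‖H‖) := by
            have := norm_add_le (θ.1 - (n + H)) (n + H)
            rw [sub_add_cancel] at this
            linarith [norm_add_le n H]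
          have h7 := norm_add_le x θ.2
          have h8 := norm_nonneg x
          have h9 := norm_nonneg n
          have h10 := norm_nonneg H
          have h11 : 0 ≤ |U| * ‖H‖ := by positivity
          have h12 := abs_nonneg U
          linarith
      _ = _ := by
          rw [Finset.sum_const, nsmul_eq_mul, Finset.card_univ]; ring

lemma exists_lineBound_scatter (f : 𝓢(Space d, ℂ)) {ε : ℝ} :
    ∃ C : ℝ, 0 ≤ C ∧ ∀ {ι J : Type} [Fintype ι] [Fintype J] (κ M : ℝ) (pos : ι → Space d)
      (R : J → Space d → Space d → ℂ) (T : ι → Finset J), 0 ≤ κ → 0 ≤ M →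
      IsBound ε M κ pos R T → ∀ g : ℝ, g = 0 ∨ g = 1 →
      IsLineBound ε (C * Fintype.card ι * M) κ (fun v : ι × J => scatter f g (pos v.1) (R v.2))
        (nondiagNew T) := by
  obtain ⟨C₀, hC₀, h₀⟩ := exists_lineBound_scatter_zero f (ε := ε)
  obtain ⟨C₁, hC₁, h₁⟩ := exists_lineBound_scatter_zero (reflect f) (ε := ε)
  refine ⟨C₀ + 3 * C₁, by positivity, ?_⟩
  intro ι J _ _ κ M pos R T hκ hM hb g hg
  rcases hg with rfl | rfl
  · have h := h₀ κ M pos R T hκ hM hb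
    refine ⟨fun H x n U => (h.all H x n U).trans ?_, fun H x n U => (h.nondiag H x n U).trans ?_⟩
    · gcongr
      linarith
    · have := one_le_lineWeight H x n U
      gcongr
      linarith
  · have h := h₁ κ M (fun i => -pos i) (fun j p p' => R j p' p) T hκ hM hb.swap
    refine ⟨fun H x n U => ?_, fun H x n U => ?_⟩
    · simp_rw [linePair_scatter_one, norm_mul, norm_e, one_mul]
      refine (h.all (-H) (x - U • H) (n + H) U).trans ?_
      gcongr
      linarith
    · simp_rw [linePair_scatter_one, norm_mul, norm_e, one_mul]
      refine (h.nondiag (-H) (x - U • H) (n + H) U).trans ?_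
      have h1 : lineWeight (-H) (x - U • H) (n + H) U ≤ 3 * lineWeight H x n U := by
        have h2 : ‖x - U • H‖ ≤ ‖x‖ + |U| * ‖H‖ := by
          refine (norm_sub_le _ _).trans ?_
          rw [norm_smul, Real.norm_eq_abs]
        have h3 := norm_add_le n H
        have h8 := norm_nonneg x
        have h9 := norm_nonneg n
        have h10 := norm_nonneg H
        have h11 : 0 ≤ |U| * ‖H‖ := by positivity
        have h12 := abs_nonneg U
        rw [lineWeight, lineWeight, norm_neg]
        linarith
      have h2 := one_le_lineWeight H x n U
      calc _ ≤ C₁ * Fintype.card ι * M * κ * (3 * lineWeight H x n U) * Real.exp (ε * |U|) := by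
            gcongr
        _ = 3 * C₁ * Fintype.card ι * M * κ * lineWeight H x n U * Real.exp (ε * |U|) := by ring
        _ ≤ _ := by
            gcongr
            linarith

/-! ### One stage of the evolution -/

/-- The factor of one stage: free evolution for the time `u`, and the multiplier `D + N w`, where
`w` is the momentum difference in units of `h`. -/
def stageFactor (h u D : ℝ) (N : Space d → ℂ) (p p' : Space d) : ℂ :=
  e (u / 2 * (‖p‖ ^ 2 - ‖p'‖ ^ 2)) * (D + N (h⁻¹ • (p - p')))

/-- The two kinds of stages. At a node (`s`) the momentum difference is confined to a ball and the
time is at most `t / h`; otherwise the time is exponentially damped. -/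
structure IsStage (a ρ t h : ℝ) (s : Prop) (u D : ℝ) (N : Space d → ℂ) : Prop where
  nonneg : 0 ≤ u
  meas : Measurable N
  supp : ∀ w, ρ < ‖w‖ → N w = 0
  node : s → D = 0 ∧ h * u ≤ t ∧ ∀ w, ‖N w‖ ≤ 1
  inner : ¬ s → D = Real.exp (-(a * u)) ∧ ∀ w, ‖N w‖ ≤ Real.exp (-(a * u))

open Classical in
/-- The size of one stage, up to a constant. -/
def stageSize (a h : ℝ) (s : Prop) (u : ℝ) : ℝ := if s then h else Real.exp (-(a / 2 * u))

lemma stageSize_pos {a h : ℝ} (hh : 0 < h) (s : Prop) (u : ℝ) : 0 < stageSize a h s u := by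
  unfold stageSize
  split_ifs
  · exact hh
  · exact Real.exp_pos _

lemma bddMeas_node {R : Space d → Space d → ℂ} (hR : BddMeas R) {N : Space d → ℂ}
    (hN : Measurable N) {τ : ℝ} (hτ : ∀ w, ‖N w‖ ≤ τ) (h u : ℝ) :
    BddMeas fun p p' => e (u / 2 * (‖p‖ ^ 2 - ‖p'‖ ^ 2)) * N (h⁻¹ • (p - p')) * R p p' := by
  obtain ⟨K, hK⟩ := hR.bdd
  have := continuous_e
  refine ⟨Measurable.mul (Measurable.mul ?_ ?_) hR.meas, τ * K, fun p p' => ?_⟩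
  · exact Continuous.measurable (by fun_prop)
  · exact hN.comp (by fun_prop)
  · rw [norm_mul, norm_mul, norm_e, one_mul]
    exact mul_le_mul (hτ _) (hK _ _) (norm_nonneg _) ((norm_nonneg _).trans (hτ 0))

/-- A stage acts on a pair of packets by a shift of the times, weighted with `D`, plus the node
part. -/
lemma norm_pair_stage_le {R : Space d → Space d → ℂ} (hR : BddMeas R) {N : Space d → ℂ}
    (hN : Measurable N) {τ : ℝ} (hτ : ∀ w, ‖N w‖ ≤ τ) {D : ℝ} (hD : 0 ≤ D) (h u : ℝ)
    (x n x' n' : Space d) (U U' : ℝ) :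
    ‖pair (fun p p' => stageFactor h u D N p p' * R p p') x n U x' n' U'‖ ≤
      D * ‖pair R x n (U + u) x' n' (U' - u)‖ +
      ‖pair (fun p p' => e (u / 2 * (‖p‖ ^ 2 - ‖p'‖ ^ 2)) * N (h⁻¹ • (p - p')) * R p p')
        x n U x' n' U'‖ := by
  have h1 : pair (fun p p' => stageFactor h u D N p p' * R p p') x n U x' n' U' =
      D * pair R x n (U + u) x' n' (U' - u) +
      pair (fun p p' => e (u / 2 * (‖p‖ ^ 2 - ‖p'‖ ^ 2)) * N (h⁻¹ • (p - p')) * R p p')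
        x n U x' n' U' := by
    have i1 := (integrable_pair hR x n (U + u) x' n' (U' - u)).const_mul (D : ℂ)
    have i2 := integrable_pair (bddMeas_node hR hN hτ h u) x n U x' n' U'
    have hv : ∀ v : Space d × Space d, packet x n U v.1 * packet x' n' U' v.2 *
        (stageFactor h u D N v.1 v.2 * R v.1 v.2) =
        D * (packet x n (U + u) v.1 * packet x' n' (U' - u) v.2 * R v.1 v.2) +
        packet x n U v.1 * packet x' n' U' v.2 * (e (u / 2 * (‖v.1‖ ^ 2 - ‖v.2‖ ^ 2)) *
          N (h⁻¹ • (v.1 - v.2)) * R v.1 v.2) := by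
      intro v
      have h2 : e (U / 2 * ‖v.1‖ ^ 2) * e (U' / 2 * ‖v.2‖ ^ 2) *
          e (u / 2 * (‖v.1‖ ^ 2 - ‖v.2‖ ^ 2)) =
          e ((U + u) / 2 * ‖v.1‖ ^ 2) * e ((U' - u) / 2 * ‖v.2‖ ^ 2) := by
        simp only [← e_add]
        congr 1
        ring
      simp only [packet, stageFactor]
      linear_combination (D * bump d (v.1 - n) * e ⟪x, v.1⟫ * bump d (v.2 - n') * e ⟪x', v.2⟫ *
        R v.1 v.2) * h2
    have i3 := (i1.add i2).congr (Filter.Eventually.of_forall fun v => (hv v).symm)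
    calc _ = ∫ v : Space d × Space d, packet x n U v.1 * packet x' n' U' v.2 *
        (stageFactor h u D N v.1 v.2 * R v.1 v.2) := (integral_prod _ i3).symm
      _ = (∫ v : Space d × Space d,
          D * (packet x n (U + u) v.1 * packet x' n' (U' - u) v.2 * R v.1 v.2)) +
          ∫ v : Space d × Space d, packet x n U v.1 * packet x' n' U' v.2 *
            (e (u / 2 * (‖v.1‖ ^ 2 - ‖v.2‖ ^ 2)) * N (h⁻¹ • (v.1 - v.2)) * R v.1 v.2) := by
        simp_rw [hv]
        exact integral_add i1 i2
      _ = _ := by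
        rw [integral_const_mul]
        congr 1
        · congr 1
          exact integral_prod _ (integrable_pair hR x n (U + u) x' n' (U' - u))
        · exact integral_prod _ i2
  rw [h1]
  refine (norm_add_le _ _).trans ?_
  rw [norm_mul, Complex.norm_real, Real.norm_of_nonneg hD]

lemma lineWeight_le (c x n x' n' X w : Space d) {U U' h u t ρ H₀ : ℝ} (hh : 0 < h) (hH : h ≤ H₀)
    (hu : 0 ≤ u) (ht : h * u ≤ t) (hw : ‖w‖ ≤ ρ) :
    lineWeight (h • w) (x + x' + X + (U + u) • h • w) n' (U + U') ≤
      (1 + 2 * (H₀ * ρ) + t * ρ) * deviation c x n U x' n' U' * (1 + ‖X‖) := by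
  have hρ : 0 ≤ ρ := (norm_nonneg w).trans hw
  have hH' : 0 ≤ H₀ := hh.le.trans hH
  have h1 : ‖h • w‖ ≤ H₀ * ρ := by
    rw [norm_smul, Real.norm_of_nonneg hh.le]
    gcongr
  have h2 : u * ‖h • w‖ ≤ t * ρ := by
    rw [norm_smul, Real.norm_of_nonneg hh.le, ← mul_assoc, mul_comm u]
    gcongr
    exact (mul_nonneg hh.le hu).trans ht
  have h3 : ‖x + x' + X + (U + u) • h • w‖ ≤
      ‖x + c‖ + ‖x' - c‖ + ‖X‖ + (|U| * (H₀ * ρ) + t * ρ) := by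
    rw [show x + x' + X + (U + u) • h • w = (x + c) + (x' - c) + X + (U + u) • h • w by abel]
    have h4' : ‖(U + u) • h • w‖ ≤ |U| * (H₀ * ρ) + t * ρ := by
      have h4 := abs_add_le U u
      rw [abs_of_nonneg hu] at h4
      rw [norm_smul, Real.norm_eq_abs]
      calc |U + u| * ‖h • w‖ ≤ (|U| + u) * ‖h • w‖ := by gcongr
        _ = |U| * ‖h • w‖ + u * ‖h • w‖ := by ring
        _ ≤ _ := by gcongr
    exact norm_add₃_le.trans (add_le_add_three (norm_add_le _ _) le_rfl h4') |>.trans_eq (by ring)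
  have h5 := abs_add_le U U'
  have h6 : |U + U'| * (1 + ‖h • w‖) ≤ (|U| + |U'|) * (1 + H₀ * ρ) := by gcongr
  have hdev : 1 + ‖x + c‖ + ‖x' - c‖ + ‖n'‖ + |U| + |U'| ≤ deviation c x n U x' n' U' := by
    rw [deviation]
    linarith [norm_nonneg n]
  have hH0 : 0 ≤ H₀ * ρ := (norm_nonneg _).trans h1
  have htρ : 0 ≤ t * ρ := le_trans (by positivity) h2
  have hX := norm_nonneg X
  have h7 := abs_nonneg U
  have h8 := abs_nonneg U'
  have h9 := norm_nonneg (x + c)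
  have h10 := norm_nonneg (x' - c)
  have h11 := norm_nonneg n'
  set V := deviation c x n U x' n' U' with hV
  have hV1 : 1 ≤ V := one_le_deviation _ _ _ _ _ _ _
  have hsum : lineWeight (h • w) (x + x' + X + (U + u) • h • w) n' (U + U') ≤
      V + ‖X‖ + (2 * (H₀ * ρ) + t * ρ) * V := by
    rw [lineWeight]
    have h12 : (H₀ * ρ) * (1 + |U| + |U| + |U'|) + t * ρ * 1 ≤
        (H₀ * ρ) * (2 * V) + t * ρ * V := by
      gcongr
      linarith
    linarith
  have h13 : V + ‖X‖ + (2 * (H₀ * ρ) + t * ρ) * V ≤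
      (1 + 2 * (H₀ * ρ) + t * ρ) * V * (1 + ‖X‖) := by
    have h14 : 0 ≤ (2 * (H₀ * ρ) + t * ρ) * V * ‖X‖ := by positivity
    have h15 : ‖X‖ ≤ V * ‖X‖ := le_mul_of_one_le_left hX hV1
    linarith
  exact hsum.trans h13

open Classical in
/-- One stage, followed by one scattering, multiplies the bound by a constant times the size of the
stage. At a node the nondiagonal gain is asked for with respect to the next scatterer, since a new
block begins. -/
lemma exists_bound_stage (f : 𝓢(Space d, ℂ)) {a ρ t H₀ cS cN cκ : ℝ} (ha : 0 < a) (hρ : 0 ≤ ρ)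
    (ht : 0 ≤ t) (hH₀ : 0 ≤ H₀) (hcN : 0 ≤ cN) (hcκ : 0 ≤ cκ) :
    ∃ C : ℝ, 0 ≤ C ∧ ∀ {ι J : Type} [Fintype ι] [Fintype J] (κ M h : ℝ) (pos : ι → Space d)
      (R : J → Space d → Space d → ℂ) (T : ι → Finset J), 0 ≤ κ → 0 ≤ M → Scatterers cS κ pos →
      0 < h → h ≤ H₀ → h ^ d * Fintype.card ι ≤ cN * h → h ≤ cκ * κ →
      IsBound (a / 8) M κ pos R T → ∀ g : ℝ, g = 0 ∨ g = 1 →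
      ∀ (s : Prop) (u D : ℝ) (N : Space d → ℂ), IsStage a ρ t h s u D N →
      IsBound (a / 8) (C * M * stageSize a h s u) κ pos
        (fun (v : ι × J) p p' => stageFactor h u D N p p' * scatter f g (pos v.1) (R v.2) p p')
        (if s then fun _ => nondiagNew T else nondiagExt T) := by
  have hε : 0 < a / 8 := by positivity
  obtain ⟨C₁, hC₁, h₁⟩ := exists_bound_scatter f hε cS
  obtain ⟨C₂, hC₂, h₂⟩ := exists_lineBound_scatter f (ε := a / 8)
  obtain ⟨C₃, hC₃, h₃⟩ := exists_sum_norm_pair_node_le (d := d) ρ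
  obtain ⟨C₄, hC₄, h₄⟩ := exists_one_add_pow_le_exp 1 hε
  set K := 1 + 2 * (H₀ * ρ) + t * ρ with hK
  have hK0 : 0 ≤ K := by positivity
  refine ⟨C₁ * (1 + C₄) + C₃ * C₂ * cN * (1 + H₀ + cκ + K), by positivity, ?_⟩
  intro ι J _ _ κ M h pos R T hκ hM hs hh hhH hcard hhκ hb g hg s u D N hst
  set ε := a / 8 with hεdef
  have hb' := h₁ κ M pos R T hκ hM hs hb g hg
  have hl := h₂ κ M pos R T hκ hM hb g hg
  set σ := stageSize a h s u with hσ
  have hσ0 : 0 < σ := stageSize_pos hh s u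
  have hu := hst.nonneg
  -- the common size of the multiplier at the two kinds of stages
  obtain ⟨τ, hτ0, hτ, hτh, hτs⟩ : ∃ τ : ℝ, 0 ≤ τ ∧ (∀ w, ‖N w‖ ≤ τ) ∧ τ * h ≤ (1 + H₀) * σ ∧
      (¬ s → τ ≤ σ) := by
    by_cases hs' : s
    · refine ⟨1, zero_le_one, (hst.node hs').2.2, ?_, fun h' => absurd hs' h'⟩
      rw [hσ, stageSize, if_pos hs']
      nlinarith
    · have hexp : Real.exp (-(a * u)) ≤ σ := by
        rw [hσ, stageSize, if_neg hs']
        refine Real.exp_le_exp.2 ?_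
        nlinarith
      refine ⟨_, (Real.exp_pos _).le, (hst.inner hs').2, ?_, fun _ => hexp⟩
      calc _ ≤ σ * H₀ := by gcongr
        _ ≤ _ := by nlinarith
  have hD0 : 0 ≤ D := by
    by_cases hs' : s
    · rw [(hst.node hs').1]
    · rw [(hst.inner hs').1]; positivity
  -- the damping `e^{-a u}` pays for the shifts of the times by `u`, four times `e^{(a/8) u}`, and
  -- leaves `e^{-(a/2) u}`
  have hDσ : D * Real.exp (4 * ε * u) ≤ σ := by
    by_cases hs' : s
    · rw [(hst.node hs').1, zero_mul]; exact hσ0.le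
    · rw [(hst.inner hs').1, ← Real.exp_add, hσ, stageSize, if_neg hs']
      refine Real.exp_le_exp.2 (le_of_eq ?_)
      rw [hεdef]; ring
  have hexp2 : ∀ U U' : ℝ, Real.exp (ε * (|U + u| + |U' - u|)) ≤
      Real.exp (ε * (|U| + |U'|)) * Real.exp (2 * ε * u) := by
    intro U U'
    rw [← Real.exp_add]
    refine Real.exp_le_exp.2 ?_
    have h5 := abs_add_le U u
    have h6 := abs_sub U' u
    rw [abs_of_nonneg hu] at h5 h6
    calc ε * (|U + u| + |U' - u|) ≤ ε * ((|U| + u) + (|U'| + u)) := by gcongr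
      _ = _ := by ring
  -- the node part, without the gain from nondiagonality
  have hnode : ∀ x n U x' n' U', ∑ v : ι × J, ‖pair (fun p p' =>
      e (u / 2 * (‖p‖ ^ 2 - ‖p'‖ ^ 2)) * N (h⁻¹ • (p - p')) * scatter f g (pos v.1) (R v.2) p p')
        x n U x' n' U'‖ ≤ C₃ * C₂ * cN * (τ * h) * M * Real.exp (ε * (|U| + |U'|)) := by
    intro x n U x' n' U'
    refine (h₃ Finset.univ (fun v : ι × J => scatter f g (pos v.1) (R v.2))
      (fun v => (hb.bdd _).scatter f g _) N hst.meas τ hτ hst.supp h hh x n x' n' U U' u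
      (C₂ * Fintype.card ι * M * Real.exp (ε * (|U| + |U'|))) fun w hw X => ?_).trans ?_
    · refine (hl.all _ _ _ _).trans ?_
      have h5 : Real.exp (ε * |U + U'|) ≤ Real.exp (ε * (|U| + |U'|)) := by
        gcongr
        exact abs_add_le _ _
      calc _ ≤ C₂ * Fintype.card ι * M * Real.exp (ε * (|U| + |U'|)) := by gcongr
        _ ≤ _ := le_mul_of_one_le_right (by positivity) (by linarith [norm_nonneg X])
    · calc _ = C₃ * C₂ * τ * (h ^ d * Fintype.card ι) * M * Real.exp (ε * (|U| + |U'|)) := by ring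
        _ ≤ C₃ * C₂ * τ * (cN * h) * M * Real.exp (ε * (|U| + |U'|)) := by gcongr
        _ = _ := by ring
  have hsc : ∀ v : ι × J, BddMeas (scatter f g (pos v.1) (R v.2)) := fun v =>
    (hb.bdd _).scatter f g _
  refine ⟨fun v => ?_, fun x n U x' n' U' => ?_, fun c x n U x' n' U' => ?_⟩
  · have h5 := bddMeas_node (hsc v) (N := fun w => D + N w) (hst.meas.const_add _) (τ := D + τ)
      (fun w => (norm_add_le _ _).trans (add_le_add (by simp [abs_of_nonneg hD0]) (hτ w))) h u
    exact h5
  · refine (Finset.sum_le_sum fun v _ =>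
      norm_pair_stage_le (hsc v) hst.meas hτ hD0 h u x n x' n' U U').trans ?_
    rw [Finset.sum_add_distrib, ← Finset.mul_sum]
    have h5 := hb'.all x n (U + u) x' n' (U' - u)
    have h6 := hnode x n U x' n' U'
    set E := Real.exp (ε * (|U| + |U'|)) with hE
    have h7 : D * ∑ v : ι × J, ‖pair (scatter f g (pos v.1) (R v.2)) x n (U + u) x' n' (U' - u)‖ ≤
        C₁ * M * σ * E := by
      calc _ ≤ D * (C₁ * M * (E * Real.exp (2 * ε * u))) := by
            gcongr
            exact h5.trans (by gcongr; exact hexp2 U U')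
        _ = C₁ * M * (D * Real.exp (2 * ε * u)) * E := by ring
        _ ≤ C₁ * M * σ * E := by
            gcongr
            refine le_trans ?_ hDσ
            gcongr
            norm_num
    have h8 : C₃ * C₂ * cN * (τ * h) * M * E ≤ C₃ * C₂ * cN * ((1 + H₀) * σ) * M * E := by gcongr
    have h9 : 0 ≤ C₁ * C₄ * M * σ * E := by positivity
    have h10 : 0 ≤ C₃ * C₂ * cN * (cκ + K) * M * σ * E := by positivity
    calc _ ≤ C₁ * M * σ * E + C₃ * C₂ * cN * ((1 + H₀) * σ) * M * E :=
          add_le_add h7 (h6.trans h8)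
      _ ≤ _ := by linarith
  · set V := deviation (pos c) x n U x' n' U' with hV
    have hV1 : 1 ≤ V := one_le_deviation _ _ _ _ _ _ _
    set E := Real.exp (ε * (|U| + |U'|)) with hE
    set T' := (if s then fun _ => nondiagNew T else nondiagExt T : ι → Finset (ι × J)) c with hT'
    refine (Finset.sum_le_sum fun v _ =>
      norm_pair_stage_le (hsc v) hst.meas hτ hD0 h u x n x' n' U U').trans ?_
    rw [Finset.sum_add_distrib, ← Finset.mul_sum]
    -- the constant part of the multiplier: the block goes on
    have h7 : D * ∑ v ∈ T', ‖pair (scatter f g (pos v.1) (R v.2)) x n (U + u) x' n' (U' - u)‖ ≤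
        C₁ * C₄ * M * σ * κ * V * E := by
      by_cases hs' : s
      · rw [(hst.node hs').1, zero_mul]
        positivity
      · rw [hT', if_neg hs']
        have h5 := hb'.nondiag c x n (U + u) x' n' (U' - u)
        have h6 : deviation (pos c) x n (U + u) x' n' (U' - u) ≤
            V * (C₄ * Real.exp (2 * ε * u)) := by
          have h8 := h₄ (2 * u) (by positivity)
          rw [pow_one] at h8
          have h9 : deviation (pos c) x n (U + u) x' n' (U' - u) ≤ V * (1 + 2 * u) := by
            have h10 := abs_add_le U u
            have h11 := abs_sub U' u
            rw [abs_of_nonneg hu] at h10 h11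
            have h12 : deviation (pos c) x n (U + u) x' n' (U' - u) ≤ V + 2 * u := by
              rw [hV, deviation, deviation]
              linarith
            nlinarith
          refine h9.trans ?_
          rw [show 2 * ε * u = ε * (2 * u) by ring]
          gcongr
        have hdev0 := one_le_deviation (pos c) x n (U + u) x' n' (U' - u)
        calc _ ≤ D * (C₁ * M * κ * (V * (C₄ * Real.exp (2 * ε * u))) *
              (E * Real.exp (2 * ε * u))) := by
              gcongr
              refine h5.trans ?_
              gcongr
              exact hexp2 U U'
          _ = C₁ * C₄ * M * (D * (Real.exp (2 * ε * u) * Real.exp (2 * ε * u))) * κ * V * E := by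
              ring
          _ = C₁ * C₄ * M * (D * Real.exp (4 * ε * u)) * κ * V * E := by
              rw [← Real.exp_add]; ring_nf
          _ ≤ _ := by gcongr
    -- the node part of the multiplier
    have h8 : ∑ v ∈ T', ‖pair (fun p p' => e (u / 2 * (‖p‖ ^ 2 - ‖p'‖ ^ 2)) *
        N (h⁻¹ • (p - p')) * scatter f g (pos v.1) (R v.2) p p') x n U x' n' U'‖ ≤
        C₃ * C₂ * cN * (cκ + K) * M * σ * κ * V * E := by
      by_cases hs' : s
      · rw [hT', if_pos hs']
        have hσh : σ = h := by rw [hσ, stageSize, if_pos hs']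
        refine (h₃ (nondiagNew T) (fun v : ι × J => scatter f g (pos v.1) (R v.2))
          hsc N hst.meas 1 (hst.node hs').2.2 hst.supp h hh x n x' n' U U' u
          (C₂ * Fintype.card ι * M * κ * (K * V) * E) fun w hw X => ?_).trans ?_
        · refine (hl.nondiag _ _ _ _).trans ?_
          have h5 : Real.exp (ε * |U + U'|) ≤ E := by
            rw [hE]
            gcongr
            exact abs_add_le _ _
          have h6 := lineWeight_le (pos c) x n x' n' X w (U := U) (U' := U') hh hhH hu
            (hst.node hs').2.1 hw
          have h7 := one_le_lineWeight (h • w) (x + x' + X + (U + u) • h • w) n' (U + U')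
          calc _ ≤ C₂ * Fintype.card ι * M * κ * (K * V * (1 + ‖X‖)) * E := by gcongr
            _ = _ := by ring
        · calc _ = C₃ * C₂ * (h ^ d * Fintype.card ι) * M * κ * (K * V) * E := by ring
            _ ≤ C₃ * C₂ * (cN * h) * M * κ * (K * V) * E := by gcongr
            _ = C₃ * C₂ * cN * K * M * σ * κ * V * E := by rw [hσh]; ring
            _ ≤ _ := by
                gcongr
                linarith
      · -- inside a block the node part gains `h ≤ cκ * κ`, whatever the scatterers are
        have h6 := hnode x n U x' n' U'
        have h5 := Finset.sum_le_sum_of_subset_of_nonneg (Finset.subset_univ T')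
          (f := fun v : ι × J => ‖pair (fun p p' => e (u / 2 * (‖p‖ ^ 2 - ‖p'‖ ^ 2)) *
            N (h⁻¹ • (p - p')) * scatter f g (pos v.1) (R v.2) p p') x n U x' n' U'‖)
          (fun _ _ _ => norm_nonneg _)
        refine h5.trans (h6.trans ?_)
        have hτσ := hτs hs'
        calc C₃ * C₂ * cN * (τ * h) * M * E ≤ C₃ * C₂ * cN * (σ * (cκ * κ)) * M * E := by gcongr
          _ = C₃ * C₂ * cN * cκ * M * σ * κ * E * 1 := by ring
          _ ≤ C₃ * C₂ * cN * (cκ + K) * M * σ * κ * E * V := by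
              gcongr
              linarith
          _ = _ := by ring
    have h9 : 0 ≤ C₁ * M * σ * κ * V * E := by positivity
    have h10 : 0 ≤ C₃ * C₂ * cN * (1 + H₀) * M * σ * κ * V * E := by positivity
    calc _ ≤ _ := add_le_add h7 h8
      _ ≤ _ := by linarith

/-! ### Chains of scatterings -/

/-- The amplitude of a chain of `m` stages, each followed by a scattering, and ending with the
amplitude `F`. -/
def chain (f : Space d → ℂ) (F : Space d → Space d → ℂ) : (m : ℕ) →
    (Fin m → Space d → Space d → ℂ) → (Fin m → ℝ) → (Fin m → Space d) → Space d → Space d → ℂ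
  | 0, _, _, _ => F
  | m + 1, E, g, q => fun p p' =>
      E 0 p p' * scatter f (g 0) (q 0) (chain f F m (Fin.tail E) (Fin.tail g) (Fin.tail q)) p p'

/-- The scatterer only changes at nodes, when `c` is the scatterer before the first stage. -/
def ChainDiagonal {ι : Type} {m : ℕ} (s : Fin m → Prop) (c : ι) (q : Fin m → ι) : Prop :=
  ∀ j, ¬ s j → q j = (Fin.cons c q : Fin (m + 1) → ι) j.castSucc

lemma chainDiagonal_cons {ι : Type} {m : ℕ} (s : Fin (m + 1) → Prop) (c i : ι)
    (q : Fin m → ι) : ChainDiagonal s c (Fin.cons i q : Fin (m + 1) → ι) ↔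
      (¬ s 0 → i = c) ∧ ChainDiagonal (Fin.tail s) i q := by
  rw [ChainDiagonal, Fin.forall_fin_succ]
  refine and_congr (by simp) (forall_congr' fun j => ?_)
  rw [Fin.castSucc_succ, Fin.cons_succ, Fin.cons_succ]
  rfl

lemma IsBound.comp_equiv {ι J J' : Type} [Fintype J] [Fintype J'] {ε M κ : ℝ} {pos : ι → Space d}
    {R : J → Space d → Space d → ℂ} {T : ι → Finset J} (h : IsBound ε M κ pos R T) (φ : J' ≃ J)
    {T' : ι → Finset J'} (hT : ∀ c j, j ∈ T' c ↔ φ j ∈ T c) :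
    IsBound ε M κ pos (fun j => R (φ j)) T' := by
  refine ⟨fun j => h.bdd _, fun x n U x' n' U' => ?_, fun c x n U x' n' U' => ?_⟩
  · rw [Equiv.sum_comp φ fun j => ‖pair (R j) x n U x' n' U'‖]
    exact h.all x n U x' n' U'
  · rw [Finset.sum_equiv φ (hT c) (g := fun j => ‖pair (R j) x n U x' n' U'‖) fun _ _ => rfl]
    exact h.nondiag c x n U x' n' U'

/-- An amplitude decaying in the momentum difference, measured in units of `h`. -/
lemma exists_norm_pair_le : ∃ C : ℝ, 0 ≤ C ∧ ∀ (F : Space d → Space d → ℂ), BddMeas F →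
    ∀ A h : ℝ, 0 ≤ A → 0 < h → (∀ p p', ‖F p p'‖ ≤ A * decay (d + 1) (h⁻¹ • (p - p'))) →
    ∀ x n U x' n' U', ‖pair F x n U x' n' U'‖ ≤ C * A * h ^ d := by
  obtain ⟨K, hK, hb⟩ := exists_bump_le (d := d)
  have hi := integrable_decay_space (Nat.lt_succ_self d)
  set I : ℝ := ∫ y : Space d, decay (d + 1) y with hI
  have hI0 : 0 ≤ I := integral_nonneg fun y => (decay_pos _ y).le
  refine ⟨K * I, by positivity, fun F hF A h hA hh hdec x n U x' n' U' => ?_⟩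
  have h1 := integral_integral_eq_smul (F := fun p p' => packet x n U p * packet x' n' U' p' *
    F p p') (integrable_pair hF x n U x' n' U') hh
  rw [pair, h1, norm_mul, Complex.norm_real, Real.norm_of_nonneg (by positivity)]
  have h2 : ∀ w : Space d, ‖∫ p', packet x n U (p' + h • w) * packet x' n' U' p' *
      F (p' + h • w) p'‖ ≤ K * A * decay (d + 1) w := by
    intro w
    rw [show K * A * decay (d + 1) w = ∫ p', K * A * decay (d + 1) w * bump d (p' - n') by
      rw [integral_const_mul, integral_bump_sub, mul_one]]
    refine norm_integral_le_of_norm_le ((integrable_bump_sub n').const_mul _)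
      (Filter.Eventually.of_forall fun p' => ?_)
    have h3 := hdec (p' + h • w) p'
    rw [add_sub_cancel_left, inv_smul_smul₀ hh.ne'] at h3
    rw [norm_mul, norm_mul, norm_packet, norm_packet]
    calc _ ≤ K * bump d (p' - n') * (A * decay (d + 1) w) := by
          gcongr
          · exact mul_nonneg hK (bump_nonneg _)
          · exact bump_nonneg _
          · exact hb _
      _ = _ := by ring
  have h4 : ‖∫ w : Space d, ∫ p', packet x n U (p' + h • w) * packet x' n' U' p' *
      F (p' + h • w) p'‖ ≤ ∫ w, K * A * decay (d + 1) w :=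
    norm_integral_le_of_norm_le (hi.const_mul _) (Filter.Eventually.of_forall h2)
  rw [integral_const_mul] at h4
  calc _ ≤ h ^ d * (K * A * I) := by gcongr
    _ = _ := by ring

open Classical in
/-- The sum of the amplitudes of all chains, and the gain `κ` for the nondiagonal ones. -/
lemma exists_bound_chain (f : 𝓢(Space d, ℂ)) {a ρ t H₀ cS cN cκ : ℝ} (ha : 0 < a) (hρ : 0 ≤ ρ)
    (ht : 0 ≤ t) (hH₀ : 0 ≤ H₀) (hcN : 0 ≤ cN) (hcκ : 0 ≤ cκ) :
    ∃ C : ℝ, 1 ≤ C ∧ ∀ {ι : Type} [Fintype ι] (κ h A : ℝ) (pos : ι → Space d)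
      (F : Space d → Space d → ℂ), 0 ≤ κ → 0 ≤ A → Scatterers cS κ pos →
      0 < h → h ≤ H₀ → h ^ d * Fintype.card ι ≤ cN * h → h ≤ cκ * κ →
      BddMeas F → (∀ p p', ‖F p p'‖ ≤ A * decay (d + 1) (h⁻¹ • (p - p'))) →
      ∀ (m : ℕ) (g : Fin m → ℝ), (∀ j, g j = 0 ∨ g j = 1) →
      ∀ (s : Fin m → Prop) (u D : Fin m → ℝ) (N : Fin m → Space d → ℂ),
      (∀ j, IsStage a ρ t h (s j) (u j) (D j) (N j)) →
      IsBound (a / 8) (C ^ (m + 1) * A * h ^ d * ∏ j, stageSize a h (s j) (u j)) κ pos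
        (fun q : Fin m → ι => chain f F m (fun j => stageFactor h (u j) (D j) (N j)) g
          fun j => pos (q j))
        (fun c => Finset.univ.filter fun q => ¬ ChainDiagonal s c q) := by
  obtain ⟨C₁, hC₁, h₁⟩ := exists_bound_stage f (cS := cS) ha hρ ht hH₀ hcN hcκ
  obtain ⟨C₂, hC₂, h₂⟩ := exists_norm_pair_le (d := d)
  refine ⟨1 + C₁ + C₂, by linarith, ?_⟩
  intro ι _ κ h A pos F hκ hA hs hh hhH hcard hhκ hF hdec m
  set C := 1 + C₁ + C₂ with hC
  have hC0 : 0 ≤ C := by positivity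
  induction m with
  | zero =>
    intro g _ s u D N _
    refine ⟨fun q => hF, fun x n U x' n' U' => ?_, fun c x n U x' n' U' => ?_⟩
    · have hexp : 1 ≤ Real.exp (a / 8 * (|U| + |U'|)) := Real.one_le_exp (by positivity)
      have h3 := h₂ F hF A h hA hh hdec x n U x' n' U'
      rw [Fintype.sum_unique]
      simp only [Finset.univ_eq_empty, Finset.prod_empty, mul_one, zero_add, pow_one]
      refine h3.trans ((?_ : C₂ * A * h ^ d ≤ C * A * h ^ d).trans
        (le_mul_of_one_le_right (by positivity) hexp))
      gcongr
      linarith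
    · rw [Finset.sum_eq_zero]
      · have := one_le_deviation (pos c) x n U x' n' U'
        simp only [Finset.univ_eq_empty, Finset.prod_empty]
        positivity
      · intro q hq
        exact absurd (fun j => j.elim0) (Finset.mem_filter.1 hq).2
  | succ m ih =>
    intro g hg s u D N hst
    have hprod : 0 ≤ ∏ j, stageSize a h (Fin.tail s j) (Fin.tail u j) :=
      Finset.prod_nonneg fun j _ => (stageSize_pos hh _ _).le
    have hb := ih (Fin.tail g) (fun j => hg _) (Fin.tail s) (Fin.tail u) (Fin.tail D)
      (Fin.tail N) fun j => hst _
    have hb1 := h₁ κ _ h pos _ _ hκ (by positivity) hs hh hhH hcard hhκ hb (g 0) (hg 0) (s 0)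
      (u 0) (D 0) (N 0) (hst 0)
    have hb2 := hb1.comp_equiv (Fin.consEquiv fun _ => ι).symm
      (T' := fun c => Finset.univ.filter fun q : Fin (m + 1) → ι => ¬ ChainDiagonal s c q) ?_
    · have hσ := (stageSize_pos (a := a) hh (s 0) (u 0)).le
      have hle : C₁ * (C ^ (m + 1) * A * h ^ d *
          ∏ j, stageSize a h (Fin.tail s j) (Fin.tail u j)) * stageSize a h (s 0) (u 0) ≤
          C ^ (m + 1 + 1) * A * h ^ d * ∏ j, stageSize a h (s j) (u j) := by
        rw [Fin.prod_univ_succ, pow_succ C (m + 1)]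
        calc _ ≤ C * (C ^ (m + 1) * A * h ^ d *
              ∏ j, stageSize a h (Fin.tail s j) (Fin.tail u j)) * stageSize a h (s 0) (u 0) := by
              gcongr
              linarith
          _ = _ := by
              simp only [Fin.tail]
              ring
      refine ⟨fun q => hb2.bdd q, fun x n U x' n' U' => (hb2.all x n U x' n' U').trans ?_,
        fun c x n U x' n' U' => (hb2.nondiag c x n U x' n' U').trans ?_⟩
      · gcongr
      · have := one_le_deviation (pos c) x n U x' n' U'
        gcongr
    · intro c q
      obtain ⟨⟨i, q⟩, rfl⟩ := (Fin.consEquiv fun _ => ι).surjective q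
      rw [Equiv.symm_apply_apply]
      simp only [Fin.consEquiv, Equiv.coe_fn_mk, Finset.mem_filter, Finset.mem_univ, true_and,
        chainDiagonal_cons]
      split_ifs with h0
      · simp [nondiagNew, h0]
      · simp only [nondiagExt, h0, Finset.mem_filter, Finset.mem_univ, true_and,
          not_false_eq_true, forall_true_left, not_and]
        refine forall_congr' fun hi => ?_
        rw [hi]

/-! ### The initial and final observables -/

lemma tilde_eq_fourier (a : 𝓢(Space d × Space d, ℂ)) (ξ y : Space d) :
    tilde a ξ y = 𝓕 (fun x => a (x, y)) ξ := by
  rw [tilde, Real.fourier_eq]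
  congr 1
  ext z
  rw [Circle.smul_def, smul_eq_mul, mul_comm, e_eq_fourierChar]

lemma exists_norm_tilde_le (a : 𝓢(Space d × Space d, ℂ)) (M N : ℕ) :
    ∃ C : ℝ, 0 ≤ C ∧ ∀ ξ y, ‖tilde a ξ y‖ ≤ C * (decay M ξ * decay N y) := by
  obtain ⟨C, hC, h⟩ := fourier_decay (d := d) M
  obtain ⟨D, hD, h'⟩ := SchwartzMap.exists_decay a (d + 1 + N) M
  refine ⟨C * D, by positivity, fun ξ y => ?_⟩
  have hs : ContDiff ℝ ∞ fun v : Space d × Space d => a (v + (0, y)) :=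
    (a.smooth ⊤).comp (contDiff_id.add contDiff_const)
  have hf : (fun x : Space d => a (x, y)) =
      fun x => a (ContinuousLinearMap.inl ℝ (Space d) (Space d) x + (0, y)) := by
    ext x
    simp
  rw [tilde_eq_fourier]
  have := h (fun x => a (x, y)) (D * decay N y) ?_ ?_ ξ
  · calc _ ≤ _ := this
      _ = _ := by ring
  · rw [hf]
    exact hs.comp (ContinuousLinearMap.contDiff _)
  · intro l hl x
    rw [hf]
    refine (norm_iteratedFDeriv_comp_clm_le (ContinuousLinearMap.inl ℝ (Space d) (Space d))
      ?_ hs l x).trans ?_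
    · exact ContinuousLinearMap.norm_inl_le_one _ _ _
    · rw [iteratedFDeriv_comp_add_right]
      have h1 : ‖x‖ ≤ ‖(x, y)‖ := by simp [Prod.norm_def]
      have h2 : ‖y‖ ≤ ‖(x, y)‖ := by simp [Prod.norm_def]
      have h3 : decay (d + 1) (x, y) ≤ decay (d + 1) x := by
        unfold decay
        have := norm_nonneg x
        gcongr
      have h4 : decay N (x, y) ≤ decay N y := by
        unfold decay
        have := norm_nonneg y
        gcongr
      have h5 := (decay_pos (d + 1) x).le
      have h6 := (decay_pos N (x, y)).le
      have h7 := h' l hl (x, y)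
      rw [decay_add] at h7
      simp only [ContinuousLinearMap.inl_apply, Prod.mk_add_mk, add_zero, zero_add]
      calc _ ≤ _ := h7
        _ ≤ D * (decay (d + 1) x * decay N y) := by gcongr
        _ = _ := by ring

lemma continuous_tilde (a : 𝓢(Space d × Space d, ℂ)) :
    Continuous fun v : Space d × Space d => tilde a v.1 v.2 := by
  obtain ⟨C, hC, h⟩ := SchwartzMap.exists_decay a (d + 1) 0
  unfold tilde
  have := continuous_e
  have := a.continuous
  refine continuous_of_dominated (bound := fun x => C * decay (d + 1) x) (fun θ => ?_)
    (fun θ => ?_) ((integrable_decay_space (Nat.lt_succ_self d)).const_mul C) ?_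
  · exact Continuous.aestronglyMeasurable (by fun_prop)
  · refine Filter.Eventually.of_forall fun x => ?_
    rw [norm_mul, norm_e, mul_one]
    have h2 := h 0 le_rfl (x, θ.2)
    rw [norm_iteratedFDeriv_zero] at h2
    refine h2.trans (mul_le_mul_of_nonneg_left ?_ hC)
    have h1 : ‖x‖ ≤ ‖(x, θ.2)‖ := by simp [Prod.norm_def]
    unfold decay
    have := norm_nonneg x
    gcongr
  · exact Filter.Eventually.of_forall fun x => by fun_prop

lemma exists_window_tilde_le (b : 𝓢(Space d × Space d, ℂ)) (N : ℕ) :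
    ∃ C : ℝ, 0 ≤ C ∧ ∀ η n x,
      ‖window (tilde b η) n x‖ ≤ C * decay N η * (decay N n * decay N x) := by
  have : (volume : Measure (Space d × Space d)).IsAddHaarMeasure := by
    rw [Measure.volume_eq_prod]; infer_instance
  obtain ⟨C, hC, h⟩ := fourier_decay_prod (d := d) N
  obtain ⟨D, hD, h'⟩ := exists_decay_mul_translate b (plateauS d)
    (ContinuousLinearMap.snd ℝ (Space d) (Space d)) (ContinuousLinearMap.norm_snd_le _ _ _)
    (2 * N) (d + d + 1) N
  refine ⟨C * D, by positivity, fun η n x => ?_⟩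
  have hs : ContDiff ℝ ∞ fun v : Space d × Space d =>
      b v * plateauS d (ContinuousLinearMap.snd ℝ (Space d) (Space d) v - n) :=
    (b.smooth ⊤).mul (((plateauS d).smooth ⊤).comp
      ((ContinuousLinearMap.contDiff _).sub contDiff_const))
  have h1 := h _ (D * decay N n) hs (fun l hl v => h' n l hl v) (η, -x)
  rw [show decay N ((η, -x) : Space d × Space d).2 = decay N x by simp [decay]] at h1
  have h2 : window (tilde b η) n x = VectorFourier.fourierIntegral Real.fourierChar volume
      (prodInner d).toLinearMap₁₂ (fun v : Space d × Space d =>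
        b v * plateauS d (ContinuousLinearMap.snd ℝ (Space d) (Space d) v - n)) (η, -x) := by
    have h3 : ∀ v : Space d × Space d, Real.fourierChar
        (-(prodInner d).toLinearMap₁₂ v (η, -x)) • (b v * plateauS d
          (ContinuousLinearMap.snd ℝ (Space d) (Space d) v - n)) =
        b v * e (-⟪v.1, η⟫) * plateau d (v.2 - n) * e ⟪x, v.2⟫ := by
      intro v
      have h4 : (prodInner d).toLinearMap₁₂ v (η, -x) = ⟪v.1, η⟫ - ⟪x, v.2⟫ := by
        change prodInner d v (η, -x) = _
        rw [prodInner_apply, inner_neg_right, real_inner_comm x, sub_eq_add_neg]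
      rw [h4, Circle.smul_def, smul_eq_mul, ← e_eq_fourierChar, neg_sub, sub_eq_add_neg,
        add_comm, e_add]
      simp only [plateauS_apply, ContinuousLinearMap.coe_snd']
      ring
    have := continuous_e
    have := b.continuous
    have hp : Continuous (plateau d) := contDiff_plateau.continuous
    have hi : Integrable fun v : Space d × Space d =>
        b v * e (-⟪v.1, η⟫) * plateau d (v.2 - n) * e ⟪x, v.2⟫ := by
      refine ((integrable_decay (volume : Measure (Space d × Space d)) (N := d + d + 1)
        (by simp [Module.finrank_prod])).const_mul (D * decay N n)).mono'
        (Continuous.aestronglyMeasurable (by fun_prop)) (Filter.Eventually.of_forall fun v => ?_)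
      have h5 := h' n 0 (Nat.zero_le _) v
      simp only [norm_iteratedFDeriv_zero, plateauS_apply, ContinuousLinearMap.coe_snd'] at h5
      rw [norm_mul, norm_mul, norm_mul, norm_e, norm_e, mul_one, mul_one, ← norm_mul]
      exact h5
    rw [VectorFourier.fourierIntegral]
    simp_rw [h3]
    rw [Measure.volume_eq_prod, integral_prod_symm _ hi, window]
    refine integral_congr_ae (Filter.Eventually.of_forall fun z => ?_)
    simp only [tilde]
    rw [integral_mul_const, integral_mul_const]
  rw [h2]
  calc _ ≤ _ := h1
    _ = _ := by ring

lemma eq_integral_window {g : Space d → ℂ} (hg : Continuous g) {A B : ℝ}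
    (hA : ∀ z, ‖g z‖ ≤ A * decay (d + 1) z)
    (hB : ∀ n x, ‖window g n x‖ ≤ B * (decay (d + 1) n * decay (d + 1) x)) (Y : Space d) :
    g Y = ∫ θ : Space d × Space d,
      window g θ.1 θ.2 * e (-⟪θ.2, Y⟫) * bump d (Y - θ.1) := by
  have hi := integrable_decay_space (Nat.lt_succ_self d)
  have hwc := continuous_window hg hA
  have := continuous_e
  obtain ⟨K, hK, hK'⟩ := exists_bump_le (d := d)
  have hint : Integrable fun θ : Space d × Space d =>
      window g θ.1 θ.2 * e (-⟪θ.2, Y⟫) * bump d (Y - θ.1) := by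
    refine (((hi.mul_prod hi).const_mul B).mul_const K).mono'
      (Continuous.aestronglyMeasurable (by fun_prop)) (Filter.Eventually.of_forall fun θ => ?_)
    rw [norm_mul, norm_mul, norm_e, mul_one, Complex.norm_real,
      Real.norm_of_nonneg (bump_nonneg _)]
    exact mul_le_mul (hB _ _) (hK' _) (bump_nonneg _) ((norm_nonneg _).trans (hB θ.1 θ.2))
  rw [Measure.volume_eq_prod, integral_prod _ hint]
  have h1 : ∀ n : Space d, ∫ x, window g n x * e (-⟪x, Y⟫) * bump d (Y - n) =
      g Y * bump d (Y - n) := by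
    intro n
    rw [integral_mul_const, integral_window hg n Y (C := B * decay (d + 1) n)
      fun x => (hB n x).trans_eq (by ring)]
    by_cases h : 1 ≤ ‖Y - n‖
    · simp [bump_eq_zero h]
    · rw [plateau_eq_one (by linarith), Complex.ofReal_one, mul_one]
  simp_rw [h1]
  rw [integral_const_mul, integral_complex_ofReal, integral_bump_sub', Complex.ofReal_one, mul_one]

lemma BddMeas.measurable_add {R : Space d → Space d → ℂ} (hR : BddMeas R) (H : Space d) :
    Measurable fun y => R (y + H) y :=
  hR.meas.comp (f := fun y : Space d => (y + H, y)) (by fun_prop)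

/-- The expansion of an initial amplitude in packets. -/
lemma integral_mul_eq_integral_window_linePair {g : Space d → ℂ} (hg : Continuous g) {A B : ℝ}
    (hA : ∀ z, ‖g z‖ ≤ A * decay (d + 1) z)
    (hB : ∀ n x, ‖window g n x‖ ≤ B * (decay (d + 1) n * decay (d + 1) x))
    {R : Space d → Space d → ℂ} (hR : BddMeas R) (c X H : Space d) :
    ∫ y, g (y + c) * (e ⟪X, y⟫ * R (y + H) y) = ∫ θ : Space d × Space d,
      window g θ.1 θ.2 * e (-⟪θ.2, c⟫) * linePair R H (X - θ.2) (θ.1 - c) 0 := by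
  obtain ⟨K, hK⟩ := hR.bdd
  have hK0 : 0 ≤ K := (norm_nonneg _).trans (hK 0 0)
  have hi := integrable_decay_space (Nat.lt_succ_self d)
  have hwc := continuous_window hg hA
  have := continuous_e
  set G : Space d × (Space d × Space d) → ℂ := fun v =>
    window g v.2.1 v.2.2 * e (-⟪v.2.2, c⟫) *
      (packet (X - v.2.2) (v.2.1 - c) 0 v.1 * R (v.1 + H) v.1) with hG
  have hGn : ∀ v, ‖G v‖ ≤ B * K * ((decay (d + 1) v.2.1 * decay (d + 1) v.2.2) *
      bump d (v.1 - (v.2.1 - c))) := by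
    intro v
    simp only [hG, norm_mul, norm_e, norm_packet, mul_one]
    have h1 := hB v.2.1 v.2.2
    have h2 := bump_nonneg (v.1 - (v.2.1 - c))
    have h3 := hK (v.1 + H) v.1
    calc _ ≤ B * (decay (d + 1) v.2.1 * decay (d + 1) v.2.2) *
          (bump d (v.1 - (v.2.1 - c)) * K) := by
            gcongr
            exact (norm_nonneg _).trans h1
      _ = _ := by ring
  have hcont : Continuous fun v : Space d × (Space d × Space d) => window g v.2.1 v.2.2 :=
    hwc.comp continuous_snd
  have hGm : AEStronglyMeasurable G := by
    have h1 : Measurable fun v : Space d × (Space d × Space d) => R (v.1 + H) v.1 :=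
      (hR.measurable_add H).comp measurable_fst
    refine AEStronglyMeasurable.mul ?_ (AEStronglyMeasurable.mul ?_ h1.aestronglyMeasurable)
    · exact Continuous.aestronglyMeasurable (hcont.mul (by fun_prop))
    · unfold packet
      exact Continuous.aestronglyMeasurable (by fun_prop)
  have hdom : Integrable (fun v : Space d × (Space d × Space d) =>
      (decay (d + 1) v.2.1 * decay (d + 1) v.2.2) * bump d (v.1 - (v.2.1 - c))) := by
    refine (integrable_prod_iff' ?_).2 ⟨Filter.Eventually.of_forall fun θ => ?_, ?_⟩
    · have hc := continuous_decay (V := Space d) (d + 1)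
      exact Continuous.aestronglyMeasurable (by fun_prop)
    · exact (integrable_bump_sub (θ.1 - c)).const_mul
        (decay (d + 1) θ.1 * decay (d + 1) θ.2)
    · have : ∀ θ : Space d × Space d, ∫ y : Space d,
          ‖(decay (d + 1) θ.1 * decay (d + 1) θ.2) * bump d (y - (θ.1 - c))‖ =
          decay (d + 1) θ.1 * decay (d + 1) θ.2 := by
        intro θ
        simp_rw [norm_mul, Real.norm_of_nonneg (bump_nonneg _),
          Real.norm_of_nonneg (decay_pos _ _).le]
        rw [integral_const_mul, integral_bump_sub, mul_one]
      simp only [this]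
      exact hi.mul_prod hi
  have hGi : Integrable G := (hdom.const_mul (B * K)).mono' hGm (Filter.Eventually.of_forall hGn)
  have hy : ∀ y : Space d, ∫ θ, G (y, θ) = g (y + c) * (e ⟪X, y⟫ * R (y + H) y) := by
    intro y
    rw [eq_integral_window hg hA hB (y + c), ← integral_mul_const]
    congr 1
    ext θ
    have h1 : e (-⟪θ.2, c⟫) * e ⟪X - θ.2, y⟫ = e (-⟪θ.2, y + c⟫) * e ⟪X, y⟫ := by
      rw [← e_add, ← e_add, inner_add_right, inner_sub_left]
      congr 1
      ring
    simp only [hG, packet, zero_div, zero_mul, e_zero, mul_one,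
      show y - (θ.1 - c) = y + c - θ.1 by abel]
    linear_combination (window g θ.1 θ.2 * bump d (y + c - θ.1) * R (y + H) y) * h1
  simp_rw [← hy]
  rw [integral_integral_swap (f := fun y θ => G (y, θ)) hGi]
  refine integral_congr_ae (Filter.Eventually.of_forall fun θ => ?_)
  simp only [hG, linePair]
  rw [integral_const_mul]

/-! ### Chains paired with the initial observable -/

/-- The pairing of an amplitude with the Wigner transform of the initial observable; `h` is the
unit of the momentum difference. -/
def startPair (b : 𝓢(Space d × Space d, ℂ)) (h : ℝ) (R : Space d → Space d → ℂ) : ℂ :=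
  ∫ v : Space d × Space d,
    tilde b v.1 (v.2 + ((1 / 2 : ℝ) * h) • v.1) * R (v.2 + h • v.1) v.2

lemma BddMeas.measurable_shear {R : Space d → Space d → ℂ} (hR : BddMeas R) (h : ℝ) :
    Measurable fun v : Space d × Space d => R (v.2 + h • v.1) v.2 :=
  hR.meas.comp (f := fun v : Space d × Space d => (v.2 + h • v.1, v.2)) (by fun_prop)

lemma integrable_startPair (b : 𝓢(Space d × Space d, ℂ)) (h : ℝ) {R : Space d → Space d → ℂ}
    (hR : BddMeas R) : Integrable fun v : Space d × Space d =>
      tilde b v.1 (v.2 + ((1 / 2 : ℝ) * h) • v.1) * R (v.2 + h • v.1) v.2 := by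
  obtain ⟨K, hK⟩ := hR.bdd
  have hi := integrable_decay_space (Nat.lt_succ_self d)
  obtain ⟨C, hC, hb⟩ := exists_norm_tilde_le b (d + 1) (d + 1)
  have hdom : Integrable fun v : Space d × Space d =>
      decay (d + 1) v.1 * decay (d + 1) (v.2 + ((1 / 2 : ℝ) * h) • v.1) := by
    have hc := continuous_decay (V := Space d) (d + 1)
    refine (integrable_prod_iff ?_).2 ⟨Filter.Eventually.of_forall fun η => ?_, ?_⟩
    · exact Continuous.aestronglyMeasurable (by fun_prop)
    · exact (hi.comp_add_right (((1 / 2 : ℝ) * h) • η)).const_mul (decay (d + 1) η)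
    · have : ∀ η : Space d, ∫ y : Space d,
          ‖decay (d + 1) η * decay (d + 1) (y + ((1 / 2 : ℝ) * h) • η)‖ =
          decay (d + 1) η * ∫ y : Space d, decay (d + 1) y := by
        intro η
        simp_rw [norm_mul, Real.norm_of_nonneg (decay_pos _ _).le]
        rw [integral_const_mul,
          integral_add_right_eq_self (decay (d + 1)) (((1 / 2 : ℝ) * h) • η)]
      simp only [this]
      exact hi.mul_const _
  refine (hdom.const_mul (C * K)).mono' ?_ (Filter.Eventually.of_forall fun v => ?_)
  · have := continuous_tilde b
    refine AEStronglyMeasurable.mul ?_ (hR.measurable_shear h).aestronglyMeasurable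
    exact (this.comp (f := fun v : Space d × Space d => (v.1, v.2 + ((1 / 2 : ℝ) * h) • v.1))
      (by fun_prop)).aestronglyMeasurable
  · rw [norm_mul]
    calc _ ≤ C * (decay (d + 1) v.1 * decay (d + 1) (v.2 + ((1 / 2 : ℝ) * h) • v.1)) * K :=
          mul_le_mul (hb _ _) (hK _ _) (norm_nonneg _) ((norm_nonneg _).trans (hb _ _))
      _ = _ := by ring

lemma lineWeight_start_le {h u t H₀ : ℝ} (hh : 0 < h) (hH : h ≤ H₀) (hu : 0 ≤ u) (ht : h * u ≤ t)
    (η n x : Space d) :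
    lineWeight (h • η) ((u * h) • η - x) (n - ((1 / 2 : ℝ) * h) • η) 0 ≤
      (1 + t + 2 * H₀) * ((1 + ‖η‖) * ((1 + ‖n‖) * (1 + ‖x‖))) := by
  have h1 : ‖h • η‖ ≤ H₀ * ‖η‖ := by
    rw [norm_smul, Real.norm_of_nonneg hh.le]
    gcongr
  have h2 : ‖(u * h) • η‖ ≤ t * ‖η‖ := by
    rw [norm_smul, Real.norm_of_nonneg (by positivity), mul_comm u]
    gcongr
  have h3 : ‖((1 / 2 : ℝ) * h) • η‖ ≤ H₀ * ‖η‖ := by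
    rw [norm_smul, Real.norm_of_nonneg (by positivity)]
    gcongr
    linarith
  have h4 := norm_sub_le ((u * h) • η) x
  have h5 := norm_sub_le n (((1 / 2 : ℝ) * h) • η)
  have h6 := norm_nonneg η
  have h7 := norm_nonneg n
  have h8 := norm_nonneg x
  have ht0 : 0 ≤ t := le_trans (by positivity) ht
  have hH0 : 0 ≤ H₀ := hh.le.trans hH
  rw [lineWeight, abs_zero, zero_mul, add_zero]
  have h9 : 1 + ‖η‖ + ‖n‖ + ‖x‖ ≤ (1 + ‖η‖) * ((1 + ‖n‖) * (1 + ‖x‖)) := by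
    have : 0 ≤ ‖n‖ * ‖x‖ := by positivity
    have : 0 ≤ ‖η‖ * ((‖n‖ + ‖x‖) + ‖n‖ * ‖x‖) := by positivity
    linarith
  calc _ ≤ (1 + t + 2 * H₀) * (1 + ‖η‖ + ‖n‖ + ‖x‖) := by
        have : 0 ≤ (t + 2 * H₀) * (1 + ‖n‖ + ‖x‖) := by positivity
        linarith
    _ ≤ _ := by gcongr

/-- The first stage of a nondiagonal chain. The momentum difference is integrated against the initial
observable, as at a node, so the sum over the first scatterer costs their number. -/
lemma exists_sum_startPair_le (f : 𝓢(Space d, ℂ)) (b : 𝓢(Space d × Space d, ℂ)) {ε t H₀ : ℝ}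
    (ht : 0 ≤ t) (hH₀ : 0 ≤ H₀) :
    ∃ C : ℝ, 0 ≤ C ∧ ∀ {ι J : Type} [Fintype ι] [Fintype J] (κ M h : ℝ) (pos : ι → Space d)
      (R : J → Space d → Space d → ℂ) (T : ι → Finset J), 0 ≤ κ → 0 ≤ M → 0 < h → h ≤ H₀ →
      IsBound ε M κ pos R T → ∀ g : ℝ, g = 0 ∨ g = 1 →
      ∀ (u : ℝ) (N : Space d → ℂ), 0 ≤ u → h * u ≤ t → Measurable N → (∀ w, ‖N w‖ ≤ 1) →
      ∑ v ∈ nondiagNew T, ‖startPair b h fun p p' =>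
        stageFactor h u 0 N p p' * scatter f g (pos v.1) (R v.2) p p'‖ ≤
        C * Fintype.card ι * M * κ := by
  obtain ⟨C₁, hC₁, h₁⟩ := exists_lineBound_scatter f (ε := ε)
  obtain ⟨C₂, hC₂, h₂⟩ := exists_window_tilde_le b (d + 2)
  obtain ⟨C₃, hC₃, h₃⟩ := exists_norm_tilde_le b 0 (d + 1)
  have hi := integrable_decay_space (Nat.lt_succ_self d)
  set I : ℝ := ∫ y : Space d, decay (d + 1) y with hI
  have hI0 : 0 ≤ I := integral_nonneg fun y => (decay_pos _ y).le
  refine ⟨C₂ * C₁ * (1 + t + 2 * H₀) * (I * (I * I)), by positivity, ?_⟩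
  intro ι J _ _ κ M h pos R T hκ hM hh hhH hb g hg u N hu hut hN hN1
  have hl := h₁ κ M pos R T hκ hM hb g hg
  have hsc : ∀ v : ι × J, BddMeas (scatter f g (pos v.1) (R v.2)) :=
    fun v => (hb.bdd _).scatter f g _
  have hst : ∀ v : ι × J, BddMeas fun p p' =>
      stageFactor h u 0 N p p' * scatter f g (pos v.1) (R v.2) p p' := by
    intro v
    simp only [stageFactor, Complex.ofReal_zero, zero_add]
    exact bddMeas_node (hsc v) hN hN1 h u
  set B : ℝ := C₁ * Fintype.card ι * M * κ * (1 + t + 2 * H₀) with hB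
  have hB0 : 0 ≤ B := by positivity
  -- the integral over the momenta, at a fixed momentum difference
  have hη : ∀ η : Space d, ∑ v ∈ nondiagNew T, ‖∫ y,
      tilde b η (y + ((1 / 2 : ℝ) * h) • η) * (stageFactor h u 0 N (y + h • η) y *
        scatter f g (pos v.1) (R v.2) (y + h • η) y)‖ ≤
      C₂ * B * (I * I) * decay (d + 1) η := by
    intro η
    have hg0 : Continuous (tilde b η) :=
      (continuous_tilde b).comp (f := fun y => (η, y)) (by fun_prop)
    have hA : ∀ z, ‖tilde b η z‖ ≤ C₃ * decay 0 η * decay (d + 1) z :=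
      fun z => (h₃ η z).trans_eq (by ring)
    have hW : ∀ n x, ‖window (tilde b η) n x‖ ≤
        C₂ * decay (d + 2) η * (decay (d + 1) n * decay (d + 1) x) := by
      intro n x
      have h4 := (decay_pos (d + 2) η).le
      have h5 := (decay_pos (d + 1) n).le
      have h6 := (decay_pos (d + 2) x).le
      refine (h₂ η n x).trans ?_
      gcongr
      · exact decay_anti (Nat.le_succ _) _
      · exact decay_anti (Nat.le_succ _) _
    have hrw : ∀ v : ι × J, ∫ y, tilde b η (y + ((1 / 2 : ℝ) * h) • η) *
        (stageFactor h u 0 N (y + h • η) y * scatter f g (pos v.1) (R v.2) (y + h • η) y) =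
        e (u / 2 * ‖h • η‖ ^ 2) * N η * ∫ θ : Space d × Space d, window (tilde b η) θ.1 θ.2 *
          e (-⟪θ.2, ((1 / 2 : ℝ) * h) • η⟫) * linePair (scatter f g (pos v.1) (R v.2)) (h • η)
            ((u * h) • η - θ.2) (θ.1 - ((1 / 2 : ℝ) * h) • η) 0 := by
      intro v
      rw [← integral_mul_eq_integral_window_linePair hg0 hA hW (hsc v), ← integral_const_mul]
      congr 1
      ext y
      have h4 : u / 2 * (‖y + h • η‖ ^ 2 - ‖y‖ ^ 2) = u / 2 * ‖h • η‖ ^ 2 + ⟪(u * h) • η, y⟫ := by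
        rw [norm_add_sq_real, real_inner_comm, inner_smul_left, inner_smul_left]
        simp only [conj_trivial]
        ring
      rw [stageFactor, h4, e_add, add_sub_cancel_left, inv_smul_smul₀ hh.ne', Complex.ofReal_zero]
      ring
    simp_rw [hrw, norm_mul, norm_e, one_mul, ← Finset.mul_sum]
    refine (mul_le_of_le_one_left (Finset.sum_nonneg fun _ _ => norm_nonneg _) (hN1 η)).trans ?_
    have hint : Integrable fun θ : Space d × Space d =>
        C₂ * B * decay (d + 1) η * (decay (d + 1) θ.1 * decay (d + 1) θ.2) :=
      (hi.mul_prod hi).const_mul _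
    refine (sum_norm_integral_le _ hint fun θ => ?_).trans_eq ?_
    · simp_rw [norm_mul, norm_e, mul_one, ← Finset.mul_sum]
      have h4 := hl.nondiag (h • η) ((u * h) • η - θ.2) (θ.1 - ((1 / 2 : ℝ) * h) • η) 0
      rw [abs_zero, mul_zero, Real.exp_zero, mul_one] at h4
      have h5 := lineWeight_start_le hh hhH hu hut η θ.1 θ.2
      have h6 := (one_le_lineWeight (h • η) ((u * h) • η - θ.2)
        (θ.1 - ((1 / 2 : ℝ) * h) • η) 0).trans h5
      calc _ ≤ (C₂ * decay (d + 2) η * (decay (d + 2) θ.1 * decay (d + 2) θ.2)) *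
            (C₁ * Fintype.card ι * M * κ * ((1 + t + 2 * H₀) *
              ((1 + ‖η‖) * ((1 + ‖θ.1‖) * (1 + ‖θ.2‖))))) := by
            refine mul_le_mul (h₂ _ _ _) (h4.trans ?_)
              (Finset.sum_nonneg fun _ _ => norm_nonneg _) ((norm_nonneg _).trans (h₂ _ _ _))
            gcongr
        _ = C₂ * B * ((1 + ‖η‖) * decay (d + 1 + 1) η) *
            (((1 + ‖θ.1‖) * decay (d + 1 + 1) θ.1) *
              ((1 + ‖θ.2‖) * decay (d + 1 + 1) θ.2)) := by
            rw [hB]; ring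
        _ = _ := by simp_rw [one_add_norm_mul_decay]
    · rw [integral_const_mul, Measure.volume_eq_prod,
        integral_prod_mul (decay (d + 1)) (decay (d + 1))]
      ring
  have hsp : ∀ v : ι × J, (startPair b h fun p p' =>
      stageFactor h u 0 N p p' * scatter f g (pos v.1) (R v.2) p p') = ∫ η, ∫ y,
      tilde b η (y + ((1 / 2 : ℝ) * h) • η) * (stageFactor h u 0 N (y + h • η) y *
        scatter f g (pos v.1) (R v.2) (y + h • η) y) := fun v =>
    integral_prod _ (integrable_startPair b h (hst v))
  simp_rw [hsp]
  refine (sum_norm_integral_le _ (hi.const_mul (C₂ * B * (I * I))) hη).trans_eq ?_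
  rw [integral_const_mul, hB]
  ring

/-! ### Chains as integrals over the momentum transfers -/

lemma partialSum_zero {m : ℕ} (x : Fin m → Space d) : partialSum x 0 = 0 := by
  simp [partialSum]

lemma partialSum_succ {m : ℕ} (x : Fin (m + 1) → Space d) (j : Fin (m + 1)) :
    partialSum x j.succ = x 0 + partialSum (Fin.tail x) j := by
  simp only [partialSum, Finset.sum_filter, Fin.sum_univ_succ, Fin.castSucc_zero, Fin.succ_pos,
    if_true, Fin.castSucc_succ, Fin.succ_lt_succ_iff, Fin.tail]

lemma partialSum_last {m : ℕ} (x : Fin m → Space d) : partialSum x (Fin.last m) = ∑ i, x i := by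
  simp [partialSum, Fin.castSucc_lt_last]

lemma integral_fin_cons {n : ℕ} {G : (Fin (n + 1) → Space d) → ℂ} (hG : Integrable G) :
    ∫ z, G z = ∫ z₀, ∫ z, G (Fin.cons z₀ z) := by
  have hv := (volume_preserving_piFinSuccAbove (fun _ : Fin (n + 1) => Space d) 0).symm
  have hc : ∀ v : Space d × (Fin n → Space d),
      (MeasurableEquiv.piFinSuccAbove (fun _ : Fin (n + 1) => Space d) 0).symm v =
        Fin.cons v.1 v.2 := by
    intro v
    simp [MeasurableEquiv.piFinSuccAbove, Fin.insertNthEquiv, Fin.insertNth_zero']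
  have hi : Integrable fun v : Space d × (Fin n → Space d) =>
      G (Fin.cons v.1 v.2 : Fin (n + 1) → Space d) := by
    refine (hv.integrable_comp_of_integrable hG).congr (Filter.Eventually.of_forall fun v => ?_)
    simp only [Function.comp_apply, hc]
  rw [← hv.integral_comp' G]
  simp_rw [hc]
  exact integral_prod _ hi

/-- The integrand of `chain` as an integral over all momentum transfers. -/
def chainDensity {m : ℕ} (f : Space d → ℂ) (F : Space d → Space d → ℂ)
    (E : Fin m → Space d → Space d → ℂ) (g : Fin m → ℝ) (q : Fin m → Space d)
    (p p' : Space d) (z : Fin m → Space d) : ℂ :=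
  (∏ i, f (z i) * e (-⟪q i, z i⟫)) *
    (∏ i, E i (p + partialSum (fun i => (1 - g i) • z i) i.castSucc)
      (p' - partialSum (fun i => g i • z i) i.castSucc)) *
    F (p + ∑ i, (1 - g i) • z i) (p' - ∑ i, g i • z i)

lemma chainDensity_cons {m : ℕ} (f : Space d → ℂ) (F : Space d → Space d → ℂ)
    (E : Fin (m + 1) → Space d → Space d → ℂ) (g : Fin (m + 1) → ℝ) (q : Fin (m + 1) → Space d)
    (p p' z₀ : Space d) (z : Fin m → Space d) :
    chainDensity f F E g q p p' (Fin.cons z₀ z) = E 0 p p' * (f z₀ * e (-⟪q 0, z₀⟫) *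
      chainDensity f F (Fin.tail E) (Fin.tail g) (Fin.tail q) (p + (1 - g 0) • z₀)
        (p' - g 0 • z₀) z) := by
  have h1 : ∀ c : Fin (m + 1) → ℝ, Fin.tail (fun i => c i •
      (Fin.cons z₀ z : Fin (m + 1) → Space d) i) = fun i => Fin.tail c i • z i := by
    intro c
    ext1 i
    simp [Fin.tail]
  have h2 := h1 fun i => 1 - g i
  have h3 := h1 g
  simp only [chainDensity, Fin.prod_univ_succ, Fin.sum_univ_succ, Fin.cons_zero, Fin.cons_succ,
    Fin.castSucc_zero, Fin.castSucc_succ, partialSum_zero, partialSum_succ, add_zero, sub_zero, h2,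
    h3]
  simp only [Fin.tail, add_assoc, sub_sub]
  ring

lemma measurable_chainDensity {m : ℕ} (f : 𝓢(Space d, ℂ)) {F : Space d → Space d → ℂ}
    (hF : BddMeas F) {E : Fin m → Space d → Space d → ℂ} (hE : ∀ i, BddMeas (E i)) (g : Fin m → ℝ)
    (q : Fin m → Space d) : Measurable fun v : (Space d × Space d) × (Fin m → Space d) =>
      chainDensity f F E g q v.1.1 v.1.2 v.2 := by
  have := continuous_e
  have := f.continuous
  unfold chainDensity partialSum
  refine Measurable.mul (Measurable.mul ?_ ?_) ?_
  · exact Continuous.measurable (by fun_prop)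
  · refine Finset.measurable_prod _ fun i _ => ?_
    exact (hE i).meas.comp (f := fun v : (Space d × Space d) × (Fin m → Space d) =>
      (v.1.1 + ∑ k : Fin m with k.castSucc < i.castSucc, (1 - g k) • v.2 k,
        v.1.2 - ∑ k : Fin m with k.castSucc < i.castSucc, g k • v.2 k)) (by fun_prop)
  · exact hF.meas.comp (f := fun v : (Space d × Space d) × (Fin m → Space d) =>
      (v.1.1 + ∑ k : Fin m, (1 - g k) • v.2 k, v.1.2 - ∑ k : Fin m, g k • v.2 k)) (by fun_prop)

lemma norm_chainDensity_le {m : ℕ} (f : Space d → ℂ) {F : Space d → Space d → ℂ} {L : ℝ}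
    (hF : ∀ p p', ‖F p p'‖ ≤ L) {E : Fin m → Space d → Space d → ℂ} {K : Fin m → ℝ}
    (hE : ∀ i p p', ‖E i p p'‖ ≤ K i) (g : Fin m → ℝ) (q : Fin m → Space d) (p p' : Space d)
    (z : Fin m → Space d) :
    ‖chainDensity f F E g q p p' z‖ ≤ (∏ i, K i) * L * ∏ i, ‖f (z i)‖ := by
  have h1 : ‖∏ i, f (z i) * e (-⟪q i, z i⟫)‖ = ∏ i, ‖f (z i)‖ := by
    simp [norm_prod, norm_e]
  rw [chainDensity, norm_mul, norm_mul, h1, norm_prod]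
  have h2 : 0 ≤ ∏ i, K i := Finset.prod_nonneg fun i _ => (norm_nonneg _).trans (hE i 0 0)
  calc _ ≤ (∏ i, ‖f (z i)‖) * (∏ i, K i) * L := by
        refine mul_le_mul ?_ (hF _ _) (norm_nonneg _) (by positivity)
        gcongr
        exact hE _ _ _
    _ = _ := by ring

lemma exists_norm_chainDensity_le {m : ℕ} (f : Space d → ℂ) {F : Space d → Space d → ℂ}
    (hF : BddMeas F) {E : Fin m → Space d → Space d → ℂ} (hE : ∀ i, BddMeas (E i)) (g : Fin m → ℝ)
    (q : Fin m → Space d) :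
    ∃ K : ℝ, ∀ p p' z, ‖chainDensity f F E g q p p' z‖ ≤ K * ∏ i, ‖f (z i)‖ := by
  choose K hK using fun i => (hE i).bdd
  obtain ⟨L, hL⟩ := hF.bdd
  exact ⟨_, norm_chainDensity_le f hL hK g q⟩

lemma integrable_prod_norm {m : ℕ} (f : 𝓢(Space d, ℂ)) :
    Integrable fun z : Fin m → Space d => ∏ i, ‖f (z i)‖ :=
  Integrable.fintype_prod (f := fun _ z => ‖f z‖) fun _ => f.integrable.norm

lemma chain_eq_integral (f : 𝓢(Space d, ℂ)) {F : Space d → Space d → ℂ} (hF : BddMeas F) :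
    ∀ (m : ℕ) (E : Fin m → Space d → Space d → ℂ) (_ : ∀ i, BddMeas (E i)) (g : Fin m → ℝ)
      (q : Fin m → Space d) (p p' : Space d),
      chain f F m E g q p p' = ∫ z, chainDensity f F E g q p p' z := by
  intro m
  induction m with
  | zero =>
    intro E _ g q p p'
    rw [chain, Measure.volume_pi_eq_dirac 0, integral_dirac]
    simp [chainDensity]
  | succ m ih =>
    intro E hE g q p p'
    obtain ⟨K, hK⟩ := exists_norm_chainDensity_le f hF hE g q
    have hi : Integrable (chainDensity f F E g q p p') := by
      refine ((integrable_prod_norm f).const_mul K).mono' ?_ (Filter.Eventually.of_forall (hK p p'))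
      exact ((measurable_chainDensity f hF hE g q).comp
        (f := fun z => ((p, p'), z)) (by fun_prop)).aestronglyMeasurable
    rw [integral_fin_cons hi]
    simp_rw [chainDensity_cons, integral_const_mul]
    simp only [chain, scatter, ih (Fin.tail E) (fun i => hE i.succ)]

lemma integrable_tilde_mul_prod_norm {m : ℕ} (f : 𝓢(Space d, ℂ))
    (b : 𝓢(Space d × Space d, ℂ)) (h : ℝ) :
    Integrable fun v : (Space d × Space d) × (Fin m → Space d) =>
      ‖tilde b v.1.2 (v.1.1 + ((1 / 2 : ℝ) * h) • v.1.2)‖ * ∏ i, ‖f (v.2 i)‖ := by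
  have hb1 : BddMeas fun _ _ : Space d => (1 : ℂ) := ⟨measurable_const, 1, by simp⟩
  have hi1 := (integrable_startPair b h hb1).swap
  simp only [mul_one] at hi1
  exact hi1.norm.mul_prod (integrable_prod_norm (m := m) f)

/-- The phase-space integral of the chain density against the initial observable. -/
lemma integral_chainDensity {m : ℕ} (f : 𝓢(Space d, ℂ))
    (b : 𝓢(Space d × Space d, ℂ)) (h : ℝ) {F : Space d → Space d → ℂ} (hF : BddMeas F)
    (E : Fin m → Space d → Space d → ℂ) (hE : ∀ i, BddMeas (E i)) (g : Fin m → ℝ)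
    (q : Fin m → Space d) :
    ∫ v : Space d × Space d × (Fin m → Space d),
      tilde b v.2.1 (v.1 + ((1 / 2 : ℝ) * h) • v.2.1) *
        chainDensity f F E g q (v.1 + h • v.2.1) v.1 v.2.2 =
      startPair b h (chain f F m E g q) := by
  obtain ⟨K, hK⟩ := exists_norm_chainDensity_le f hF hE g q
  have hi : Integrable fun v : (Space d × Space d) × (Fin m → Space d) =>
      tilde b v.1.2 (v.1.1 + ((1 / 2 : ℝ) * h) • v.1.2) *
        chainDensity f F E g q (v.1.1 + h • v.1.2) v.1.1 v.2 := by
    refine ((integrable_tilde_mul_prod_norm f b h).const_mul K).mono'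
      (AEStronglyMeasurable.mul ?_ ?_) (Filter.Eventually.of_forall fun v => ?_)
    · exact ((continuous_tilde b).comp (f := fun v : (Space d × Space d) × (Fin m → Space d) =>
        (v.1.2, v.1.1 + ((1 / 2 : ℝ) * h) • v.1.2)) (by fun_prop)).aestronglyMeasurable
    · exact ((measurable_chainDensity f hF hE g q).comp
        (f := fun v : (Space d × Space d) × (Fin m → Space d) =>
          ((v.1.1 + h • v.1.2, v.1.1), v.2)) (by fun_prop)).aestronglyMeasurable
    · rw [norm_mul]
      exact (mul_le_mul_of_nonneg_left (hK _ _ _) (norm_nonneg _)).trans_eq (by ring)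
  have hcomp := (volume_preserving_prodAssoc (α₁ := Space d) (β₁ := Space d)
    (γ₁ := Fin m → Space d)).integral_comp' (fun v : Space d × Space d × (Fin m → Space d) =>
      tilde b v.2.1 (v.1 + ((1 / 2 : ℝ) * h) • v.2.1) *
        chainDensity f F E g q (v.1 + h • v.2.1) v.1 v.2.2)
  rw [← hcomp]
  refine (integral_prod _ hi).trans ?_
  simp_rw [integral_const_mul, ← chain_eq_integral f hF m E hE g q]
  exact integral_prod_swap (μ := volume) (ν := volume) fun v : Space d × Space d =>
    tilde b v.1 (v.2 + ((1 / 2 : ℝ) * h) • v.1) * chain f F m E g q (v.2 + h • v.1) v.2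

/-! ### The stages of the Duhamel expansion -/

lemma IsDampingProfile.eq_zero_of_one_le {Γ : Space d → ℝ} (hΓ : IsDampingProfile Γ) {y : Space d}
    (hy : 1 ≤ ‖y‖) : Γ y = 0 := by
  have hc : IsClosed {y : Space d | Γ y = 0} := isClosed_eq hΓ.smooth.continuous continuous_const
  have hsub : (Metric.closedBall (0 : Space d) 1)ᶜ ⊆ {y | Γ y = 0} := fun z hz =>
    hΓ.eq_zero z (by simpa using hz)
  have hcl := hc.closure_subset_iff.2 hsub
  rw [closure_compl, interior_closedBall _ one_ne_zero] at hcl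
  exact hcl (by simpa using hy)

lemma IsRadialCutoff.nonneg {χ : Space d → ℝ} (hχ : IsRadialCutoff χ) (hd : 0 < d)
    (z : Space d) : 0 ≤ χ z := by
  have : Nonempty (Fin d) := ⟨⟨0, hd⟩⟩
  obtain ⟨w, hw⟩ := NormedSpace.exists_lt_norm ℝ (Space d) (max 2 ‖z‖)
  rw [← hχ.eq_zero w ((le_max_left _ _).trans_lt hw)]
  exact hχ.antitone_norm z w ((le_max_right _ _).trans hw.le)

lemma IsRadialCutoff.le_one {χ : Space d → ℝ} (hχ : IsRadialCutoff χ) (z : Space d) :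
    χ z ≤ 1 := by
  rw [← hχ.eq_one 0 (by simp)]
  exact hχ.antitone_norm 0 z (by simp)

/-- The factor of the partition of unity that belongs to the stage `j`. -/
def cutoff {m : ℕ} (χ : Space d → ℝ) (α : ℝ) (S : Finset (Fin (m + 1))) (j : Fin (m + 1))
    (w : Space d) : ℝ :=
  if j ∈ S then if j = 0 ∨ j = Fin.last m then 1 else χ (α • w) else 1 - χ (α • w)

lemma chiS_eq_prod {m : ℕ} (χ : Space d → ℝ) (α : ℝ) {S : Finset (Fin (m + 1))}
    (w : Fin (m + 1) → Space d) :
    chiS χ S (fun j => α • w j) = ∏ j, cutoff χ α S j (w j) := by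
  have h1 : ∏ j ∈ S \ {0, Fin.last m}, χ (α • w j) = ∏ j ∈ S, cutoff χ α S j (w j) := by
    rw [← Finset.prod_subset (Finset.sdiff_subset (s := S) (t := {0, Fin.last m}))]
    · refine Finset.prod_congr rfl fun j hj => ?_
      simp only [Finset.mem_sdiff, Finset.mem_insert, Finset.mem_singleton] at hj
      rw [cutoff, if_pos hj.1, if_neg hj.2]
    · intro j hj hj'
      simp only [Finset.mem_sdiff, Finset.mem_insert, Finset.mem_singleton, not_and, not_not]
        at hj'
      rw [cutoff, if_pos hj, if_pos (hj' hj)]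
  have h2 : ∏ j ∈ Sᶜ, (1 - χ (α • w j)) = ∏ j ∈ Sᶜ, cutoff χ α S j (w j) := by
    refine Finset.prod_congr rfl fun j hj => ?_
    rw [cutoff, if_neg (Finset.mem_compl.1 hj)]
  rw [chiS, h1, h2, Finset.prod_mul_prod_compl]

/-- The multiplier in the momentum difference (in units of `h`) at the stage `j`, lasting for the
time `u`. -/
def multiplier {m : ℕ} (Γ χ : Space d → ℝ) (α : ℝ) (S : Finset (Fin (m + 1))) (j : Fin (m + 1))
    (u : ℝ) (w : Space d) : ℝ :=
  Real.exp (-(α ^ d * (1 - Γ (α • w)) * u)) * cutoff χ α S j w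

/-- The value of the multiplier at large momentum differences, for the stages other than the first
and the last; for these two it is set to `0`. -/
def farPart {m : ℕ} (α : ℝ) (S : Finset (Fin (m + 1))) (j : Fin (m + 1)) (u : ℝ) : ℝ :=
  if j ∈ S then 0 else Real.exp (-(α ^ d * u))

/-- The multiplier without `farPart`; for the stages other than the first and the last it lives at
bounded momentum differences. -/
def nearPart {m : ℕ} (Γ χ : Space d → ℝ) (α : ℝ) (S : Finset (Fin (m + 1))) (j : Fin (m + 1))
    (u : ℝ) (w : Space d) : ℂ :=
  ((multiplier Γ χ α S j u w - farPart (d := d) α S j u : ℝ) : ℂ)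

section Stages

variable {m : ℕ} {Γ χ : Space d → ℝ} {α : ℝ} {S : Finset (Fin (m + 1))} {j : Fin (m + 1)}
  {u : ℝ}

lemma cutoff_mem_Icc (hχ : IsRadialCutoff χ) (hd : 0 < d) (w : Space d) :
    cutoff χ α S j w ∈ Set.Icc (0 : ℝ) 1 := by
  have h1 := hχ.nonneg hd (α • w)
  have h2 := hχ.le_one (α • w)
  unfold cutoff
  constructor <;> split_ifs <;> linarith

lemma multiplier_mem_Icc (hΓ : IsDampingProfile Γ) (hχ : IsRadialCutoff χ) (hd : 0 < d)
    (hα : 0 < α) (hu : 0 ≤ u) (w : Space d) : multiplier Γ χ α S j u w ∈ Set.Icc (0 : ℝ) 1 := by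
  have h1 := cutoff_mem_Icc (α := α) (S := S) (j := j) hχ hd w
  have h2 : Real.exp (-(α ^ d * (1 - Γ (α • w)) * u)) ≤ 1 := by
    rw [Real.exp_le_one_iff, neg_nonpos]
    have := (hΓ.mem_Icc (α • w)).2
    exact mul_nonneg (mul_nonneg (by positivity) (by linarith)) hu
  exact ⟨mul_nonneg (Real.exp_pos _).le h1.1, mul_le_one₀ h2 h1.1 h1.2⟩

/-- Outside `S` the damping acts with full strength, since `Γ` vanishes where `χ ≠ 1`; for
`‖α w‖ = 1` this follows from the continuity of `Γ`. -/
lemma nearPart_of_notMem (hΓ : IsDampingProfile Γ) (hχ : IsRadialCutoff χ) (hj : j ∉ S)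
    (w : Space d) :
    nearPart Γ χ α S j u w = ((-(Real.exp (-(α ^ d * u)) * χ (α • w)) : ℝ) : ℂ) := by
  rw [nearPart, multiplier, farPart, cutoff, if_neg hj, if_neg hj]
  congr 1
  rcases lt_or_ge ‖α • w‖ 1 with h | h
  · rw [hχ.eq_one _ h]
    ring
  · rw [hΓ.eq_zero_of_one_le h]
    ring_nf

lemma continuous_nearPart (hΓ : IsDampingProfile Γ) (hχ : IsRadialCutoff χ) :
    Continuous (nearPart Γ χ α S j u) := by
  have h1 := hΓ.smooth.continuous
  have h2 := hχ.smooth.continuous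
  unfold nearPart multiplier cutoff
  split_ifs <;> fun_prop

lemma norm_nearPart_le_one (hΓ : IsDampingProfile Γ) (hχ : IsRadialCutoff χ) (hd : 0 < d)
    (hα : 0 < α) (hu : 0 ≤ u) (hj : j ∈ S) (w : Space d) : ‖nearPart Γ χ α S j u w‖ ≤ 1 := by
  have h1 := multiplier_mem_Icc (S := S) (j := j) hΓ hχ hd hα hu w
  rw [nearPart, farPart, if_pos hj, sub_zero, Complex.norm_real, Real.norm_of_nonneg h1.1]
  exact h1.2

lemma isStage_nearPart (hΓ : IsDampingProfile Γ) (hχ : IsRadialCutoff χ) (hd : 0 < d)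
    (hα : 0 < α) (hj0 : j ≠ 0) (hj1 : j ≠ Fin.last m) {t h : ℝ} (hu : 0 ≤ u) (hut : h * u ≤ t) :
    IsStage (α ^ d) (2 / α) t h (j ∈ S) u (farPart (d := d) α S j u) (nearPart Γ χ α S j u) := by
  refine ⟨hu, (continuous_nearPart hΓ hχ).measurable, fun w hw => ?_, fun hj => ?_, fun hj => ?_⟩
  · have h1 : 2 < ‖α • w‖ := by
      rw [norm_smul, Real.norm_of_nonneg hα.le]
      rwa [div_lt_iff₀' hα] at hw
    by_cases hj : j ∈ S
    · simp [nearPart, multiplier, farPart, cutoff, hj, hj0, hj1, hχ.eq_zero _ h1]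
    · rw [nearPart_of_notMem hΓ hχ hj, hχ.eq_zero _ h1]
      simp
  · exact ⟨by rw [farPart, if_pos hj], hut, norm_nearPart_le_one hΓ hχ hd hα hu hj⟩
  · refine ⟨by rw [farPart, if_neg hj], fun w => ?_⟩
    rw [nearPart_of_notMem hΓ hχ hj, Complex.norm_real, norm_neg, norm_mul, Real.norm_eq_abs,
      Real.abs_exp, Real.norm_of_nonneg (hχ.nonneg hd _)]
    exact mul_le_of_le_one_right (Real.exp_pos _).le (hχ.le_one _)

/-- The amplitude of the stage `j`. -/
def stage (Γ χ : Space d → ℝ) (α h : ℝ) (S : Finset (Fin (m + 1))) (u : Fin (m + 1) → ℝ)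
    (j : Fin (m + 1)) : Space d → Space d → ℂ :=
  stageFactor h (u j) (farPart (d := d) α S j (u j)) (nearPart Γ χ α S j (u j))

lemma stage_apply (Γ χ : Space d → ℝ) (α h : ℝ) (S : Finset (Fin (m + 1))) (u : Fin (m + 1) → ℝ)
    (j : Fin (m + 1)) (p p' : Space d) : stage Γ χ α h S u j p p' =
      e (u j / 2 * (‖p‖ ^ 2 - ‖p'‖ ^ 2)) *
        (multiplier Γ χ α S j (u j) (h⁻¹ • (p - p')) : ℂ) := by
  rw [stage, stageFactor, nearPart]
  push_cast
  ring

lemma norm_stage_le_one (hΓ : IsDampingProfile Γ) (hχ : IsRadialCutoff χ) (hd : 0 < d)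
    (hα : 0 < α) {u : Fin (m + 1) → ℝ} (hu : ∀ j, 0 ≤ u j) (h : ℝ) (p p' : Space d) :
    ‖stage Γ χ α h S u j p p'‖ ≤ 1 := by
  have h1 := multiplier_mem_Icc (S := S) (j := j) hΓ hχ hd hα (hu j) (h⁻¹ • (p - p'))
  rw [stage_apply, norm_mul, norm_e, one_mul, Complex.norm_real, Real.norm_of_nonneg h1.1]
  exact h1.2

lemma bddMeas_stage (hΓ : IsDampingProfile Γ) (hχ : IsRadialCutoff χ) (hd : 0 < d)
    (hα : 0 < α) {u : Fin (m + 1) → ℝ} (hu : ∀ j, 0 ≤ u j) (h : ℝ) :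
    BddMeas (stage Γ χ α h S u j) := by
  refine ⟨?_, 1, norm_stage_le_one hΓ hχ hd hα hu h⟩
  have h1 := continuous_nearPart (α := α) (S := S) (j := j) (u := u j) hΓ hχ
  have h2 := continuous_e
  unfold stage stageFactor
  exact Continuous.measurable (by fun_prop)

/-- The amplitude of the last stage, with the final observable. -/
def finalStage (a : 𝓢(Space d × Space d, ℂ)) (Γ χ : Space d → ℝ) (α h : ℝ)
    (S : Finset (Fin (m + 1))) (u : Fin (m + 1) → ℝ) (p p' : Space d) : ℂ :=
  stage Γ χ α h S u (Fin.last m) p p' *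
    tilde a (-(h⁻¹ • (p - p'))) ((1 / 2 : ℝ) • (p + p'))

lemma norm_finalStage_le {a : 𝓢(Space d × Space d, ℂ)} {A : ℝ} {N : ℕ}
    (hA : ∀ ξ y, ‖tilde a ξ y‖ ≤ A * decay N ξ) (hΓ : IsDampingProfile Γ) (hχ : IsRadialCutoff χ)
    (hd : 0 < d) (hα : 0 < α) {u : Fin (m + 1) → ℝ} (hu : ∀ j, 0 ≤ u j) (h : ℝ)
    (p p' : Space d) : ‖finalStage a Γ χ α h S u p p'‖ ≤ A * decay N (h⁻¹ • (p - p')) := by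
  rw [finalStage, norm_mul]
  refine (mul_le_of_le_one_left (norm_nonneg _) (norm_stage_le_one hΓ hχ hd hα hu h p p')).trans ?_
  refine (hA _ _).trans_eq ?_
  simp only [decay, norm_neg]

lemma bddMeas_finalStage {a : 𝓢(Space d × Space d, ℂ)} (hΓ : IsDampingProfile Γ)
    (hχ : IsRadialCutoff χ) (hd : 0 < d) (hα : 0 < α) {u : Fin (m + 1) → ℝ} (hu : ∀ j, 0 ≤ u j)
    (h : ℝ) : BddMeas (finalStage a Γ χ α h S u) := by
  obtain ⟨C, -, hC⟩ := exists_norm_tilde_le a 0 0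
  refine ⟨?_, C, fun p p' => ?_⟩
  · refine (bddMeas_stage hΓ hχ hd hα hu h).meas.mul ?_
    exact ((continuous_tilde a).comp (f := fun v : Space d × Space d =>
      (-(h⁻¹ • (v.1 - v.2)), (1 / 2 : ℝ) • (v.1 + v.2))) (by fun_prop)).measurable
  · simpa [decay] using norm_finalStage_le (fun ξ y => (hC ξ y).trans_eq
      (by simp [decay] : _ = C * decay 0 ξ)) hΓ hχ hd hα hu h p p'

/-! ### The nondiagonal term as an integral of chains over the times -/

/-- The integrand of the nondiagonal term at fixed times `u`. -/
def timeDensity (W : 𝓢(Space d, ℂ)) (a b : 𝓢(Space d × Space d, ℂ)) (Γ χ : Space d → ℝ)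
    (α r : ℝ) (γ : Fin m → Fin 2) (S : Finset (Fin (m + 1))) (q : Fin m → Space d)
    (u : Fin (m + 1) → ℝ) (y η : Space d) (z : Fin m → Space d) : ℂ :=
  (∏ i, 𝓕 (⇑W) (z i)) * e (-(r⁻¹ * ∑ i, ⟪q i, z i⟫))
    * (∏ j, (e (xi r γ y η z j * u j)
          * (Real.exp (-(α ^ d * (1 - Γ (α • offset r η z j)) * u j)) : ℂ)))
    * (chiS χ S (fun j => α • offset r η z j) : ℂ)
    * tilde a (-η - (r ^ d)⁻¹ • ∑ i, z i)
        (y - ∑ i, gam γ i • z i + (1 / 2 : ℝ) • (r ^ d • η + ∑ i, z i))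
    * tilde b η (y + ((1 / 2 : ℝ) * r ^ d) • η)

lemma integrand_eq_integral (W : 𝓢(Space d, ℂ)) (a b : 𝓢(Space d × Space d, ℂ))
    (Γ χ : Space d → ℝ) (α t r : ℝ) (γ : Fin m → Fin 2) (S : Finset (Fin (m + 1)))
    (q : Fin m → Space d) (y η : Space d) (z : Fin m → Space d) :
    integrand W a b Γ χ α t r γ S q y η z =
      ∫ v in {v : Fin m → ℝ | (∀ i, 0 ≤ v i) ∧ ∑ i, v i ≤ (r ^ d)⁻¹ * t},
        timeDensity W a b Γ χ α r γ S q (Fin.cons ((r ^ d)⁻¹ * t - ∑ i, v i) v) y η z := by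
  simp only [integrand, timeDensity, simplexIntegral]
  simp_rw [integral_mul_const, integral_const_mul]

lemma partialSum_sub_smul (g : Fin m → ℝ) (z : Fin m → Space d) (j : Fin (m + 1)) :
    partialSum (fun i => (1 - g i) • z i) j + partialSum (fun i => g i • z i) j =
      partialSum z j := by
  simp only [partialSum, ← Finset.sum_add_distrib, ← add_smul, sub_add_cancel, one_smul]

lemma e_sum {ι : Type*} (s : Finset ι) (x : ι → ℝ) : e (∑ i ∈ s, x i) = ∏ i ∈ s, e (x i) := by
  classical
  induction s using Finset.induction_on with
  | empty => simp [e_zero]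
  | insert i s hi ih => rw [Finset.sum_insert hi, Finset.prod_insert hi, e_add, ih]

lemma stage_eq {r : ℝ} (hr : 0 < r) (γ : Fin m → Fin 2) (u : Fin (m + 1) → ℝ) (y η : Space d)
    (z : Fin m → Space d) (j : Fin (m + 1)) :
    stage Γ χ α (r ^ d) S u j (y + r ^ d • η + partialSum (fun i => (1 - gam γ i) • z i) j)
      (y - partialSum (fun i => gam γ i • z i) j) =
    e (xi r γ y η z j * u j) * (Real.exp (-(α ^ d * (1 - Γ (α • offset r η z j)) * u j)) : ℂ) *
      (cutoff χ α S j (offset r η z j) : ℂ) := by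
  have hw : (r ^ d)⁻¹ • (y + r ^ d • η + partialSum (fun i => (1 - gam γ i) • z i) j -
      (y - partialSum (fun i => gam γ i • z i) j)) = offset r η z j := by
    rw [show y + r ^ d • η + partialSum (fun i => (1 - gam γ i) • z i) j -
      (y - partialSum (fun i => gam γ i • z i) j) = r ^ d • η +
        (partialSum (fun i => (1 - gam γ i) • z i) j + partialSum (fun i => gam γ i • z i) j) by
      abel, partialSum_sub_smul, smul_add, inv_smul_smul₀ (by positivity), offset]
  have hp : y + r ^ d • η + partialSum (fun i => (1 - gam γ i) • z i) j =
      y + partialSum (fun i => (1 - gam γ i) • z i) j + r ^ d • η := by abel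
  have hx : u j / 2 * (‖y + partialSum (fun i => (1 - gam γ i) • z i) j + r ^ d • η‖ ^ 2 -
      ‖y - partialSum (fun i => gam γ i • z i) j‖ ^ 2) = xi r γ y η z j * u j := by
    rw [xi]
    ring
  rw [stage_apply, hw, hp, hx, multiplier, Complex.ofReal_mul]
  ring

lemma timeDensity_eq (W : 𝓢(Space d, ℂ)) (a b : 𝓢(Space d × Space d, ℂ))
    {r : ℝ} (hr : 0 < r) (γ : Fin m → Fin 2) (q : Fin m → Space d) (u : Fin (m + 1) → ℝ)
    (y η : Space d) (z : Fin m → Space d) :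
    timeDensity W a b Γ χ α r γ S q u y η z =
      tilde b η (y + ((1 / 2 : ℝ) * r ^ d) • η) *
        chainDensity (𝓕 W : 𝓢(Space d, ℂ)) (finalStage a Γ χ α (r ^ d) S u)
          (fun i => stage Γ χ α (r ^ d) S u i.castSucc) (gam γ) (fun i => r⁻¹ • q i)
          (y + r ^ d • η) y z := by
  have hsum : ∑ i, (1 - gam γ i) • z i + ∑ i, gam γ i • z i = ∑ i, z i := by
    simp only [← Finset.sum_add_distrib, ← add_smul, sub_add_cancel, one_smul]
  have h1 : e (-(r⁻¹ * ∑ i, ⟪q i, z i⟫)) = ∏ i, e (-⟪r⁻¹ • q i, z i⟫) := by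
    rw [← e_sum, Finset.sum_neg_distrib, Finset.mul_sum]
    simp_rw [real_inner_smul_left]
  have h2 := stage_eq (Γ := Γ) (χ := χ) (α := α) (S := S) hr γ u y η z
  have h3 := h2 (Fin.last m)
  rw [partialSum_last, partialSum_last] at h3
  have h4 : -((r ^ d)⁻¹ • (y + r ^ d • η + ∑ i, (1 - gam γ i) • z i - (y - ∑ i, gam γ i • z i))) =
      -η - (r ^ d)⁻¹ • ∑ i, z i := by
    rw [← hsum, show y + r ^ d • η + ∑ i, (1 - gam γ i) • z i - (y - ∑ i, gam γ i • z i) =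
      r ^ d • η + (∑ i, (1 - gam γ i) • z i + ∑ i, gam γ i • z i) by abel, smul_add,
      inv_smul_smul₀ (by positivity)]
    abel
  have h5 : (1 / 2 : ℝ) • (y + r ^ d • η + ∑ i, (1 - gam γ i) • z i + (y - ∑ i, gam γ i • z i)) =
      y - ∑ i, gam γ i • z i + (1 / 2 : ℝ) • (r ^ d • η + ∑ i, z i) := by
    rw [← hsum]
    module
  rw [timeDensity, chainDensity, finalStage, h4, h5, h3, chiS_eq_prod, Complex.ofReal_prod, h1]
  simp_rw [h2]
  rw [Finset.prod_mul_distrib (f := fun i => (𝓕 W : 𝓢(Space d, ℂ)) (z i)),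
    Fin.prod_univ_castSucc (f := fun j => e (xi r γ y η z j * u j) *
      (Real.exp (-(α ^ d * (1 - Γ (α • offset r η z j)) * u j)) : ℂ)),
    Fin.prod_univ_castSucc (f := fun j => (cutoff χ α S j (offset r η z j) : ℂ)),
    Finset.prod_mul_distrib (g := fun i : Fin m =>
      (cutoff χ α S i.castSucc (offset r η z i.castSucc) : ℂ)), SchwartzMap.fourier_coe]
  ring

end Stages

section Times

variable {m : ℕ} {Γ χ : Space d → ℝ} {α : ℝ} {S : Finset (Fin (m + 1))}

/-- The simplex of times, the time of the first stage being eliminated. -/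
def timeSimplex (m : ℕ) (T : ℝ) : Set (Fin m → ℝ) := {v | (∀ i, 0 ≤ v i) ∧ ∑ i, v i ≤ T}

/-- All times, the first one included. -/
def allTimes (T : ℝ) (v : Fin m → ℝ) : Fin (m + 1) → ℝ := Fin.cons (T - ∑ i, v i) v

lemma continuous_allTimes (T : ℝ) : Continuous (allTimes (m := m) T) :=
  Continuous.finCons (A := fun _ => ℝ) (by fun_prop) (by fun_prop)

lemma measurableSet_timeSimplex (T : ℝ) : MeasurableSet (timeSimplex m T) := by
  unfold timeSimplex
  refine IsClosed.measurableSet ?_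
  simp only [Set.ofPred_and, Set.ofPred_forall]
  exact (isClosed_iInter fun i => isClosed_le continuous_const (by fun_prop)).inter
    (isClosed_le (by fun_prop) continuous_const)

lemma le_of_mem_timeSimplex {T : ℝ} {v : Fin m → ℝ} (hv : v ∈ timeSimplex m T) (i : Fin m) :
    v i ≤ T :=
  (Finset.single_le_sum (fun i _ => hv.1 i) (Finset.mem_univ i)).trans hv.2

lemma timeSimplex_subset (T : ℝ) : timeSimplex m T ⊆ Set.Icc (fun _ => 0) fun _ => T :=
  fun _ hv => ⟨fun i => hv.1 i, fun i => le_of_mem_timeSimplex hv i⟩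

lemma allTimes_nonneg {T : ℝ} {v : Fin m → ℝ} (hv : v ∈ timeSimplex m T) (j : Fin (m + 1)) :
    0 ≤ allTimes T v j := by
  refine Fin.cases ?_ (fun i => hv.1 i) j
  exact sub_nonneg.2 hv.2

lemma allTimes_le {T : ℝ} {v : Fin m → ℝ} (hv : v ∈ timeSimplex m T) (j : Fin (m + 1)) :
    allTimes T v j ≤ T := by
  refine Fin.cases ?_ (fun i => le_of_mem_timeSimplex hv i) j
  exact sub_le_self _ (Finset.sum_nonneg fun i _ => hv.1 i)

lemma continuous_timeDensity (W : 𝓢(Space d, ℂ)) (a b : 𝓢(Space d × Space d, ℂ))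
    (hΓ : IsDampingProfile Γ) (hχ : IsRadialCutoff χ) (α r : ℝ) (γ : Fin m → Fin 2)
    (S : Finset (Fin (m + 1))) (q : Fin m → Space d) :
    Continuous fun v : (Space d × Space d × (Fin m → Space d)) × (Fin (m + 1) → ℝ) =>
      timeDensity W a b Γ χ α r γ S q v.2 v.1.1 v.1.2.1 v.1.2.2 := by
  have h1 := hΓ.smooth.continuous
  have h2 := hχ.smooth.continuous
  have h3 := continuous_e
  have h4 : Continuous (𝓕 (⇑W)) := by
    rw [← SchwartzMap.fourier_coe]
    exact (𝓕 W : 𝓢(Space d, ℂ)).continuous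
  have hcomp : ∀ (a : 𝓢(Space d × Space d, ℂ)) {X : Type} [TopologicalSpace X]
      {f g : X → Space d}, Continuous f → Continuous g → Continuous fun x => tilde a (f x) (g x) :=
    fun a _ _ _ _ hf hg => (continuous_tilde a).comp (hf.prodMk hg)
  unfold timeDensity xi offset chiS partialSum
  refine Continuous.mul (Continuous.mul (Continuous.mul ?_ ?_) ?_) ?_
  · fun_prop
  · fun_prop
  · exact hcomp a (by fun_prop) (by fun_prop)
  · exact hcomp b (by fun_prop) (by fun_prop)

/-- The times may be integrated last. -/
lemma integral_integrand (W : 𝓢(Space d, ℂ)) (a b : 𝓢(Space d × Space d, ℂ))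
    (hΓ : IsDampingProfile Γ) (hχ : IsRadialCutoff χ) (hd : 0 < d) (hα : 0 < α) (t : ℝ) {r : ℝ}
    (hr : 0 < r) (γ : Fin m → Fin 2) (q : Fin m → Space d) :
    ∫ x : Space d × Space d × (Fin m → Space d),
        integrand W a b Γ χ α t r γ S q x.1 x.2.1 x.2.2 =
      ∫ v in timeSimplex m ((r ^ d)⁻¹ * t), startPair b (r ^ d)
        (chain (𝓕 W : 𝓢(Space d, ℂ)) (finalStage a Γ χ α (r ^ d) S (allTimes ((r ^ d)⁻¹ * t) v)) m
          (fun i => stage Γ χ α (r ^ d) S (allTimes ((r ^ d)⁻¹ * t) v) i.castSucc) (gam γ)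
          fun i => r⁻¹ • q i) := by
  set T := (r ^ d)⁻¹ * t with hT
  obtain ⟨C, -, hC⟩ := exists_norm_tilde_le a 0 0
  simp_rw [integrand_eq_integral]
  have hfin : IsFiniteMeasure ((volume : Measure (Fin m → ℝ)).restrict (timeSimplex m T)) := by
    refine ⟨?_⟩
    rw [Measure.restrict_apply_univ]
    exact (measure_mono (timeSimplex_subset T)).trans_lt measure_Icc_lt_top
  have hdom : Integrable fun x : Space d × Space d × (Fin m → Space d) =>
      C * (‖tilde b x.2.1 (x.1 + ((1 / 2 : ℝ) * r ^ d) • x.2.1)‖ *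
        ∏ i, ‖(𝓕 W : 𝓢(Space d, ℂ)) (x.2.2 i)‖) :=
    ((volume_preserving_prodAssoc (α₁ := Space d) (β₁ := Space d)
      (γ₁ := Fin m → Space d)).integrable_comp_emb (MeasurableEquiv.measurableEmbedding _)).1
      ((integrable_tilde_mul_prod_norm (m := m) (𝓕 W) b (r ^ d)).const_mul C)
  have hi : Integrable (Function.uncurry fun (x : Space d × Space d × (Fin m → Space d))
      (v : Fin m → ℝ) => timeDensity W a b Γ χ α r γ S q (allTimes T v) x.1 x.2.1 x.2.2)
      (volume.prod (volume.restrict (timeSimplex m T))) := by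
    refine (hdom.comp_fst (volume.restrict (timeSimplex m T))).mono' ?_ ?_
    · exact ((continuous_timeDensity W a b hΓ hχ α r γ S q).comp
        (f := fun p : (Space d × Space d × (Fin m → Space d)) × (Fin m → ℝ) =>
          (p.1, allTimes T p.2)) (continuous_fst.prodMk
            ((continuous_allTimes T).comp continuous_snd))).aestronglyMeasurable
    · have hmem : ∀ᵐ p : (Space d × Space d × (Fin m → Space d)) × (Fin m → ℝ)
          ∂(volume.prod (volume.restrict (timeSimplex m T))), p.2 ∈ timeSimplex m T :=
        Measure.quasiMeasurePreserving_snd.ae (ae_restrict_mem (measurableSet_timeSimplex T))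
      filter_upwards [hmem] with p hp
      have hu := allTimes_nonneg hp
      rw [Function.uncurry, timeDensity_eq W a b hr, norm_mul]
      have h1 := norm_chainDensity_le (𝓕 W : 𝓢(Space d, ℂ)) (K := fun _ => 1)
        (fun p p' => (norm_finalStage_le (S := S) (A := C) (N := 0) (fun ξ y => (hC ξ y).trans_eq
          (by simp [decay])) hΓ hχ hd hα hu (r ^ d) p p').trans_eq
            (by simp [decay] : _ = C))
        (E := fun i => stage Γ χ α (r ^ d) S (allTimes T p.2) i.castSucc)
        (fun i p p' => norm_stage_le_one hΓ hχ hd hα hu (r ^ d) p p') (gam γ)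
        (fun i => r⁻¹ • q i) (p.1.1 + r ^ d • p.1.2.1) p.1.1 p.1.2.2
      rw [Finset.prod_const_one, one_mul] at h1
      exact (mul_le_mul_of_nonneg_left h1 (norm_nonneg _)).trans_eq (by ring)
  refine (integral_integral_swap hi).trans ?_
  refine setIntegral_congr_fun (measurableSet_timeSimplex T) fun v hv => ?_
  have hu := allTimes_nonneg hv
  simp_rw [timeDensity_eq W a b hr]
  exact integral_chainDensity (𝓕 W) b (r ^ d) (bddMeas_finalStage hΓ hχ hd hα hu (r ^ d)) _
    (fun i => bddMeas_stage hΓ hχ hd hα hu (r ^ d)) (gam γ) _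

end Times

/-! ### The sum over the nondiagonal tuples -/

open Classical in
/-- The sum over the nondiagonal tuples at fixed times. -/
lemma exists_sum_startPair_chain_le (f : 𝓢(Space d, ℂ)) (a b : 𝓢(Space d × Space d, ℂ)) (hd : 0 < d)
    {α t H₀ cS cN cκ : ℝ} (hα : 0 < α) (ht : 0 ≤ t) (hH₀ : 0 ≤ H₀) (hcN : 0 ≤ cN)
    (hcκ : 0 ≤ cκ) :
    ∃ C : ℝ, 0 ≤ C ∧ ∀ {ι : Type} [Fintype ι] (κ h : ℝ) (pos : ι → Space d), 0 ≤ κ →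
      Scatterers cS κ pos → 0 < h → h ≤ H₀ → h ^ d * Fintype.card ι ≤ cN * h → h ≤ cκ * κ →
      ∀ Γ χ : Space d → ℝ, IsDampingProfile Γ → IsRadialCutoff χ →
      ∀ (k : ℕ) (g : Fin (k + 1) → ℝ), (∀ i, g i = 0 ∨ g i = 1) →
      ∀ S : Finset (Fin (k + 1 + 1)), 0 ∈ S → Fin.last (k + 1) ∈ S →
      ∀ u : Fin (k + 1 + 1) → ℝ, (∀ j, 0 ≤ u j) → (∀ j, h * u j ≤ t) →
      ∑ q : Fin (k + 1) → ι with
          ¬ ChainDiagonal (fun i : Fin k => i.succ.castSucc ∈ S) (q 0) (Fin.tail q),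
        ‖startPair b h (chain f (finalStage a Γ χ α h S u) (k + 1)
          (fun i => stage Γ χ α h S u i.castSucc) g fun i => pos (q i))‖ ≤
        C ^ (k + 1) * κ * ∏ i : Fin (k + 1), stageSize (α ^ d) h (i.succ ∈ S) (u i.succ) := by
  obtain ⟨C₁, hC₁, h₁⟩ := exists_bound_chain f (a := α ^ d) (ρ := 2 / α) (t := t) (cS := cS)
    (by positivity) (by positivity) ht hH₀ hcN hcκ
  obtain ⟨C₂, hC₂, h₂⟩ := exists_sum_startPair_le f b (ε := α ^ d / 8) ht hH₀
  obtain ⟨A, hA, hA'⟩ := exists_norm_tilde_le a (d + 1) 0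
  refine ⟨C₁ * (1 + C₂ * A * cN), by positivity, ?_⟩
  intro ι _ κ h pos hκ hs hh hhH hcard hhκ Γ χ hΓ hχ k g hg S hS0 hS1 u hu hut
  have hF := bddMeas_finalStage (a := a) (S := S) hΓ hχ hd hα hu h
  have hFd := norm_finalStage_le (S := S) (N := d + 1) (fun ξ y => (hA' ξ y).trans_eq
    (by simp [decay] : _ = A * decay (d + 1) ξ)) hΓ hχ hd hα hu h
  have hst : ∀ i : Fin k, IsStage (α ^ d) (2 / α) t h (i.succ.castSucc ∈ S) (u i.succ.castSucc)
      (farPart (d := d) α S i.succ.castSucc (u i.succ.castSucc))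
      (nearPart Γ χ α S i.succ.castSucc (u i.succ.castSucc)) := fun i =>
    isStage_nearPart hΓ hχ hd hα (by simp [Fin.castSucc_succ]) (Fin.castSucc_lt_last _).ne
      (hu _) (hut _)
  have hb := h₁ κ h A pos _ hκ hA hs hh hhH hcard hhκ hF hFd k (Fin.tail g) (fun i => hg _)
    (fun i => i.succ.castSucc ∈ S) _ _ _ hst
  set P := ∏ i : Fin k, stageSize (α ^ d) h (i.succ.castSucc ∈ S) (u i.succ.castSucc) with hP
  have hP0 : 0 ≤ P := Finset.prod_nonneg fun i _ => (stageSize_pos hh _ _).le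
  have hN1 := norm_nearPart_le_one hΓ hχ hd hα (hu 0) hS0
  have h3 := h₂ κ _ h pos _ _ hκ (by positivity) hh hhH hb (g 0) (hg 0) (u 0)
    (nearPart Γ χ α S 0 (u 0)) (hu 0) (hut 0) (continuous_nearPart hΓ hχ).measurable hN1
  have hlast : ∏ i : Fin (k + 1), stageSize (α ^ d) h (i.succ ∈ S) (u i.succ) = P * h := by
    rw [Fin.prod_univ_castSucc, Fin.succ_last]
    congr 1
    rw [stageSize, if_pos hS1]
  rw [hlast]
  calc _ = _ := ?_
    _ ≤ _ := h3
    _ = C₂ * A * C₁ ^ (k + 1) * (h ^ d * Fintype.card ι) * P * κ := by ring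
    _ ≤ C₂ * A * C₁ ^ (k + 1) * (cN * h) * P * κ := by gcongr
    _ = (C₂ * A * cN) * (C₁ ^ (k + 1) * κ * (P * h)) := by ring
    _ ≤ (1 + C₂ * A * cN) ^ (k + 1) * (C₁ ^ (k + 1) * κ * (P * h)) := by
        have h4 : 0 ≤ C₂ * A * cN := by positivity
        gcongr
        refine le_trans ?_ (le_self_pow₀ (by linarith) (Nat.succ_ne_zero k))
        linarith
    _ = _ := by rw [mul_pow]; ring
  refine Finset.sum_equiv (Fin.consEquiv fun _ => ι).symm (fun q => ?_) fun q _ => ?_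
  · simp [nondiagNew, Fin.consEquiv]
  · have hfar : farPart (d := d) α S 0 (u 0) = 0 := by rw [farPart, if_pos hS0]
    simp only [chain, stage, Fin.castSucc_zero, hfar]
    rfl

lemma integrableOn_stageSize (a h : ℝ) (s : Prop) (T : ℝ) :
    IntegrableOn (fun u => stageSize a h s u) (Set.Icc 0 T) := by
  unfold stageSize
  refine Continuous.integrableOn_Icc ?_
  split_ifs <;> fun_prop

/-- A node lasts at most for the time `t / h`; elsewhere the damping bounds the time. -/
lemma setIntegral_stageSize_le {a h t : ℝ} (ha : 0 < a) (hh : 0 < h) (ht : 0 < t) (s : Prop) :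
    ∫ u in Set.Icc 0 (h⁻¹ * t), stageSize a h s u ≤ t + 2 / a := by
  have h2 : 0 < 2 / a := by positivity
  by_cases hs : s
  · simp only [stageSize, hs, if_true]
    rw [setIntegral_const, measureReal_def, Real.volume_Icc, sub_zero,
      ENNReal.toReal_ofReal (by positivity), smul_eq_mul]
    rw [mul_right_comm, inv_mul_cancel₀ hh.ne', one_mul]
    linarith
  · simp only [stageSize, hs, if_false]
    rw [integral_Icc_eq_integral_Ioc]
    have h3 : (fun u : ℝ => Real.exp (-(a / 2 * u))) = fun u => Real.exp (-(a / 2) * u) := by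
      ext u
      rw [neg_mul]
    have hneg : -(a / 2) < 0 := by linarith
    rw [h3]
    calc _ ≤ ∫ u in Set.Ioi 0, Real.exp (-(a / 2) * u) :=
          setIntegral_mono_set (integrableOn_exp_mul_Ioi hneg 0)
            (Filter.Eventually.of_forall fun u => (Real.exp_pos _).le)
            Set.Ioc_subset_Ioi_self.eventuallyLE
      _ = 2 / a := by
          rw [integral_exp_mul_Ioi hneg, mul_zero, Real.exp_zero]
          field_simp
      _ ≤ _ := by linarith

/-- The integral over the time simplex is bounded by a product of one-dimensional integrals. -/
lemma sum_norm_setIntegral_le {ι : Type*} (I : Finset ι) {m : ℕ} {a h t K : ℝ} (ha : 0 < a)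
    (hh : 0 < h) (ht : 0 < t) (hK : 0 ≤ K) (s : Fin m → Prop) (F : ι → (Fin m → ℝ) → ℂ)
    (hF : ∀ v ∈ timeSimplex m (h⁻¹ * t),
      ∑ i ∈ I, ‖F i v‖ ≤ K * ∏ j, stageSize a h (s j) (v j)) :
    ∑ i ∈ I, ‖∫ v in timeSimplex m (h⁻¹ * t), F i v‖ ≤ K * (t + 2 / a) ^ m := by
  set T := h⁻¹ * t with hT
  set σ : Fin m → ℝ → ℝ := fun j => (Set.Icc 0 T).indicator fun u => stageSize a h (s j) u with hσ
  have hσ0 : ∀ j u, 0 ≤ σ j u := fun j u =>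
    Set.indicator_nonneg (fun u _ => (stageSize_pos hh _ u).le) u
  have hi : Integrable fun v : Fin m → ℝ => K * ∏ j, σ j (v j) :=
    (Integrable.fintype_prod (f := σ) fun j =>
      (integrableOn_stageSize a h (s j) T).integrable_indicator measurableSet_Icc).const_mul K
  simp_rw [← integral_indicator (measurableSet_timeSimplex T)]
  refine (sum_norm_integral_le I hi fun v => ?_).trans ?_
  · by_cases hv : v ∈ timeSimplex m T
    · simp_rw [Set.indicator_of_mem hv]
      refine (hF v hv).trans_eq ?_
      congr 1
      refine Finset.prod_congr rfl fun j _ => ?_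
      exact (Set.indicator_of_mem (s := Set.Icc 0 T)
        ⟨hv.1 j, le_of_mem_timeSimplex hv j⟩ _).symm
    · simp_rw [Set.indicator_of_notMem hv, norm_zero, Finset.sum_const_zero]
      exact mul_nonneg hK (Finset.prod_nonneg fun j _ => hσ0 j _)
  · rw [integral_const_mul, integral_fintype_prod_volume_eq_prod σ]
    have h1 : ∏ j, ∫ u, σ j u ≤ ∏ _j : Fin m, (t + 2 / a) := by
      refine Finset.prod_le_prod (fun j _ => integral_nonneg (hσ0 j)) fun j _ => ?_
      rw [hσ, integral_indicator measurableSet_Icc]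
      exact setIntegral_stageSize_le ha hh ht (s j)
    rw [Finset.prod_const, Finset.card_univ, Fintype.card_fin] at h1
    gcongr

/-! ### Scatterers, cut-off and diagonal tuples -/

lemma norm_le_normOneInf {lam : Space d → ℝ} (h : IsSpatialCutoff lam) (x : Space d) :
    ‖lam x‖ ≤ normOneInf lam := by
  have hc := h.smooth.continuous
  have hs : HasCompactSupport lam :=
    (isCompact_closedBall (0 : Space d) 1).of_isClosed_subset (isClosed_tsupport _) h.support
  have hL := (hc.memLp_top_of_hasCompactSupport hs volume).2
  set L := (eLpNorm lam ⊤ volume).toReal with hLdef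
  have hae : ∀ᵐ y, ‖lam y‖ ≤ L := by
    filter_upwards [ae_le_eLpNormEssSup (f := lam) (μ := volume)] with y hy
    rw [← eLpNorm_exponent_top] at hy
    have := ENNReal.toReal_mono hL.ne hy
    rwa [toReal_enorm] at this
  refine le_trans ?_ (le_max_right _ _)
  by_contra hx
  have hopen : IsOpen {y | ¬ ‖lam y‖ ≤ L} := by
    simp only [not_le]
    exact isOpen_lt continuous_const (by fun_prop)
  have := (hopen.measure_eq_zero_iff volume).1 (ae_iff.1 hae)
  exact Set.eq_empty_iff_forall_notMem.1 this x hx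

lemma normOneInf_nonneg (lam : Space d → ℝ) : 0 ≤ normOneInf lam :=
  ENNReal.toReal_nonneg.trans (le_max_left _ _)

lemma IsSpatialCutoff.eq_zero {lam : Space d → ℝ} (h : IsSpatialCutoff lam) {x : Space d}
    (hx : 1 < ‖x‖) : lam x = 0 := by
  by_contra hne
  have := h.support (subset_tsupport _ hne)
  rw [mem_closedBall_zero_iff] at this
  linarith

/-- A chain that changes its scatterer only at the nodes is diagonal. -/
lemma isDiagonal_of_chainDiagonal {ι : Type} {k : ℕ} {S : Finset (Fin (k + 1 + 1))}
    {q : Fin (k + 1) → ι} (x : ι → Space d)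
    (h : ChainDiagonal (fun i : Fin k => i.succ.castSucc ∈ S) (q 0) (Fin.tail q)) :
    IsDiagonal S fun i => x (q i) := by
  have hstep : ∀ i : Fin k, i.succ.castSucc ∉ S → q i.succ = q i.castSucc := by
    intro i hi
    have h1 := h i hi
    rw [Fin.cons_self_tail] at h1
    exact h1
  intro j l hjl _ hnot
  simp only
  congr 1
  have key : ∀ n : ℕ, ∀ l : Fin (k + 1), (l : ℕ) = n → j ≤ l →
      (∀ i : Fin (k + 1), j ≤ i → i < l → i.succ ∉ S) → q j = q l := by
    intro n
    induction n with
    | zero =>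
      intro l hl hjl _
      have : j = l := Fin.ext (by have : (j : ℕ) ≤ l := hjl; omega)
      rw [this]
    | succ n ih =>
      intro l hl hjl hnot
      rcases hjl.eq_or_lt with rfl | hlt
      · rfl
      · have hn : n < k := by have := l.2; omega
        have hl' : l = (⟨n, hn⟩ : Fin k).succ := Fin.ext (by simp [hl])
        have hlt' : (j : ℕ) < l := hlt
        rw [hl', hstep ⟨n, hn⟩]
        · refine ih _ (by simp) (Fin.le_def.2 ?_) fun i hji hi => hnot i hji ?_
          · simp only [Fin.val_castSucc]
            omega
          · rw [Fin.lt_def] at hi ⊢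
            simp only [Fin.val_castSucc] at hi
            omega
        · rw [← Fin.succ_castSucc]
          refine hnot _ (Fin.le_def.2 ?_) (Fin.lt_def.2 ?_) <;> simp only [Fin.val_castSucc] <;>
            omega
  exact key l l rfl hjl hnot

/-- The scatterers that are seen by the cut-off. -/
def visible (P : Set (Space d)) (r : ℝ) : Set (Space d) := {q ∈ P | ‖r ^ (d - 1) • q‖ ≤ 1}

lemma pow_mul_lt_two {P : Set (Space d)} {r bP : ℝ} (hP : IsSeparated P bP) (hr : 0 < r)
    (hne : ¬ (visible P r).Subsingleton) : r ^ (d - 1) * bP < 2 := by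
  rw [Set.not_subsingleton_iff] at hne
  obtain ⟨q, hq, q', hq', hqq⟩ := hne
  have h1 := hP q hq.1 q' hq'.1 hqq
  have h2 : ‖r ^ (d - 1) • q - r ^ (d - 1) • q'‖ ≤ 2 :=
    (norm_sub_le _ _).trans (by linarith [hq.2, hq'.2])
  rw [← smul_sub, norm_smul, Real.norm_of_nonneg (by positivity)] at h2
  have h3 : 0 < r ^ (d - 1) := by positivity
  nlinarith

lemma card_visible_le {P : Set (Space d)} {r bP : ℝ} (hP : IsSeparated P bP) (hr : 0 < r)
    (hb : 0 < bP) (h2 : r ^ (d - 1) * bP < 2) (s : Finset (Space d))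
    (hs : ∀ q ∈ s, q ∈ visible P r) : (s.card : ℝ) ≤ (4 * (r ^ (d - 1))⁻¹ / bP) ^ d := by
  have h3 : 0 < r ^ (d - 1) := by positivity
  refine card_le_of_separated s id hb (fun i hi j hj hij => hP i (hs i hi).1 j (hs j hj).1 hij)
    (fun i hi => ?_) ?_
  · have := (hs i hi).2
    rw [norm_smul, Real.norm_of_nonneg h3.le] at this
    rwa [id, ← one_div, le_div_iff₀' h3]
  · rw [← div_eq_mul_inv, le_div_iff₀' h3]
    exact h2.le

lemma finite_visible {P : Set (Space d)} {r bP : ℝ} (hP : IsSeparated P bP) (hr : 0 < r)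
    (hb : 0 < bP) : (visible P r).Finite := by
  by_contra hinf
  have hns : ¬ (visible P r).Subsingleton := fun h => hinf h.finite
  have h2 := pow_mul_lt_two hP hr hns
  obtain ⟨n, hn⟩ := exists_nat_gt ((4 * (r ^ (d - 1))⁻¹ / bP) ^ d)
  obtain ⟨s, hs, hcard⟩ := Set.Infinite.exists_subset_card_eq hinf n
  have := card_visible_le hP hr hb h2 s fun q hq => hs hq
  rw [hcard] at this
  linarith

/-! ### The bound for the nondiagonal term -/

open Classical in
/-- The sum over the nondiagonal tuples of visible scatterers. -/
lemma exists_sum_integral_integrand_le (hd : 3 ≤ d) {χ : Space d → ℝ} (hχ : IsRadialCutoff χ)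
    (W : 𝓢(Space d, ℂ)) (a b : 𝓢(Space d × Space d, ℂ)) {α t bP : ℝ} (hα : 0 < α) (ht : 0 < t)
    (hb : 0 < bP) :
    ∃ C : ℝ, 0 ≤ C ∧ ∀ Γ : Space d → ℝ, IsDampingProfile Γ → ∀ P : Set (Space d),
      IsSeparated P bP → ∀ r : ℝ, 0 < r → r ^ (d - 1) * bP < 2 → ∀ [Fintype (visible P r)] (k : ℕ)
      (γ : Fin (k + 1) → Fin 2) (S : Finset (Fin (k + 1 + 1))), 0 ∈ S → Fin.last (k + 1) ∈ S →
      ∑ q : Fin (k + 1) → visible P r with ¬ IsDiagonal S fun i => (q i : Space d),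
        ‖∫ x : Space d × Space d × (Fin (k + 1) → Space d),
          integrand W a b Γ χ α t r γ S (fun i => (q i : Space d)) x.1 x.2.1 x.2.2‖ ≤
        C ^ (k + 1) * r := by
  have hd0 : 0 < d := by omega
  have hdd : d - 1 + 1 = d := by omega
  set R := 1 + 2 / bP with hR
  have hb2 : 0 < 2 / bP := by positivity
  have hR1 : 1 ≤ R := by linarith
  obtain ⟨cS, hcS, hsum⟩ := exists_sum_decay_le (d := d) (δ := bP / R) (by positivity)
  obtain ⟨C, hC, hmain⟩ := exists_sum_startPair_chain_le (𝓕 W) a b hd0 (t := t) (H₀ := R ^ d)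
    (cS := cS) (cN := (4 / bP) ^ d) (cκ := 2) hα ht.le (by positivity) (by positivity) zero_le_two
  refine ⟨C * (t + 2 / α ^ d) * (1 + bP⁻¹), by positivity, ?_⟩
  intro Γ hΓ P hP r hr hrb _ k γ S hS0 hS1
  have hrd : 0 < r ^ (d - 1) := by positivity
  -- `R ^ (d - 1) ≥ R > 2 / bP`, so `R` bounds the admissible values of `r`
  have hrR : r ≤ R := by
    by_contra hlt
    have h1 : R ≤ r ^ (d - 1) := (le_self_pow₀ hR1 (by omega)).trans
      (pow_le_pow_left₀ (by linarith) (not_le.1 hlt).le _)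
    have h2 : 2 / bP < r ^ (d - 1) := by linarith
    rw [div_lt_iff₀ hb] at h2
    linarith
  set pos : visible P r → Space d := fun i => r⁻¹ • (i : Space d) with hpos
  have hdist : ∀ i j : visible P r, i ≠ j → r⁻¹ * bP < ‖pos i - pos j‖ := by
    intro i j hij
    rw [hpos, ← smul_sub, norm_smul, Real.norm_of_nonneg (by positivity)]
    have := hP i i.2.1 j j.2.1 (Subtype.coe_ne_coe.2 hij)
    gcongr
  have hs : Scatterers cS (r / bP) pos := by
    refine ⟨fun X => hsum Finset.univ pos (fun i _ j _ hij => lt_of_le_of_lt ?_ (hdist i j hij)) X,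
      fun i j hij => ?_⟩
    · rw [div_eq_inv_mul]
      gcongr
    · calc (1 : ℝ) = r / bP * (r⁻¹ * bP) := by field_simp
        _ ≤ _ := by
            have := (hdist i j hij).le
            gcongr
  have hcard : (r ^ d) ^ d * Fintype.card (visible P r) ≤ (4 / bP) ^ d * r ^ d := by
    have h1 := card_visible_le hP hr hb hrb (Finset.univ.map (Function.Embedding.subtype _))
      (fun q hq => by
        obtain ⟨i, -, rfl⟩ := Finset.mem_map.1 hq
        exact i.2)
    rw [Finset.card_map, Finset.card_univ] at h1
    calc _ ≤ (r ^ d) ^ d * (4 * (r ^ (d - 1))⁻¹ / bP) ^ d := by gcongr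
      _ = (4 / bP * r) ^ d := by
          rw [← mul_pow]
          congr 1
          nth_rewrite 1 [← hdd]
          rw [pow_succ]
          field_simp
      _ = _ := mul_pow _ _ _
  have hhκ : r ^ d ≤ 2 * (r / bP) := by
    rw [← hdd, pow_succ, mul_div_assoc', le_div_iff₀ hb]
    nlinarith
  have hg : ∀ i, gam γ i = 0 ∨ gam γ i = 1 := by
    intro i
    have h1 := (γ i).2
    have h2 : ((γ i : Fin 2) : ℕ) = 0 ∨ ((γ i : Fin 2) : ℕ) = 1 := by omega
    unfold gam
    rcases h2 with h | h <;> simp [h]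
  have hh : 0 < r ^ d := by positivity
  have hκ : 0 ≤ r / bP := by positivity
  simp_rw [integral_integrand W a b hΓ hχ hd0 hα t hr γ]
  calc _ ≤ (C ^ (k + 1) * (r / bP)) * (t + 2 / α ^ d) ^ (k + 1) := by
        refine sum_norm_setIntegral_le _ (by positivity) hh ht (by positivity)
          (fun i => i.succ ∈ S) _ fun v hv => ?_
        have hut : ∀ j, r ^ d * allTimes ((r ^ d)⁻¹ * t) v j ≤ t := fun j => by
          have h1 := allTimes_le hv j
          calc _ ≤ r ^ d * ((r ^ d)⁻¹ * t) := by gcongr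
            _ = t := mul_inv_cancel_left₀ hh.ne' t
        refine le_trans (Finset.sum_le_sum_of_subset_of_nonneg ?_ fun _ _ _ => norm_nonneg _)
          (hmain (r / bP) (r ^ d) pos hκ hs hh (by gcongr) hcard hhκ Γ χ hΓ hχ k (gam γ) hg S
            hS0 hS1 (allTimes ((r ^ d)⁻¹ * t) v) (allTimes_nonneg hv) hut)
        intro q hq
        rw [Finset.mem_filter] at hq ⊢
        exact ⟨hq.1, fun h => hq.2 (isDiagonal_of_chainDiagonal _ h)⟩
    _ = (C * (t + 2 / α ^ d)) ^ (k + 1) * bP⁻¹ * r := by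
        rw [mul_pow]
        ring
    _ ≤ (C * (t + 2 / α ^ d)) ^ (k + 1) * (1 + bP⁻¹) ^ (k + 1) * r := by
        have h1 : 0 < bP⁻¹ := by positivity
        gcongr
        refine le_trans ?_ (le_self_pow₀ (by linarith) (Nat.succ_ne_zero k))
        linarith
    _ = _ := by rw [← mul_pow]

/-- Tuples with a scatterer outside the support of the cut-off do not contribute. -/
lemma norm_nondiagonalTerm_le {m : ℕ} (P : Set (Space d)) {lam : Space d → ℝ}
    (hlam : IsSpatialCutoff lam) (W : 𝓢(Space d, ℂ)) (a b : 𝓢(Space d × Space d, ℂ))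
    (Γ χ : Space d → ℝ) (α t r : ℝ) (γ : Fin m → Fin 2)
    (S : Finset (Fin (m + 1))) [Fintype (visible P r)]
    [DecidablePred fun q : Fin m → visible P r => ¬ IsDiagonal S fun i => (q i : Space d)] :
    ‖nondiagonalTerm P lam W a b Γ χ α r t γ S‖ ≤ normOneInf lam ^ m *
      ∑ q : Fin m → visible P r with ¬ IsDiagonal S fun i => (q i : Space d),
        ‖∫ x : Space d × Space d × (Fin m → Space d),
          integrand W a b Γ χ α t r γ S (fun i => (q i : Space d)) x.1 x.2.1 x.2.2‖ := by
  set f : {q : Fin m → Space d // (∀ i, q i ∈ P) ∧ ¬ IsDiagonal S q} → ℂ := fun q =>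
    (∏ i, (lam (r ^ (d - 1) • q.1 i) : ℂ)) * ∫ v : Space d × Space d × (Fin m → Space d),
      integrand W a b Γ χ α t r γ S q.1 v.1 v.2.1 v.2.2 with hf
  set I := {q : Fin m → visible P r // ¬ IsDiagonal S fun i => (q i : Space d)}
  set φ : I → {q : Fin m → Space d // (∀ i, q i ∈ P) ∧ ¬ IsDiagonal S q} :=
    fun q => ⟨fun i => q.1 i, fun i => (q.1 i).2.1, q.2⟩ with hφ
  have hinj : Function.Injective φ := by
    intro q q' h
    have h1 := congrArg Subtype.val h
    exact Subtype.ext (funext fun i => Subtype.ext (congrFun h1 i))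
  have hsupp : Function.support f ⊆ Set.range φ := by
    intro q hq
    have hvis : ∀ i, q.1 i ∈ visible P r := by
      intro i
      refine ⟨q.2.1 i, ?_⟩
      by_contra hi
      refine hq ?_
      have h1 := hlam.eq_zero (not_le.1 hi)
      have h2 : ∏ i, (lam (r ^ (d - 1) • q.1 i) : ℂ) = 0 :=
        Finset.prod_eq_zero (Finset.mem_univ i) (by rw [h1, Complex.ofReal_zero])
      simp only [hf, h2, zero_mul]
    exact ⟨⟨fun i => ⟨q.1 i, hvis i⟩, q.2.2⟩, rfl⟩
  have hL := normOneInf_nonneg lam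
  have hterm : ∀ q, ‖f q‖ ≤ normOneInf lam ^ m *
      ‖∫ x : Space d × Space d × (Fin m → Space d),
        integrand W a b Γ χ α t r γ S q.1 x.1 x.2.1 x.2.2‖ := by
    intro q
    simp only [hf]
    rw [norm_mul]
    gcongr
    rw [norm_prod]
    calc _ ≤ ∏ _i : Fin m, normOneInf lam := by
          refine Finset.prod_le_prod (fun _ _ => norm_nonneg _) fun i _ => ?_
          rw [Complex.norm_real]
          exact norm_le_normOneInf hlam _
      _ = _ := by simp
  rw [nondiagonalTerm, ← hinj.tsum_eq hsupp, tsum_fintype]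
  refine (norm_sum_le _ _).trans ((Finset.sum_le_sum fun q _ => hterm (φ q)).trans_eq ?_)
  rw [← Finset.mul_sum, Finset.sum_subtype (p := fun q : Fin m → visible P r =>
    ¬ IsDiagonal S fun i => (q i : Space d)) _ (fun q => by simp)]

end Lorentz

end

theorem mainTheorem5 (d : ℕ) (hd : 3 ≤ d)
    (χ : Lorentz.Space d → ℝ) (hχ : Lorentz.IsRadialCutoff χ)
    (W : 𝓢(Lorentz.Space d, ℂ)) (a b : 𝓢(Lorentz.Space d × Lorentz.Space d, ℂ))
    (α t : ℝ) (hα : 0 < α) (ht : 0 < t) (bP : ℝ) (hbP : 0 < bP) :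
    ∃ C : ℝ, 0 < C ∧
      ∀ Γ : Lorentz.Space d → ℝ, Lorentz.IsDampingProfile Γ →
      ∀ P : Set (Lorentz.Space d), Lorentz.IsSeparated P bP →
      ∀ lam : Lorentz.Space d → ℝ, Lorentz.IsSpatialCutoff lam →
      ∀ r : ℝ, 0 < r →
      ∀ m : ℕ, 1 ≤ m →
      ∀ γ : Fin m → Fin 2,
      ∀ S : Finset (Fin (m + 1)), 0 ∈ S → Fin.last m ∈ S →
        ‖Lorentz.nondiagonalTerm P lam W a b Γ χ α r t γ S‖
          ≤ C ^ m * r * Real.logb 2 (1 + r ^ (1 - (d : ℤ)) * bP⁻¹) * Lorentz.normOneInf lam ^ m := by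
  classical
  obtain ⟨C, hC, hmain⟩ := Lorentz.exists_sum_integral_integrand_le hd hχ W a b hα ht hbP
  have hlog0 : 0 < Real.logb 2 (3 / 2) := Real.logb_pos (by norm_num) (by norm_num)
  set l := Real.logb 2 (3 / 2) with hl
  refine ⟨(1 + C) * (1 + l⁻¹), by positivity, ?_⟩
  intro Γ hΓ P hP lam hlam r hr m hm γ S hS0 hS1
  obtain ⟨k, rfl⟩ : ∃ k, m = k + 1 := ⟨m - 1, by omega⟩
  have hfin := Lorentz.finite_visible hP hr hbP
  have : Fintype (Lorentz.visible P r) := hfin.fintype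
  have hL := Lorentz.normOneInf_nonneg lam
  have hrpow : r ^ (1 - (d : ℤ)) = (r ^ (d - 1))⁻¹ := by
    rw [show (1 - (d : ℤ)) = -((d - 1 : ℕ) : ℤ) by omega, zpow_neg, zpow_natCast]
  have hrd : 0 < r ^ (d - 1) := by positivity
  have hnn : 0 ≤ Real.logb 2 (1 + r ^ (1 - (d : ℤ)) * bP⁻¹) := by
    refine Real.logb_nonneg (by norm_num) ?_
    have : 0 ≤ r ^ (1 - (d : ℤ)) * bP⁻¹ := by positivity
    linarith
  refine (Lorentz.norm_nondiagonalTerm_le P hlam W a b Γ χ α t r γ S).trans ?_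
  by_cases hsub : (Lorentz.visible P r).Subsingleton
  · -- with at most one visible scatterer every tuple is diagonal
    rw [Finset.filter_false_of_mem, Finset.sum_empty, mul_zero]
    · positivity
    · intro q _ hq
      exact hq fun j k _ _ _ => hsub (q j).2 (q k).2
  · have h2 := Lorentz.pow_mul_lt_two hP hr hsub
    have hlog : l ≤ Real.logb 2 (1 + r ^ (1 - (d : ℤ)) * bP⁻¹) := by
      refine Real.logb_le_logb_of_le (by norm_num) (by norm_num) ?_
      rw [hrpow, ← mul_inv]
      have h3 : (2 : ℝ)⁻¹ ≤ (r ^ (d - 1) * bP)⁻¹ := by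
        gcongr
      linarith
    have hl1 : 1 ≤ (1 + l⁻¹) ^ (k + 1) * Real.logb 2 (1 + r ^ (1 - (d : ℤ)) * bP⁻¹) := by
      have h4 : l⁻¹ ≤ (1 + l⁻¹) ^ (k + 1) := by
        have h5 : 0 < l⁻¹ := by positivity
        refine le_trans ?_ (le_self_pow₀ (by linarith) (Nat.succ_ne_zero k))
        linarith
      calc (1 : ℝ) = l⁻¹ * l := (inv_mul_cancel₀ hlog0.ne').symm
        _ ≤ _ := by gcongr
    have h1 := hmain Γ hΓ P hP r hr h2 k γ S hS0 hS1
    calc _ ≤ Lorentz.normOneInf lam ^ (k + 1) * (C ^ (k + 1) * r) := by gcongr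
      _ ≤ Lorentz.normOneInf lam ^ (k + 1) * ((1 + C) ^ (k + 1) * r) := by
          gcongr
          linarith
      _ = Lorentz.normOneInf lam ^ (k + 1) * ((1 + C) ^ (k + 1) * r) * 1 := (mul_one _).symm
      _ ≤ Lorentz.normOneInf lam ^ (k + 1) * ((1 + C) ^ (k + 1) * r) *
          ((1 + l⁻¹) ^ (k + 1) * Real.logb 2 (1 + r ^ (1 - (d : ℤ)) * bP⁻¹)) := by gcongr
      _ = _ := by rw [mul_pow]; ring
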